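/- **Surplus.** Let $V$ be a finite set. A multihypergraph on $V$ is a finite multiset $H$ of subsets of $V$ (hyperedges). A 2-cut is a map $\varphi:V\to\{1,2\}$; its size is the number of hyperedges of $H$, counted with multiplicity, that meet both parts. The surplus $\mathrm{surp}(H)$ is the maximum size of a 2-cut minus the expected size of a uniformly random 2-cut. **Definition.** Let $k\in\mathbb N$, let $m,\Delta,D,\Lambda,\lambda\ge 1$ be reals and let $C_1,c_2,c_3,C_4>0$. A random multihypergraph $H=(V,R)$ is a *random $(m,\Delta,D,\Lambda,\lambda,k)$-multihypergraph of general type* with constants $C_1,c_2,c_3,C_4$ if the following hold. 1. There are finite multisets $X,Y$ of subsets of $V$ of size at most $k$ (their members are called potential hyperedges; different members may have the same vertex set), and $R$ is a random subset of $X\cup Y$ defined as follows: there are a set $\mathcal S$, independent random variables $(Z_i)_{i\in\mathcal S}$ and, for each $e\in X\cup Y$, a set $S_e\subseteq\mathcal S$ with $|S_e|\le k$ such that the event $e\in R$ is a function of $\{Z_i:i\in S_e\}$. 2. $|X\cup Y|\le C_1m$ and $|Y|\ge c_2\,m/\log m$. 3. There is a random subset $T\subseteq Y$ such that for every $e\in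 Y$ the event $e\in T$ is a function of $\{Z_i:i\in S_e\}$. 4. For any $e_1,\dots,e_j,f\in Y$ with $S_f\not\subseteq S_{e_1}\cup\dots\cup S_{e_j}$, the event $f\in T$ is independent of the events $e_1\in T,\dots,e_j\in T$. 5. For any $e\in X\cup Y$ and $f,g\in Y$ with $S_g\not\subseteq S_e\cup S_f$, the event $g\in T$ is independent of the events $e\in R$, $f\in T$. 6. $\mathbb P(e\in R,f\in T)\ge\mathbb P(e\in R)\,\mathbb P(f\in T)$ for all $e\in X\cup Y$, $f\in Y$. 7. $\mathbb P(e\in R,f\in T)-\mathbb P(e\in R)\,\mathbb P(f\in T)\ge c_3$ for all $e,f\in Y$ with $S_e=S_f$. 8. Every $e\in Y$ has $|e|=2$, and $|S_e|$ is the same for all $e\in Y$. 9. Every vertex lies in at most $\Delta$ potential hyperedges $e\in X\cup Y$. 10. For distinct $u,v\in V$ at most $D$ potential hyperedges $e\in X\cup Y$ contain both $u$ and $v$; for every $u\in V$, $i\in\mathcal S$ at most $D$ elements $e\in Y$ satisfy $u\in e$ and $i\in S_e$. 11. For every $e\in Y$ there are at most $\Lambda\lambda$ elements $f\in Y$ with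 $S_f=S_e$. 12. For every $e\in Y$ the number of $f\in Y$ with the same vertex set as $e$ and $S_f=S_e$ is at least $\lambda/2$ and at most $\lambda$. 13. With probability at least $1-m^{-10}$, for all distinct $u,v\in V$: $|B(u,v)-\mathbb E[B(u,v)]|\le C_4(\log m)^{k/2}\lambda^{1/2}e_g(u,v)^{1/2}$, where $B(u,v)$ and $e_g(u,v)$ are the numbers of elements of $T$ and of $Y$, respectively, with vertex set $\{u,v\}$. Here an event $A$ is independent of events $A_1,\dots,A_\ell$ if $\mathbb P(A\cap B_1\cap\dots\cap B_\ell)=\mathbb P(A)\,\mathbb P(B_1\cap\dots\cap B_\ell)$ whenever each $B_i\in\{A_i,A_i^c\}$. **Theorem.** Fix $k\in\mathbb N$ and $C_1,c_2,c_3,C_4>0$. There are constants $c,C>0$, depending only on $k,C_1,c_2,c_3,C_4$, such that for all reals $m,\Delta,D,\Lambda,\lambda\ge1$, every random $(m,\Delta,D,\Lambda,\lambda,k)$-multihypergraph $H=(V,R)$ of general type with constants $C_1,c_2,c_3,C_4$, and every $\beta\ge(\log m)^{(k+1)/2}\sqrt{\Delta\lambda}$, the random variable $\mathrm{surp}(H)$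 is integrable and $$\mathbb E[\mathrm{surp}(H)]\;\ge\;c\,\frac{m\lambda}{\beta\log m}\;-\;C\left(\frac{m\Lambda\lambda D}{\beta^2}+\frac{mD^3\lambda}{\beta^4}\right).$$ (In the degenerate case $m=1$, where $\log m=0$, every quotient whose denominator is $0$ is read as $0$.) -/

import Mathlib

open MeasureTheory ProbabilityTheory

section Surplus

variable {V : Type*}

/-- A hyperedge is cut by a 2-colouring of the vertices if it meets both parts. -/
def IsCutBy (φ : V → Bool) (e : Finset V) : Prop :=
  (∃ u ∈ e, φ u = true) ∧ (∃ v ∈ e, φ v = false)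

open Classical in
/-- The size of the 2-cut `φ` in the multihypergraph on `V` whose edge multiset is `H`
(edges are counted with multiplicity). -/
noncomputable def cutSize (H : Multiset (Finset V)) (φ : V → Bool) : ℕ :=
  Multiset.card (H.filter (fun e => IsCutBy φ e))

open Classical in
/-- The expected size of a uniformly random 2-cut. -/
noncomputable def meanCutSize [Fintype V] (H : Multiset (Finset V)) : ℝ :=
  (∑ φ : V → Bool, (cutSize H φ : ℝ)) / (Fintype.card (V → Bool) : ℝ)

/-- The 2-surplus: the maximum over all 2-cuts of (size of the cut) minus
(expected size of a random 2-cut). The supremum runs over a finite non-empty family. -/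
noncomputable def surp [Fintype V] (H : Multiset (Finset V)) : ℝ :=
  ⨆ φ : V → Bool, ((cutSize H φ : ℝ) - meanCutSize H)

end Surplus

/-- The event `A` is independent of the events `B 0, …, B (n - 1)`: for every choice of
`B' i ∈ {B i, (B i)ᶜ}` one has `ℙ(A, B' 0, …, B' (n-1)) = ℙ(A) ℙ(B' 0, …, B' (n-1))`. -/
def EventIndepOf {Ω : Type*} [MeasurableSpace Ω] (μ : Measure Ω) (A : Set Ω) {n : ℕ}
    (B : Fin n → Set Ω) : Prop :=
  ∀ B' : Fin n → Set Ω, (∀ i, B' i = B i ∨ B' i = (B i)ᶜ) →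
    μ.real (A ∩ ⋂ i, B' i) = μ.real A * μ.real (⋂ i, B' i)

/-- The data behind a random multihypergraph on `V`. Elements of `ι` label the members of the
multisets `X` and `Y` of potential hyperedges, so that two different potential
hyperedges may have the same vertex set; `verts e` is the vertex set of `e`, `colours e` is the
set of colours `S_e`, `Z i` is the random variable attached to the colour `i`, and `R`, `T` are the
random sets of potential hyperedges. -/
structure PotentialHyperedges (V ι 𝓢 Ω : Type*) (α : 𝓢 → Type*) where
  X : Finset ι
  Y : Finset ι
  verts : ι → Finset V
  colours : ι → Finset 𝓢
  Z : (i : 𝓢) → Ω → α i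
  R : Ω → Finset ι
  T : Ω → Finset ι

namespace PotentialHyperedges

variable {V ι 𝓢 Ω : Type*} {α : 𝓢 → Type*}

open Classical in
/-- The collection `X ∪ Y` of all potential hyperedges. -/
noncomputable def all (G : PotentialHyperedges V ι 𝓢 Ω α) : Finset ι := G.X ∪ G.Y

/-- The edge multiset of the random multihypergraph `H = (V, R)` at the outcome `ω`. -/
def hypergraph (G : PotentialHyperedges V ι 𝓢 Ω α) (ω : Ω) : Multiset (Finset V) :=
  (G.R ω).val.map G.verts

/-- The event `e ∈ R`. -/
def inR (G : PotentialHyperedges V ι 𝓢 Ω α) (e : ι) : Set Ω := {ω | e ∈ G.R ω}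

/-- The event `e ∈ T`. -/
def inT (G : PotentialHyperedges V ι 𝓢 Ω α) (e : ι) : Set Ω := {ω | e ∈ G.T ω}

open Classical in
/-- `B(u, v)`: the number of potential edges in `T` with vertex set `{u, v}`. -/
noncomputable def countT (G : PotentialHyperedges V ι 𝓢 Ω α) (u v : V) (ω : Ω) : ℝ :=
  (((G.T ω).filter (fun e => G.verts e = {u, v})).card : ℝ)

open Classical in
/-- `e_g(u, v)`: the number of potential edges in `Y` with vertex set `{u, v}`. -/
noncomputable def countY (G : PotentialHyperedges V ι 𝓢 Ω α) (u v : V) : ℝ :=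
  ((G.Y.filter (fun e => G.verts e = {u, v})).card : ℝ)

/-- The σ-algebra generated by the random variables `Z i` with `i ∈ S`. An event is a
function of `{Z i : i ∈ S}` if it belongs to this σ-algebra. -/
abbrev colourAlgebra [∀ i, MeasurableSpace (α i)] (G : PotentialHyperedges V ι 𝓢 Ω α)
    (S : Finset 𝓢) : MeasurableSpace Ω :=
  ⨆ i ∈ S, MeasurableSpace.comap (G.Z i) inferInstance

open Classical in
/-- `H = (V, R)` is a random `(m, Δ, D, Λ, lam, k)`-multihypergraph of general type, where
`C₁, c₂, c₃, C₄` are the constants implicit in, respectively, `|X ∪ Y| = O(m)`,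
`|Y| = Ω(m / log m)`, the correlation gain `Ω(1)` and the concentration condition. -/
structure IsGeneralType [MeasurableSpace Ω] [∀ i, MeasurableSpace (α i)]
    (G : PotentialHyperedges V ι 𝓢 Ω α) (μ : Measure Ω)
    (m Δ D Λ lam : ℝ) (k : ℕ) (C₁ c₂ c₃ C₄ : ℝ) : Prop where
  card_verts_le : ∀ e ∈ G.all, (G.verts e).card ≤ k
  card_colours_le : ∀ e ∈ G.all, (G.colours e).card ≤ k
  measurable_Z : ∀ i, Measurable (G.Z i)
  indep_Z : iIndepFun G.Z μ
  R_subset : ∀ ω, G.R ω ⊆ G.all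
  R_function : ∀ e ∈ G.all, MeasurableSet[G.colourAlgebra (G.colours e)] (G.inR e)
  card_all_le : (G.all.card : ℝ) ≤ C₁ * m
  le_card_Y : c₂ * (m / Real.log m) ≤ (G.Y.card : ℝ)
  T_subset : ∀ ω, G.T ω ⊆ G.Y
  T_function : ∀ e ∈ G.Y, MeasurableSet[G.colourAlgebra (G.colours e)] (G.inT e)
  indep_T : ∀ (j : ℕ) (e : Fin j → ι) (f : ι), (∀ i, e i ∈ G.Y) → f ∈ G.Y →
    ¬ (G.colours f ⊆ Finset.univ.biUnion (fun i => G.colours (e i))) →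
    EventIndepOf μ (G.inT f) (fun i => G.inT (e i))
  indep_T_R_T : ∀ e ∈ G.all, ∀ f ∈ G.Y, ∀ g ∈ G.Y,
    ¬ (G.colours g ⊆ G.colours e ∪ G.colours f) →
    EventIndepOf μ (G.inT g) ![G.inR e, G.inT f]
  correlation : ∀ e ∈ G.all, ∀ f ∈ G.Y,
    μ.real (G.inR e) * μ.real (G.inT f) ≤ μ.real (G.inR e ∩ G.inT f)
  correlation_gain : ∀ e ∈ G.Y, ∀ f ∈ G.Y, G.colours e = G.colours f →
    c₃ ≤ μ.real (G.inR e ∩ G.inT f) - μ.real (G.inR e) * μ.real (G.inT f)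
  card_verts_Y : ∀ e ∈ G.Y, (G.verts e).card = 2
  card_colours_Y : ∀ e ∈ G.Y, ∀ f ∈ G.Y, (G.colours e).card = (G.colours f).card
  degree_le : ∀ u : V, ((G.all.filter (fun e => u ∈ G.verts e)).card : ℝ) ≤ Δ
  codegree_le : ∀ u v : V, u ≠ v →
    ((G.all.filter (fun e => u ∈ G.verts e ∧ v ∈ G.verts e)).card : ℝ) ≤ D
  colour_codegree_le : ∀ (u : V) (i : 𝓢),
    ((G.Y.filter (fun e => u ∈ G.verts e ∧ i ∈ G.colours e)).card : ℝ) ≤ D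
  same_colours_le : ∀ e ∈ G.Y,
    ((G.Y.filter (fun f => G.colours e = G.colours f)).card : ℝ) ≤ Λ * lam
  multiplicity : ∀ e ∈ G.Y,
    lam / 2 ≤ ((G.Y.filter (fun f => G.verts e = G.verts f ∧
      G.colours e = G.colours f)).card : ℝ) ∧
    ((G.Y.filter (fun f => G.verts e = G.verts f ∧
      G.colours e = G.colours f)).card : ℝ) ≤ lam
  concentration : 1 - m ^ (-10 : ℤ) ≤ μ.real {ω | ∀ u v : V, u ≠ v →
    |G.countT u v ω - ∫ ω', G.countT u v ω' ∂μ| ≤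
      C₄ * (Real.log m) ^ ((k : ℝ) / 2) * Real.sqrt lam * Real.sqrt (G.countY u v)}

end PotentialHyperedges

/-! Let `M` be the symmetric random matrix with entries `B(u,v) - 𝔼 B(u,v)`. Give the vertex `v` the
vector `e_v - M_v / β`, rescaled and padded by a private coordinate so that all vectors have the
same small norm. The inner products of distinct vectors are then proportional to the entries of `-2
M / β + M ^ 2 / β ^ 2`. Draw a Gaussian vector `g` and colour the vertices independently with means
`sin ⟨x_v, g⟩`. Products of sines are combinations of exponentials, so the Gaussian average is
explicit: up to a quadratic error, the gain of a hyperedge over a uniform cut is a negative multiple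
of the sum of the inner products over its pairs (`abs_integral_prod_one_add_sin_sub_le`,
`gram_le_surp`, `gramEntry_le_surp`). Pairs with large `M u v` thus tend to be separated.

Averaging over the hypergraph leaves four moments. In the linear one, `e ∈ R` is never negatively
correlated with `T`, and every `e ∈ Y` gains order `lam` from the edges parallel to it with the same
colours (`le_integral_linear`); as `|Y|` has order at least `m / log m`, this is the main term. In
the other three, the independence hypotheses kill every mixed moment in which the colour set of some
edge of `Y` is not covered by those of the other edges. Colour sets in `Y` have equal size, so in
the surviving paths and closed 4-walks the colour sets either coincide in pairs or are linked by
intersections. The degree and codegree conditions count both types (`abs_integral_quadratic_le`,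
`integral_sum_discr_sq_le`, `integral_sum_discrSq_sq_le`).

The vectors exist only if the rows of `M` have squared norm `O(β ^ 2)`. Concentration gives this
outside an event of probability at most `m ^ (-10)`, on which the surplus is still nonnegative and
trivial bounds for the gains suffice (`le_integral_surp`). -/

/-! ### Gaussian averages of products of `1 ± sin` -/

section GaussianRounding

/-- The characteristic function of a standard Gaussian vector. -/
lemma integral_cexp_pi_gaussianReal {W : Type*} [Fintype W] (t : W → ℝ) :
    ∫ g : W → ℝ, Complex.exp (Complex.I * ((∑ w, t w * g w : ℝ) : ℂ))
      ∂(Measure.pi fun _ => gaussianReal 0 1) = Complex.exp ((-(∑ w, t w ^ 2) / 2 : ℝ) : ℂ) := by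
  have h1 : ∀ g : W → ℝ, Complex.exp (Complex.I * ((∑ w, t w * g w : ℝ) : ℂ))
      = ∏ w, Complex.exp ((t w : ℂ) * (g w : ℂ) * Complex.I) := by
    intro g
    rw [← Complex.exp_sum]
    congr 1
    push_cast
    rw [Finset.mul_sum]
    exact Finset.sum_congr rfl fun w _ => by ring
  simp_rw [h1]
  rw [integral_fintype_prod_eq_prod (𝕜 := ℂ)
    (fun w (y : ℝ) => Complex.exp ((t w : ℂ) * (y : ℂ) * Complex.I))]
  have h2 : ∀ w, ∫ y : ℝ, Complex.exp ((t w : ℂ) * (y : ℂ) * Complex.I) ∂(gaussianReal 0 1)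
      = Complex.exp (((-(t w ^ 2) / 2 : ℝ) : ℂ)) := by
    intro w
    have := charFun_gaussianReal (μ := 0) (v := 1) (t w)
    rw [charFun_apply_real] at this
    rw [this]
    congr 1
    push_cast
    simp
    ring
  rw [Finset.prod_congr rfl fun w _ => h2 w, ← Complex.exp_sum]
  congr 1
  push_cast
  rw [neg_div, Finset.sum_div, ← Finset.sum_neg_distrib]
  exact Finset.sum_congr rfl fun w _ => by ring

variable {J W : Type*} [Fintype J] [Fintype W]

lemma sum_sq_signed_combination (x : J → W → ℝ) (N : ℝ) (hN : ∀ j, ∑ w, x j w ^ 2 = N)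
    (ρ : J → J → ℝ) (hρ0 : ∀ j, ρ j j = 0) (hρ : ∀ j l, j ≠ l → ρ j l = ∑ w, x j w * x l w)
    (s : J → ℝ) :
    ∑ w, (∑ j, s j * x j w) ^ 2 = N * ∑ j, s j ^ 2 + ∑ j, ∑ l, s j * s l * ρ j l := by
  classical
  have h1 : ∀ w, (∑ j, s j * x j w) ^ 2 = ∑ j, ∑ l, s j * s l * (x j w * x l w) := by
    intro w
    rw [sq, Finset.sum_mul_sum]
    exact Finset.sum_congr rfl fun j _ => Finset.sum_congr rfl fun l _ => by ring
  simp_rw [h1]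
  rw [Finset.sum_comm, Finset.mul_sum, ← Finset.sum_add_distrib]
  refine Finset.sum_congr rfl fun j _ => ?_
  rw [Finset.sum_comm]
  have h2 : ∀ l, ∑ w, s j * s l * (x j w * x l w)
      = (if j = l then N * s j ^ 2 else 0) + s j * s l * ρ j l := by
    intro l
    rw [← Finset.mul_sum]
    split_ifs with h
    · subst h
      rw [hρ0, ← hN j]
      simp_rw [← sq]
      ring
    · rw [hρ j l h]; ring
  simp_rw [h2]
  rw [Finset.sum_add_distrib]
  simp

/-- The exponents in the expansion of `1 + δ sin` into exponentials. -/
def sinSign : Fin 3 → ℝ := ![0, 1, -1]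

/-- The coefficients in the expansion of `1 + δ sin` into exponentials. -/
noncomputable def sinCoeff (δ : ℝ) : Fin 3 → ℂ :=
  ![1, δ / (2 * Complex.I), -(δ / (2 * Complex.I))]

lemma one_add_sin_eq_sum (δ y : ℝ) :
    ((1 + δ * Real.sin y : ℝ) : ℂ)
      = ∑ σ, sinCoeff δ σ * Complex.exp (Complex.I * ((sinSign σ * y : ℝ) : ℂ)) := by
  have hI := Complex.I_ne_zero
  simp [Fin.sum_univ_three, sinCoeff, sinSign, Complex.sin]
  rw [mul_comm (y : ℂ) Complex.I]
  field_simp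
  linear_combination (δ * (Complex.exp (-(Complex.I * y)) - Complex.exp (Complex.I * y)))
    * Complex.I_sq

/-- The coefficients `sinCoeff` after damping by a Gaussian factor. -/
noncomputable def dampedCoeff (δ N : ℝ) (σ : Fin 3) : ℂ :=
  sinCoeff δ σ * ((Real.exp (-(N * sinSign σ ^ 2) / 2) : ℝ) : ℂ)

lemma sum_dampedCoeff (δ N : ℝ) : ∑ σ, dampedCoeff δ N σ = 1 := by
  simp [Fin.sum_univ_three, dampedCoeff, sinCoeff, sinSign]

/-- The sum is purely imaginary, so its square is negative. This sign turns `-q` in the expansion of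
`exp (-q)` into a positive multiple of the inner products, the same for both values of `δ`. -/
lemma sum_dampedCoeff_mul_sign_sq (δ N : ℝ) (hδ : δ ^ 2 = 1) :
    (∑ σ, dampedCoeff δ N σ * (sinSign σ : ℂ)) ^ 2 = -((Real.exp (-N) : ℝ) : ℂ) := by
  have h : (∑ σ, dampedCoeff δ N σ * (sinSign σ : ℂ))
      = δ / Complex.I * ((Real.exp (-N / 2) : ℝ) : ℂ) := by
    simp only [Fin.sum_univ_three, dampedCoeff, sinCoeff, sinSign, Matrix.cons_val_zero,
      Matrix.cons_val_one, Matrix.cons_val]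
    have hI := Complex.I_ne_zero
    norm_num
    field_simp
    linear_combination (2 * (δ : ℂ)) * Complex.I_sq
  rw [h, mul_pow, div_pow, Complex.I_sq, ← Complex.ofReal_pow, ← Complex.ofReal_pow, hδ,
    ← Real.exp_nat_mul]
  norm_num
  congr 1
  ring

lemma sum_norm_dampedCoeff_le (δ N : ℝ) (hδ : δ ^ 2 = 1) (hN : 0 ≤ N) :
    ∑ σ, ‖dampedCoeff δ N σ‖ ≤ 2 := by
  have h1 : |δ| = 1 := by
    rw [← sq_eq_sq₀ (abs_nonneg δ) zero_le_one, sq_abs, hδ, one_pow]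
  have h2 : Real.exp (-N / 2) ≤ 1 := Real.exp_le_one_iff.2 (by linarith)
  simp [Fin.sum_univ_three, dampedCoeff, sinCoeff, sinSign, h1]
  simp only [Complex.norm_exp]
  norm_num
  linarith

/-- The sum factorises over the indices, and every index other than `j` and `l` contributes `∑ σ, b
σ = 1`. -/
lemma sum_prod_mul_sign [DecidableEq J] (b : Fin 3 → ℂ) (hb : ∑ σ, b σ = 1) {j l : J}
    (hjl : j ≠ l) :
    ∑ ε : J → Fin 3, (∏ i, b (ε i)) * ((sinSign (ε j) : ℂ) * (sinSign (ε l) : ℂ))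
      = (∑ σ, b σ * (sinSign σ : ℂ)) ^ 2 := by
  have h1 : ∀ ε : J → Fin 3,
      (∏ i, b (ε i)) * ((sinSign (ε j) : ℂ) * (sinSign (ε l) : ℂ))
      = ∏ i, (b (ε i) * (if i = j then (sinSign (ε i) : ℂ) else 1)
          * (if i = l then (sinSign (ε i) : ℂ) else 1)) := by
    intro ε
    rw [Finset.prod_mul_distrib, Finset.prod_mul_distrib]
    simp [mul_assoc]
  simp_rw [h1]
  rw [← Fintype.prod_sum (fun i σ => b σ * (if i = j then (sinSign σ : ℂ) else 1)
          * (if i = l then (sinSign σ : ℂ) else 1))]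
  have h2 : ∀ i, ∑ σ, (b σ * (if i = j then (sinSign σ : ℂ) else 1)
          * (if i = l then (sinSign σ : ℂ) else 1))
      = (if i = j then ∑ σ, b σ * (sinSign σ : ℂ) else 1)
        * (if i = l then ∑ σ, b σ * (sinSign σ : ℂ) else 1) := by
    intro i
    by_cases hj : i = j
    · have hl : i ≠ l := fun h => hjl (hj.symm.trans h)
      simp [hj, hjl]
    · by_cases hl : i = l <;> simp [hj, hl, hb]
      · simp [hjl.symm]
  simp_rw [h2]
  rw [Finset.prod_mul_distrib]
  simp [sq]

/-- For vectors of equal norm and small inner products, the expectation of a product of factors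
`1 ± sin` of the associated Gaussian variables, up to a quadratic error. -/
lemma abs_integral_prod_one_add_sin_sub_le (x : J → W → ℝ) (N : ℝ) (hN0 : 0 ≤ N)
    (hN : ∀ j, ∑ w, x j w ^ 2 = N)
    (ρ : J → J → ℝ) (hρ0 : ∀ j, ρ j j = 0) (hρ : ∀ j l, j ≠ l → ρ j l = ∑ w, x j w * x l w)
    (hJ : (Fintype.card J : ℝ) ^ 2 * N ≤ 2) (δ : ℝ) (hδ : δ ^ 2 = 1) :
    |(∫ g : W → ℝ, ∏ j, (1 + δ * Real.sin (∑ w, x j w * g w))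
        ∂(Measure.pi fun _ => gaussianReal 0 1))
      - (1 + Real.exp (-N) / 2 * ∑ j, ∑ l, ρ j l)|
      ≤ 2 ^ (Fintype.card J) * ((Fintype.card J : ℝ) ^ 2 * ∑ j, ∑ l, ρ j l ^ 2) := by
  classical
  set n : ℝ := (Fintype.card J : ℝ) with hn
  set q : (J → Fin 3) → ℝ := fun ε =>
    (∑ j, ∑ l, sinSign (ε j) * sinSign (ε l) * ρ j l) / 2 with hq
  set Q : ℝ := n ^ 2 * ∑ j, ∑ l, ρ j l ^ 2 with hQ
  have hs : ∀ σ, |sinSign σ| ≤ 1 := by intro σ; fin_cases σ <;> simp [sinSign]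
  -- the integral as an explicit sum
  have hint : ((∫ g : W → ℝ, ∏ j, (1 + δ * Real.sin (∑ w, x j w * g w))
        ∂(Measure.pi fun _ => gaussianReal 0 1) : ℝ) : ℂ)
      = ∑ ε : J → Fin 3, (∏ j, dampedCoeff δ N (ε j)) * ((Real.exp (-q ε) : ℝ) : ℂ) := by
    rw [← integral_complex_ofReal]
    have h1 : ∀ g : W → ℝ, ((∏ j, (1 + δ * Real.sin (∑ w, x j w * g w)) : ℝ) : ℂ)
        = ∑ ε : J → Fin 3, (∏ j, sinCoeff δ (ε j)) *
          Complex.exp (Complex.I *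
            ((∑ w, (∑ j, sinSign (ε j) * x j w) * g w : ℝ) : ℂ)) := by
      intro g
      rw [Complex.ofReal_prod]
      simp_rw [one_add_sin_eq_sum]
      rw [Fintype.prod_sum]
      refine Finset.sum_congr rfl fun ε _ => ?_
      rw [Finset.prod_mul_distrib, ← Complex.exp_sum, ← Finset.mul_sum, ← Complex.ofReal_sum]
      congr 4
      simp_rw [Finset.sum_mul, Finset.mul_sum]
      rw [Finset.sum_comm]
      exact Finset.sum_congr rfl fun w _ => Finset.sum_congr rfl fun j _ => by ring
    simp_rw [h1]
    rw [integral_finsetSum]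
    · refine Finset.sum_congr rfl fun ε _ => ?_
      rw [integral_const_mul, integral_cexp_pi_gaussianReal, sum_sq_signed_combination x N hN ρ hρ0 hρ]
      simp only [dampedCoeff]
      rw [Finset.prod_mul_distrib, mul_assoc, ← Complex.ofReal_prod, ← Complex.ofReal_mul,
        ← Real.exp_sum, ← Real.exp_add, ← Complex.ofReal_exp]
      congr 3
      simp only [hq]
      rw [neg_div, add_div, Finset.mul_sum, Finset.sum_div]
      simp_rw [neg_div]
      rw [Finset.sum_neg_distrib]
      ring
    · intro ε _
      refine Integrable.const_mul ?_ _
      refine Integrable.of_bound (C := 1) ?_ ?_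
      · refine Continuous.aestronglyMeasurable ?_
        fun_prop
      · refine Filter.Eventually.of_forall fun g => ?_
        rw [mul_comm, Complex.norm_exp_ofReal_mul_I]
  -- bounds on `q`
  have hρle : ∀ j l, |ρ j l| ≤ N := by
    intro j l
    by_cases h : j = l
    · rw [h, hρ0]; simpa using hN0
    · rw [hρ j l h, abs_le]
      have h1 : ∑ w, x j w * x l w ≤ ∑ w, (x j w ^ 2 + x l w ^ 2) / 2 :=
        Finset.sum_le_sum fun w _ => by nlinarith [sq_nonneg (x j w - x l w)]
      have h2 : -∑ w, x j w * x l w ≤ ∑ w, (x j w ^ 2 + x l w ^ 2) / 2 := by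
        rw [← Finset.sum_neg_distrib]
        exact Finset.sum_le_sum fun w _ => by nlinarith [sq_nonneg (x j w + x l w)]
      have h3 : ∑ w, (x j w ^ 2 + x l w ^ 2) / 2 = N := by
        rw [← Finset.sum_div, Finset.sum_add_distrib, hN, hN]; ring
      constructor <;> linarith
  have hqabs : ∀ ε, |q ε| ≤ (∑ j, ∑ l, |ρ j l|) / 2 := by
    intro ε
    simp only [hq]
    rw [abs_div, abs_two]
    gcongr
    refine (Finset.abs_sum_le_sum_abs _ _).trans (Finset.sum_le_sum fun j _ => ?_)
    refine (Finset.abs_sum_le_sum_abs _ _).trans (Finset.sum_le_sum fun l _ => ?_)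
    rw [abs_mul, abs_mul]
    calc |sinSign (ε j)| * |sinSign (ε l)| * |ρ j l| ≤ 1 * 1 * |ρ j l| := by
          gcongr <;> exact hs _
      _ = _ := by ring
  -- The hypothesis `n ^ 2 * N ≤ 2` is what places `q` in the range where `|exp (-q) - 1 + q| ≤ q ^
  -- 2`.
  have hq1 : ∀ ε, |q ε| ≤ 1 := by
    intro ε
    refine (hqabs ε).trans ?_
    have : ∑ j, ∑ l, |ρ j l| ≤ ∑ _j : J, ∑ _l : J, N :=
      Finset.sum_le_sum fun j _ => Finset.sum_le_sum fun l _ => hρle j l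
    simp only [Finset.sum_const, Finset.card_univ, nsmul_eq_mul] at this
    nlinarith
  have hq2 : ∀ ε, q ε ^ 2 ≤ Q := by
    intro ε
    have h1 : q ε ^ 2 ≤ ((∑ j, ∑ l, |ρ j l|) / 2) ^ 2 := by
      rw [← sq_abs (q ε)]
      have := hqabs ε
      gcongr
    -- Cauchy–Schwarz over the `n ^ 2` ordered pairs.
    have h2 : (∑ j, ∑ l, |ρ j l|) ^ 2 ≤ Q := by
      rw [hQ, ← Finset.sum_product' (s := Finset.univ) (t := Finset.univ)
        (f := fun j l => |ρ j l|), ← Finset.sum_product' (s := Finset.univ) (t := Finset.univ)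
        (f := fun j l => ρ j l ^ 2)]
      refine (sq_sum_le_card_mul_sum_sq).trans ?_
      simp only [sq_abs, Finset.card_product, Finset.card_univ, hn]
      push_cast
      rw [sq]
    nlinarith [sq_nonneg (∑ j, ∑ l, |ρ j l|)]
  -- the main term
  have hmain : ∑ ε : J → Fin 3, (∏ j, dampedCoeff δ N (ε j)) * (1 - (q ε : ℂ))
      = ((1 + Real.exp (-N) / 2 * ∑ j, ∑ l, ρ j l : ℝ) : ℂ) := by
    simp_rw [mul_sub, mul_one]
    rw [Finset.sum_sub_distrib, ← Fintype.prod_sum (fun (_ : J) σ => dampedCoeff δ N σ)]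
    simp only [sum_dampedCoeff, Finset.prod_const_one]
    have h1 : ∑ ε : J → Fin 3, (∏ j, dampedCoeff δ N (ε j)) * (q ε : ℂ)
        = ∑ j, ∑ l, (ρ j l : ℂ) / 2 * (∑ ε : J → Fin 3, (∏ j, dampedCoeff δ N (ε j)) *
            ((sinSign (ε j) : ℂ) * (sinSign (ε l) : ℂ))) := by
      simp only [hq]
      push_cast
      simp_rw [Finset.sum_div, Finset.mul_sum]
      rw [Finset.sum_comm]
      refine Finset.sum_congr rfl fun j _ => ?_
      rw [Finset.sum_comm]
      exact Finset.sum_congr rfl fun l _ => Finset.sum_congr rfl fun ε _ => by ring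
    rw [h1]
    have h2 : ∀ j l, (ρ j l : ℂ) / 2 * (∑ ε : J → Fin 3, (∏ j, dampedCoeff δ N (ε j)) *
            ((sinSign (ε j) : ℂ) * (sinSign (ε l) : ℂ)))
        = -(((Real.exp (-N) : ℝ) : ℂ) / 2 * (ρ j l : ℂ)) := by
      intro j l
      by_cases h : j = l
      · rw [h, hρ0]; simp
      · rw [sum_prod_mul_sign _ (sum_dampedCoeff δ N) h, sum_dampedCoeff_mul_sign_sq δ N hδ]
        ring
    simp_rw [h2]
    push_cast
    simp only [Finset.sum_neg_distrib, ← Finset.mul_sum]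
    ring
  rw [← Real.norm_eq_abs, ← Complex.norm_real, Complex.ofReal_sub, hint, ← hmain,
    ← Finset.sum_sub_distrib]
  refine (norm_sum_le _ _).trans ?_
  have hterm : ∀ ε : J → Fin 3,
      ‖(∏ j, dampedCoeff δ N (ε j)) * ((Real.exp (-q ε) : ℝ) : ℂ)
        - (∏ j, dampedCoeff δ N (ε j)) * (1 - (q ε : ℂ))‖
      ≤ (∏ j, ‖dampedCoeff δ N (ε j)‖) * Q := by
    intro ε
    rw [← mul_sub, norm_mul, norm_prod]
    gcongr
    have h1 : ((Real.exp (-q ε) : ℝ) : ℂ) - (1 - (q ε : ℂ))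
        = ((Real.exp (-q ε) - 1 - (-q ε) : ℝ) : ℂ) := by push_cast; ring
    rw [h1, Complex.norm_real, Real.norm_eq_abs]
    refine (Real.abs_exp_sub_one_sub_id_le (by rw [abs_neg]; exact hq1 ε)).trans ?_
    rw [neg_sq]; exact hq2 ε
  refine (Finset.sum_le_sum fun ε _ => hterm ε).trans ?_
  rw [← Finset.sum_mul, ← Fintype.prod_sum (fun (_ : J) σ => ‖dampedCoeff δ N σ‖)]
  have hQ0 : 0 ≤ Q := by positivity
  gcongr
  rw [Finset.prod_const, Finset.card_univ]
  exact pow_le_pow_left₀ (by positivity) (sum_norm_dampedCoeff_le δ N hδ hN0) _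

end GaussianRounding

/-! ### Random 2-cuts with independent colours -/

section RandomCut

variable {V : Type*}

/-- The probability of the 2-cut `φ` when the colours are independent with means `s v`. -/
noncomputable def cutWeight [Fintype V] (s : V → ℝ) (φ : V → Bool) : ℝ :=
  ∏ v, (if φ v then (1 + s v) / 2 else (1 - s v) / 2)

/-- The gain, over a uniform 2-cut, in the probability that the edge `e` is cut when the colours
are independent with means `s v`. -/
noncomputable def cutGain (s : V → ℝ) (e : Finset V) : ℝ :=
  (1 / 2) ^ e.card * (2 - ∏ v ∈ e, (1 + s v) - ∏ v ∈ e, (1 - s v))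

open Classical in
lemma cutSize_eq_sum (H : Multiset (Finset V)) (φ : V → Bool) :
    (cutSize H φ : ℝ) = (H.map fun e => if IsCutBy φ e then (1 : ℝ) else 0).sum := by
  unfold cutSize
  induction H using Multiset.induction with
  | empty => simp
  | cons a H ih =>
    by_cases h : IsCutBy φ a
    · rw [Multiset.filter_cons_of_pos _ h]; simp [h, ← ih]; ring
    · rw [Multiset.filter_cons_of_neg _ h]; simp [h, ← ih]

variable [Fintype V]

open Classical in
lemma sum_cutWeight (s : V → ℝ) : ∑ φ, cutWeight s φ = 1 := by
  unfold cutWeight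
  rw [← Fintype.prod_sum (fun v (b : Bool) => if b then (1 + s v) / 2 else (1 - s v) / 2)]
  refine Finset.prod_eq_one fun v _ => ?_
  simp
  ring

open Classical in
lemma sum_cutWeight_mono (s : V → ℝ) (e : Finset V) (b : Bool) :
    ∑ φ, cutWeight s φ * (if ∀ v ∈ e, φ v = b then 1 else 0)
      = (1 / 2) ^ e.card * ∏ v ∈ e, (1 + (if b then 1 else -1) * s v) := by
  have h1 : ∀ φ : V → Bool, cutWeight s φ * (if ∀ v ∈ e, φ v = b then 1 else 0)
      = ∏ v, ((if φ v then (1 + s v) / 2 else (1 - s v) / 2)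
          * (if v ∈ e → φ v = b then 1 else 0)) := by
    intro φ
    rw [Finset.prod_mul_distrib]
    unfold cutWeight
    congr 1
    rw [Finset.prod_ite_zero]
    simp
  simp_rw [h1]
  rw [← Fintype.prod_sum (fun v (c : Bool) => (if c then (1 + s v) / 2 else (1 - s v) / 2)
          * (if v ∈ e → c = b then (1 : ℝ) else 0))]
  have h2 : ∀ v, ∑ c : Bool, (if c then (1 + s v) / 2 else (1 - s v) / 2)
          * (if v ∈ e → c = b then (1 : ℝ) else 0)
      = if v ∈ e then (1 / 2) * (1 + (if b then 1 else -1) * s v) else 1 := by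
    intro v
    by_cases hv : v ∈ e <;> cases b <;> simp [hv] <;> ring
  simp_rw [h2]
  rw [Finset.prod_ite_mem, Finset.univ_inter, Finset.prod_mul_distrib, Finset.prod_const]

open Classical in
lemma sum_cutWeight_isCutBy (s : V → ℝ) {e : Finset V} (he : e.Nonempty) :
    ∑ φ, cutWeight s φ * (if IsCutBy φ e then 1 else 0)
      = 1 - (1 / 2) ^ e.card * (∏ v ∈ e, (1 + s v) + ∏ v ∈ e, (1 - s v)) := by
  have h1 : ∀ φ : V → Bool, cutWeight s φ * (if IsCutBy φ e then 1 else 0)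
      = cutWeight s φ - cutWeight s φ * (if ∀ v ∈ e, φ v = true then 1 else 0)
        - cutWeight s φ * (if ∀ v ∈ e, φ v = false then 1 else 0) := by
    intro φ
    obtain ⟨w, hw⟩ := he
    by_cases ht : ∀ v ∈ e, φ v = true
    · have hf : ¬ ∀ v ∈ e, φ v = false := fun h => by
        have := (ht w hw).symm.trans (h w hw); cases this
      have hc : ¬ IsCutBy φ e := fun ⟨_, v, hv, hv'⟩ => by
        rw [ht v hv] at hv'; cases hv'
      simp only [if_pos ht, if_neg hf, if_neg hc]; ring
    · by_cases hf : ∀ v ∈ e, φ v = false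
      · have hc : ¬ IsCutBy φ e := fun ⟨⟨v, hv, hv'⟩, _⟩ => by
          rw [hf v hv] at hv'; cases hv'
        simp only [if_neg ht, if_pos hf, if_neg hc]; ring
      · have hc : IsCutBy φ e := by
          push Not at ht hf
          obtain ⟨a, ha, ha'⟩ := ht
          obtain ⟨b, hb, hb'⟩ := hf
          exact ⟨⟨b, hb, by simpa using hb'⟩, ⟨a, ha, by simpa using ha'⟩⟩
        simp only [if_neg ht, if_neg hf, if_pos hc]; ring
  simp_rw [h1]
  rw [Finset.sum_sub_distrib, Finset.sum_sub_distrib, sum_cutWeight, sum_cutWeight_mono,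
    sum_cutWeight_mono]
  simp only [if_true, Bool.false_eq_true, if_false, one_mul, neg_one_mul, ← sub_eq_add_neg]
  ring

open Classical in
lemma sum_cutWeight_sub_isCutBy (s : V → ℝ) (e : Finset V) :
    ∑ φ, (cutWeight s φ - cutWeight 0 φ) * (if IsCutBy φ e then 1 else 0) = cutGain s e := by
  rcases e.eq_empty_or_nonempty with rfl | he
  -- The empty hyperedge is never cut, whereas the formula for nonempty hyperedges would give `-1`.
  · simp [IsCutBy, cutGain]; norm_num
  · simp_rw [sub_mul]
    rw [Finset.sum_sub_distrib, sum_cutWeight_isCutBy s he, sum_cutWeight_isCutBy 0 he, cutGain]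
    simp
    ring

open Classical in
lemma meanCutSize_eq_sum_cutWeight (H : Multiset (Finset V)) :
    meanCutSize H = ∑ φ, cutWeight 0 φ * (cutSize H φ : ℝ) := by
  unfold meanCutSize
  rw [Finset.sum_div]
  refine Finset.sum_congr rfl fun φ _ => ?_
  simp [cutWeight]
  field_simp

/-- The left side is the average of size minus mean under the product distribution `cutWeight s`,
and an average is at most the maximum. -/
lemma sum_cutGain_le_surp (H : Multiset (Finset V)) (s : V → ℝ) (hs : ∀ v, |s v| ≤ 1) :
    (H.map (cutGain s)).sum ≤ surp H := by
  classical
  have h1 : (H.map (cutGain s)).sum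
      = ∑ φ, (cutWeight s φ - cutWeight 0 φ) * (cutSize H φ : ℝ) := by
    simp_rw [cutSize_eq_sum, ← sum_cutWeight_sub_isCutBy]
    induction H using Multiset.induction with
    | empty => simp
    | cons a H ih =>
      simp only [Multiset.map_cons, Multiset.sum_cons, ih, mul_add, Finset.sum_add_distrib]
  have h2 : (H.map (cutGain s)).sum
      = ∑ φ, cutWeight s φ * ((cutSize H φ : ℝ) - meanCutSize H) := by
    simp_rw [mul_sub]
    rw [Finset.sum_sub_distrib, ← Finset.sum_mul, sum_cutWeight, one_mul,
      meanCutSize_eq_sum_cutWeight, h1, ← Finset.sum_sub_distrib]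
    exact Finset.sum_congr rfl fun φ _ => by ring
  have hw : ∀ φ, 0 ≤ cutWeight s φ := fun φ => Finset.prod_nonneg fun v _ => by
    have := abs_le.1 (hs v)
    split_ifs <;> linarith
  rw [h2]
  calc _ ≤ ∑ φ, cutWeight s φ * surp H := by
        refine Finset.sum_le_sum fun φ _ => mul_le_mul_of_nonneg_left ?_ (hw φ)
        exact le_ciSup (f := fun φ : V → Bool => (cutSize H φ : ℝ) - meanCutSize H)
          (Set.finite_range _).bddAbove φ
    _ = surp H := by rw [← Finset.sum_mul, sum_cutWeight, one_mul]

lemma surp_nonneg (H : Multiset (Finset V)) : 0 ≤ surp H := by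
  have h := sum_cutGain_le_surp H 0 (by simp)
  refine le_trans (le_of_eq ?_) h
  symm
  refine Multiset.sum_eq_zero fun y hy => ?_
  obtain ⟨e, _, rfl⟩ := Multiset.mem_map.1 hy
  simp [cutGain]
  norm_num

end RandomCut

/-! ### From Gram matrices to the surplus -/

section SurplusBound

variable {V : Type*}

lemma integral_multiset_sum_map {Ω A : Type*} [MeasurableSpace Ω] {μ : Measure Ω}
    (H : Multiset A) (f : A → Ω → ℝ) (hf : ∀ a, Integrable (f a) μ) :
    Integrable (fun ω => (H.map fun a => f a ω).sum) μ ∧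
    ∫ ω, (H.map fun a => f a ω).sum ∂μ = (H.map fun a => ∫ ω, f a ω ∂μ).sum := by
  induction H using Multiset.induction with
  | empty => simp
  | cons a H ih =>
    simp only [Multiset.map_cons, Multiset.sum_cons]
    exact ⟨(hf a).add ih.1, by rw [integral_add (hf a) ih.1, ih.2]⟩

lemma integrable_prod_one_add_sin {W : Type*} [Fintype W] (x : V → W → ℝ) (e : Finset V) (δ : ℝ)
    (hδ : |δ| ≤ 1) :
    Integrable (fun g : W → ℝ => ∏ v ∈ e, (1 + δ * Real.sin (∑ w, x v w * g w)))
      (Measure.pi fun _ => gaussianReal 0 1) := by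
  refine Integrable.of_bound (C := 2 ^ e.card) ?_ ?_
  · refine Continuous.aestronglyMeasurable ?_
    fun_prop
  · refine Filter.Eventually.of_forall fun g => ?_
    rw [Real.norm_eq_abs, Finset.abs_prod]
    rw [← Finset.prod_const]
    refine Finset.prod_le_prod (fun v _ => abs_nonneg _) fun v _ => ?_
    have h1 := Real.abs_sin_le_one (∑ w, x v w * g w)
    calc |1 + δ * Real.sin (∑ w, x v w * g w)|
        ≤ |1| + |δ * Real.sin (∑ w, x v w * g w)| := abs_add_le _ _
      _ ≤ 1 + 1 * 1 := by
          rw [abs_mul, abs_one]; gcongr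
      _ = 2 := by norm_num

variable [Fintype V]

/-- The surplus is bounded below through the Gram matrix of any family of vectors of equal,
sufficiently small norm. -/
lemma gram_le_surp {W : Type*} [Fintype W] (k : ℕ) (x : V → W → ℝ) (N : ℝ) (hN0 : 0 ≤ N)
    (hN : ∀ v, ∑ w, x v w ^ 2 = N) (hk : (k : ℝ) ^ 2 * N ≤ 2)
    (P : V → V → ℝ) (hP0 : ∀ v, P v v = 0) (hP : ∀ u v, u ≠ v → P u v = ∑ w, x u w * x v w)
    (H : Multiset (Finset V)) (hH : ∀ e ∈ H, e.card ≤ k) :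
    (H.map fun e => ∑ u ∈ e, ∑ v ∈ e,
      (-((1 / 2) ^ e.card * Real.exp (-N) * P u v) - 2 * (k : ℝ) ^ 2 * P u v ^ 2)).sum
      ≤ surp H := by
  classical
  set γ : Measure (W → ℝ) := Measure.pi fun _ => gaussianReal 0 1 with hγ
  set s : (W → ℝ) → V → ℝ := fun g v => Real.sin (∑ w, x v w * g w) with hs
  have hI1 : ∀ e : Finset V, Integrable (fun g => ∏ v ∈ e, (1 + s g v)) γ := by
    intro e
    simpa using integrable_prod_one_add_sin x e 1 (by simp)
  have hI2 : ∀ e : Finset V, Integrable (fun g => ∏ v ∈ e, (1 - s g v)) γ := by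
    intro e
    simpa [← sub_eq_add_neg] using integrable_prod_one_add_sin x e (-1) (by simp)
  have hI : ∀ e : Finset V, Integrable (fun g => cutGain (s g) e) γ := by
    intro e
    exact (((integrable_const _).sub (hI1 e)).sub (hI2 e)).const_mul _
  have hmain := integral_multiset_sum_map H (fun e g => cutGain (s g) e) hI
  have h1 : ∫ g, (H.map fun e => cutGain (s g) e).sum ∂γ ≤ surp H := by
    calc _ ≤ ∫ _g, surp H ∂γ := by
          refine integral_mono hmain.1 (integrable_const _) fun g => ?_
          exact sum_cutGain_le_surp H (s g) fun v => Real.abs_sin_le_one _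
      _ = surp H := by simp
  refine le_trans ?_ h1
  rw [hmain.2]
  refine Multiset.sum_map_le_sum_map _ _ fun e he => ?_
  have hcard := hH e he
  set n := e.card with hn
  have hnk : (n : ℝ) ≤ k := by exact_mod_cast hcard
  -- The signs `1` and `-1` correspond to the two ways for `e` to be monochromatic.
  have key : ∀ δ : ℝ, δ ^ 2 = 1 →
      ∫ g, ∏ v ∈ e, (1 + δ * s g v) ∂γ ≤ 1 + Real.exp (-N) / 2 * ∑ u ∈ e, ∑ v ∈ e, P u v
        + 2 ^ n * ((k : ℝ) ^ 2 * ∑ u ∈ e, ∑ v ∈ e, P u v ^ 2) := by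
    intro δ hδ
    have h := abs_integral_prod_one_add_sin_sub_le (J := e) (W := W) (fun j => x j) N hN0
      (fun j => hN j) (fun j l => P j l) (fun j => hP0 j)
      (fun j l hjl => hP j l (fun h => hjl (Subtype.ext h)))
      (by
        rw [Fintype.card_coe, ← hn]
        exact le_trans (by gcongr) hk) δ hδ
    rw [Fintype.card_coe, ← hn] at h
    have e1 : ∀ g : W → ℝ, ∏ j : e, (1 + δ * Real.sin (∑ w, x j w * g w))
        = ∏ v ∈ e, (1 + δ * s g v) :=
      fun g => Finset.prod_coe_sort e (fun v => 1 + δ * s g v)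
    have e2 : ∑ j : e, ∑ l : e, P j l = ∑ u ∈ e, ∑ v ∈ e, P u v := by
      rw [← Finset.sum_coe_sort e]
      exact Finset.sum_congr rfl fun j _ => Finset.sum_coe_sort e (fun v => P j v)
    have e3 : ∑ j : e, ∑ l : e, P j l ^ 2 = ∑ u ∈ e, ∑ v ∈ e, P u v ^ 2 := by
      rw [← Finset.sum_coe_sort e]
      exact Finset.sum_congr rfl fun j _ => Finset.sum_coe_sort e (fun v => P j v ^ 2)
    simp_rw [e1] at h
    rw [e2, e3] at h
    have h2 := (abs_le.1 h).2
    have h3 : (2 : ℝ) ^ n * ((n : ℝ) ^ 2 * ∑ u ∈ e, ∑ v ∈ e, P u v ^ 2)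
        ≤ 2 ^ n * ((k : ℝ) ^ 2 * ∑ u ∈ e, ∑ v ∈ e, P u v ^ 2) := by
      have : 0 ≤ ∑ u ∈ e, ∑ v ∈ e, P u v ^ 2 := by positivity
      gcongr
    linarith
  have k1 := key 1 (by norm_num)
  have k2 := key (-1) (by norm_num)
  simp only [one_mul, neg_one_mul, ← sub_eq_add_neg] at k1 k2
  have hval : ∫ g, cutGain (s g) e ∂γ
      = (1 / 2) ^ n * (2 - ∫ g, ∏ v ∈ e, (1 + s g v) ∂γ - ∫ g, ∏ v ∈ e, (1 - s g v) ∂γ) := by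
    have hc : Integrable (fun g => 2 - ∏ v ∈ e, (1 + s g v)) γ := (integrable_const _).sub (hI1 e)
    unfold cutGain
    rw [integral_const_mul, integral_sub hc (hI2 e),
      integral_sub (integrable_const _) (hI1 e)]
    simp [hn]
  rw [hval]
  set A := ∑ u ∈ e, ∑ v ∈ e, P u v
  set B := ∑ u ∈ e, ∑ v ∈ e, P u v ^ 2
  have hlhs : ∑ u ∈ e, ∑ v ∈ e,
      (-((1 / 2) ^ n * Real.exp (-N) * P u v) - 2 * (k : ℝ) ^ 2 * P u v ^ 2)
      = (1 / 2) ^ n * (-(Real.exp (-N) * A) - 2 * (2 ^ n * ((k : ℝ) ^ 2 * B))) := by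
    -- The loss `2 ^ n` in the quadratic error is absorbed by the factor `(1 / 2) ^ n` of the cut
    -- gain.
    have h2n : ((1 : ℝ) / 2) ^ n * 2 ^ n = 1 := by rw [← mul_pow]; norm_num
    simp only [Finset.sum_sub_distrib, Finset.sum_neg_distrib, ← Finset.mul_sum]
    linear_combination (-2 * (k : ℝ) ^ 2 * B) * -h2n
  rw [hlhs]
  refine mul_le_mul_of_nonneg_left ?_ (by positivity)
  linarith

open Classical in
/-- The perturbation matrix arising from `M`: linear term `-2 M / β` and quadratic term
`M ^ 2 / β ^ 2`, off the diagonal. -/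
noncomputable def gramEntry (M : V → V → ℝ) (β θ : ℝ) (u v : V) : ℝ :=
  if u = v then 0 else θ * (-2 * M u v / β + (∑ w, M u w * M w v) / β ^ 2)

/-- The vectors live in two copies of `V`: the first carries the rows of `1 - M / β` scaled by the
square root of `θ`, the second a private coordinate `t v` that raises the squared norm to `N`
without affecting inner products. Since `N = θ * (1 + K)`, the row bound is exactly what makes the
radicand in `t v` nonnegative. -/
lemma gramEntry_le_surp (k : ℕ) (M : V → V → ℝ) (hM : ∀ u v, M u v = M v u)
    (hM0 : ∀ v, M v v = 0) (K β : ℝ) (hK : 0 ≤ K) (hβ : 0 < β)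
    (hrow : ∀ v, ∑ w, M v w ^ 2 ≤ K * β ^ 2) (H : Multiset (Finset V))
    (hH : ∀ e ∈ H, e.card ≤ k) (N θ : ℝ) (hN : N = 1 / ((k : ℝ) ^ 2 + 1))
    (hθ : θ = 1 / (((k : ℝ) ^ 2 + 1) * (1 + K))) :
    (H.map fun e => ∑ u ∈ e, ∑ v ∈ e, (-((1 / 2) ^ e.card * Real.exp (-N) * gramEntry M β θ u v)
      - 2 * (k : ℝ) ^ 2 * gramEntry M β θ u v ^ 2)).sum ≤ surp H := by
  classical
  have hN0 : 0 ≤ N := by rw [hN]; positivity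
  have hθ0 : 0 ≤ θ := by rw [hθ]; positivity
  have hNθ : N = θ * (1 + K) := by rw [hN, hθ]; field_simp
  set η := Real.sqrt θ with hη
  have hη2 : η ^ 2 = θ := Real.sq_sqrt hθ0
  set t : V → ℝ := fun v => Real.sqrt (N - θ * (1 + (∑ w, M v w ^ 2) / β ^ 2)) with ht
  have ht2 : ∀ v, t v ^ 2 = N - θ * (1 + (∑ w, M v w ^ 2) / β ^ 2) := by
    intro v
    refine Real.sq_sqrt ?_
    have h1 : (∑ w, M v w ^ 2) / β ^ 2 ≤ K := by
      rw [div_le_iff₀ (by positivity)]; exact hrow v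
    rw [hNθ, sub_nonneg]
    gcongr
  refine gram_le_surp (W := V ⊕ V) k (fun v w => Sum.elim
    (fun w => η * ((if v = w then 1 else 0) - M v w / β))
    (fun w => if v = w then t v else 0) w) N hN0 ?_ ?_ (gramEntry M β θ) ?_ ?_ H hH
  · intro v
    simp only [Fintype.sum_sum_type, Sum.elim_inl, Sum.elim_inr]
    have h1 : ∀ w, (η * ((if v = w then 1 else 0) - M v w / β)) ^ 2
        = θ * ((if v = w then 1 else 0) + M v w ^ 2 / β ^ 2) := by
      intro w
      rw [mul_pow, hη2]
      split_ifs with h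
      -- The cross term `-2 * M v v / β` vanishes because the diagonal of `M` is zero.
      · subst h; rw [hM0]; simp
      · ring
    simp_rw [h1]
    rw [← Finset.mul_sum, Finset.sum_add_distrib, ← Finset.sum_div]
    simp only [ite_pow, ne_eq, OfNat.ofNat_ne_zero, not_false_eq_true, zero_pow,
      Finset.sum_ite_eq, Finset.mem_univ, if_true]
    rw [ht2]; ring
  · rw [hN, mul_one_div, div_le_iff₀ (by positivity)]
    nlinarith [sq_nonneg (k : ℝ)]
  · intro v; simp [gramEntry]
  · intro u v huv
    simp only [Fintype.sum_sum_type, Sum.elim_inl, Sum.elim_inr, gramEntry, if_neg huv]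
    have h1 : ∀ w, (η * ((if u = w then 1 else 0) - M u w / β))
          * (η * ((if v = w then 1 else 0) - M v w / β))
        = θ * ((if u = w then - M v w / β else 0) + (if v = w then - M u w / β else 0)
          + M u w * M w v / β ^ 2) := by
      intro w
      rw [← hη2, hM w v]
      by_cases h : u = w
      · have h' : v ≠ w := fun h' => huv (h.trans h'.symm)
        simp only [if_pos h, if_neg h']; ring
      · by_cases h' : v = w
        · simp only [if_neg h, if_pos h']; ring
        · simp only [if_neg h, if_neg h']; ring
    have h2 : ∀ w, (if u = w then t u else 0) * (if v = w then t v else 0) = 0 := by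
      intro w
      by_cases h : u = w
      · have h' : v ≠ w := fun h' => huv (h.trans h'.symm)
        simp [h']
      · simp [h]
    simp_rw [h1, h2]
    rw [← Finset.mul_sum, Finset.sum_add_distrib, Finset.sum_add_distrib, ← Finset.sum_div]
    simp only [Finset.sum_ite_eq, Finset.mem_univ, if_true, Finset.sum_const_zero, add_zero]
    rw [hM v u]; ring

end SurplusBound

/-! ### Indicators and rearrangement of finite sums -/

open Classical in
/-- The indicator of a proposition, as a real number. -/
noncomputable def ind (p : Prop) : ℝ := if p then 1 else 0

lemma ind_of {p : Prop} (h : p) : ind p = 1 := if_pos h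

lemma ind_of_not {p : Prop} (h : ¬p) : ind p = 0 := if_neg h

lemma ind_nonneg (p : Prop) : 0 ≤ ind p := by unfold ind; split_ifs <;> norm_num

lemma ind_le_one (p : Prop) : ind p ≤ 1 := by unfold ind; split_ifs <;> norm_num

lemma ind_le {p : Prop} {c : ℝ} (hc : 0 ≤ c) (h : p → 1 ≤ c) : ind p ≤ c := by
  by_cases hp : p
  · rw [ind_of hp]; exact h hp
  · rw [ind_of_not hp]; exact hc

lemma sum_ind_eq_card {A : Type*} (s : Finset A) (p : A → Prop) [DecidablePred p] :
    ∑ a ∈ s, ind (p a) = ((s.filter p).card : ℝ) := by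
  rw [Finset.card_filter, Nat.cast_sum]
  refine Finset.sum_congr rfl fun a _ => ?_
  by_cases h : p a <;> simp [ind, h]

lemma sum_cycle_index {A B C E : Type*} (s : Finset A) (t : Finset B) (u : Finset C)
    (v : Finset E) (F : A → B → C → E → ℝ) :
    ∑ a ∈ s, ∑ b ∈ t, ∑ c ∈ u, ∑ d ∈ v, F a b c d
      = ∑ b ∈ t, ∑ c ∈ u, ∑ d ∈ v, ∑ a ∈ s, F a b c d := by
  rw [Finset.sum_comm]
  refine Finset.sum_congr rfl fun b _ => ?_
  rw [Finset.sum_comm]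
  refine Finset.sum_congr rfl fun c _ => ?_
  rw [Finset.sum_comm]

lemma sum_swap_first_third {A B C : Type*} (s : Finset A) (t : Finset B) (u : Finset C)
    (F : A → B → C → ℝ) :
    ∑ a ∈ s, ∑ b ∈ t, ∑ c ∈ u, F a b c = ∑ c ∈ u, ∑ b ∈ t, ∑ a ∈ s, F a b c := by
  rw [Finset.sum_comm]
  simp_rw [fun b => Finset.sum_comm (s := s) (t := u) (f := fun a c => F a b c)]
  rw [Finset.sum_comm]

lemma sum_reverse_four {A B C E : Type*} (s : Finset A) (t : Finset B) (u : Finset C)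
    (v : Finset E) (F : A → B → C → E → ℝ) :
    ∑ a ∈ s, ∑ b ∈ t, ∑ c ∈ u, ∑ d ∈ v, F a b c d
      = ∑ d ∈ v, ∑ c ∈ u, ∑ b ∈ t, ∑ a ∈ s, F a b c d := by
  rw [sum_cycle_index, sum_swap_first_third]

lemma sum_ite_eq_pair {V : Type*} [Fintype V] [DecidableEq V] (s : Finset V) (hs : s.card = 2)
    (x : V) (c : ℝ) :
    ∑ y, (if s = {x, y} then c else 0) = if x ∈ s then c else 0 := by
  obtain ⟨p, q, hpq, rfl⟩ := Finset.card_eq_two.1 hs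
  by_cases hp : x = p
  · subst hp
    have h : ∀ y, (({x, q} : Finset V) = {x, y}) ↔ q = y := by
      intro y
      constructor
      · intro h
        have : q ∈ ({x, y} : Finset V) := h ▸ (by simp)
        simp only [Finset.mem_insert, Finset.mem_singleton] at this
        exact this.resolve_left fun h => hpq h.symm
      · rintro rfl; rfl
    simp [h]
  · by_cases hq : x = q
    · subst hq
      have h : ∀ y, (({p, x} : Finset V) = {x, y}) ↔ p = y := by
        intro y
        constructor
        · intro h
          have : p ∈ ({x, y} : Finset V) := h ▸ (by simp)
          simp only [Finset.mem_insert, Finset.mem_singleton] at this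
          exact this.resolve_left hpq
        · rintro rfl; exact Finset.pair_comm _ _
      simp [h]
    · have h : ∀ y, ({p, q} : Finset V) ≠ {x, y} := by
        intro y h
        have : x ∈ ({p, q} : Finset V) := h ▸ (by simp)
        simp [hp, hq] at this
      simp [h, hp, hq]

/-! ### Counting edges and closed walks in `Y` -/

namespace PotentialHyperedges

variable {V ι 𝓢 Ω : Type*} {α : 𝓢 → Type*}

open Classical in
/-- The potential edges in `Y` with vertex set `{x, y}`. -/
noncomputable def pairEdges (G : PotentialHyperedges V ι 𝓢 Ω α) (x y : V) : Finset ι :=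
  G.Y.filter fun e => G.verts e = {x, y}

lemma mem_Y_of_mem_pairEdges {G : PotentialHyperedges V ι 𝓢 Ω α} {x y : V} {a : ι}
    (h : a ∈ G.pairEdges x y) : a ∈ G.Y := by
  classical
  exact (Finset.mem_filter.1 h).1

open Classical in
lemma verts_of_mem_pairEdges {G : PotentialHyperedges V ι 𝓢 Ω α} {x y : V} {a : ι}
    (h : a ∈ G.pairEdges x y) : G.verts a = {x, y} :=
  (Finset.mem_filter.1 h).2

lemma pairEdges_comm (G : PotentialHyperedges V ι 𝓢 Ω α) (x y : V) :
    G.pairEdges x y = G.pairEdges y x := by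
  classical
  ext a
  simp only [pairEdges, Finset.mem_filter]
  rw [Finset.pair_comm]

lemma Y_subset_all (G : PotentialHyperedges V ι 𝓢 Ω α) : G.Y ⊆ G.all := by
  classical
  intro e he
  exact Finset.mem_union_right _ he

section CycleSum

variable [Fintype V]

/-- The sum of `F` over all closed walks of length four formed by edges of `Y`. -/
noncomputable def cycleSum (G : PotentialHyperedges V ι 𝓢 Ω α) (F : ι → ι → ι → ι → ℝ) : ℝ :=
  ∑ x₁, ∑ x₂, ∑ x₃, ∑ x₄, ∑ a ∈ G.pairEdges x₁ x₂, ∑ b ∈ G.pairEdges x₂ x₃,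
    ∑ c ∈ G.pairEdges x₃ x₄, ∑ d ∈ G.pairEdges x₄ x₁, F a b c d

lemma cycleSum_rotate (G : PotentialHyperedges V ι 𝓢 Ω α) (F : ι → ι → ι → ι → ℝ) :
    G.cycleSum (fun a b c d => F b c d a) = G.cycleSum F := by
  unfold cycleSum
  rw [sum_cycle_index]
  refine Finset.sum_congr rfl fun x₁ _ => Finset.sum_congr rfl fun x₂ _ =>
    Finset.sum_congr rfl fun x₃ _ => Finset.sum_congr rfl fun x₄ _ => ?_
  rw [sum_cycle_index]

lemma cycleSum_reflect (G : PotentialHyperedges V ι 𝓢 Ω α) (F : ι → ι → ι → ι → ℝ) :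
    G.cycleSum (fun a b c d => F c b a d) = G.cycleSum F := by
  unfold cycleSum
  rw [sum_reverse_four]
  refine Finset.sum_congr rfl fun x₄ _ => Finset.sum_congr rfl fun x₃ _ =>
    Finset.sum_congr rfl fun x₂ _ => Finset.sum_congr rfl fun x₁ _ => ?_
  rw [sum_swap_first_third, G.pairEdges_comm x₄ x₃, G.pairEdges_comm x₃ x₂,
    G.pairEdges_comm x₂ x₁, G.pairEdges_comm x₁ x₄]

lemma cycleSum_mono (G : PotentialHyperedges V ι 𝓢 Ω α) {F F' : ι → ι → ι → ι → ℝ}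
    (hF : ∀ a ∈ G.Y, ∀ b ∈ G.Y, ∀ c ∈ G.Y, ∀ d ∈ G.Y, F a b c d ≤ F' a b c d) :
    G.cycleSum F ≤ G.cycleSum F' := by
  unfold cycleSum
  refine Finset.sum_le_sum fun x₁ _ => Finset.sum_le_sum fun x₂ _ => Finset.sum_le_sum fun x₃ _ =>
    Finset.sum_le_sum fun x₄ _ => Finset.sum_le_sum fun a ha => Finset.sum_le_sum fun b hb =>
    Finset.sum_le_sum fun c hc => Finset.sum_le_sum fun d hd => ?_
  exact hF a (mem_Y_of_mem_pairEdges ha) b (mem_Y_of_mem_pairEdges hb) c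
    (mem_Y_of_mem_pairEdges hc) d (mem_Y_of_mem_pairEdges hd)

lemma cycleSum_add (G : PotentialHyperedges V ι 𝓢 Ω α) (F F' : ι → ι → ι → ι → ℝ) :
    G.cycleSum (fun a b c d => F a b c d + F' a b c d) = G.cycleSum F + G.cycleSum F' := by
  unfold cycleSum
  simp only [Finset.sum_add_distrib]

end CycleSum

section Counting

variable [MeasurableSpace Ω] [∀ i, MeasurableSpace (α i)]
  {G : PotentialHyperedges V ι 𝓢 Ω α} {μ : Measure Ω} {m Δ D Λ lam : ℝ} {k : ℕ}
  {C₁ c₂ c₃ C₄ : ℝ}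

namespace IsGeneralType

lemma pairEdges_self (h : G.IsGeneralType μ m Δ D Λ lam k C₁ c₂ c₃ C₄) (x : V) :
    G.pairEdges x x = ∅ := by
  classical
  rw [Finset.eq_empty_iff_forall_notMem]
  intro a ha
  have h1 := h.card_verts_Y a (mem_Y_of_mem_pairEdges ha)
  rw [verts_of_mem_pairEdges ha] at h1
  simp at h1

lemma sum_colours_eq_le (h : G.IsGeneralType μ m Δ D Λ lam k C₁ c₂ c₃ C₄) (hlam : 0 ≤ lam)
    (x y : V) (S : Finset 𝓢) :
    ∑ a ∈ G.pairEdges x y, ind (G.colours a = S) ≤ lam := by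
  classical
  rw [sum_ind_eq_card]
  rcases ((G.pairEdges x y).filter fun a => G.colours a = S).eq_empty_or_nonempty with h0 | ⟨a, ha⟩
  · rw [h0]; simpa using hlam
  · obtain ⟨ha1, ha2⟩ := Finset.mem_filter.1 ha
    refine le_trans ?_ (h.multiplicity a (mem_Y_of_mem_pairEdges ha1)).2
    norm_cast
    refine Finset.card_le_card fun b hb => ?_
    obtain ⟨hb1, hb2⟩ := Finset.mem_filter.1 hb
    refine Finset.mem_filter.2 ⟨mem_Y_of_mem_pairEdges hb1, ?_, ha2.trans hb2.symm⟩
    rw [verts_of_mem_pairEdges ha1, verts_of_mem_pairEdges hb1]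

/-- Each of the `2 ^ S.card` subsets of `S` is the colour set of at most `lam` parallel edges. -/
lemma sum_colours_subset_le (h : G.IsGeneralType μ m Δ D Λ lam k C₁ c₂ c₃ C₄) (hlam : 0 ≤ lam)
    (x y : V) (S : Finset 𝓢) :
    ∑ a ∈ G.pairEdges x y, ind (G.colours a ⊆ S) ≤ 2 ^ S.card * lam := by
  classical
  calc _ ≤ ∑ a ∈ G.pairEdges x y, ∑ U ∈ S.powerset, ind (G.colours a = U) := by
        refine Finset.sum_le_sum fun a _ => ?_
        refine ind_le (Finset.sum_nonneg fun i _ => ind_nonneg _) fun hs => ?_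
        rw [← ind_of (rfl : G.colours a = G.colours a)]
        exact Finset.single_le_sum (f := fun U => ind (G.colours a = U))
          (fun i _ => ind_nonneg _) (Finset.mem_powerset.2 hs)
    _ ≤ ∑ _U ∈ S.powerset, lam := by
        rw [Finset.sum_comm]
        exact Finset.sum_le_sum fun U _ => h.sum_colours_eq_le hlam x y U
    _ = _ := by simp [Finset.card_powerset]

variable [Fintype V]

open Classical in
lemma sum_pairEdges_right (h : G.IsGeneralType μ m Δ D Λ lam k C₁ c₂ c₃ C₄) (x : V) (F : ι → ℝ) :
    ∑ y, ∑ a ∈ G.pairEdges x y, F a = ∑ a ∈ G.Y.filter (fun a => x ∈ G.verts a), F a := by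
  unfold pairEdges
  simp_rw [Finset.sum_filter]
  rw [Finset.sum_comm]
  exact Finset.sum_congr rfl fun a ha => sum_ite_eq_pair _ (h.card_verts_Y a ha) _ _

/-- Every edge of `Y` has two orientations. -/
lemma sum_pairEdges (h : G.IsGeneralType μ m Δ D Λ lam k C₁ c₂ c₃ C₄) (F : ι → ℝ) :
    ∑ x, ∑ y, ∑ a ∈ G.pairEdges x y, F a = 2 * ∑ a ∈ G.Y, F a := by
  classical
  simp_rw [h.sum_pairEdges_right, Finset.sum_filter]
  rw [Finset.sum_comm, Finset.mul_sum]
  refine Finset.sum_congr rfl fun a ha => ?_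
  rw [← Finset.sum_filter]
  simp [h.card_verts_Y a ha]

/-- Union bound over the colours in `S`, each seen on at most `D` edges at `x`. -/
lemma sum_not_disjoint_le (h : G.IsGeneralType μ m Δ D Λ lam k C₁ c₂ c₃ C₄) (x : V)
    (S : Finset 𝓢) :
    ∑ y, ∑ a ∈ G.pairEdges x y, ind (¬ Disjoint (G.colours a) S) ≤ S.card * D := by
  classical
  rw [h.sum_pairEdges_right]
  calc _ ≤ ∑ a ∈ G.Y.filter (fun a => x ∈ G.verts a), ∑ i ∈ S, ind (i ∈ G.colours a) := by
        refine Finset.sum_le_sum fun a _ => ?_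
        refine ind_le (Finset.sum_nonneg fun i _ => ind_nonneg _) fun hd => ?_
        obtain ⟨i, hi, hiS⟩ := Finset.not_disjoint_iff.1 hd
        rw [← ind_of hi]
        exact Finset.single_le_sum (f := fun i => ind (i ∈ G.colours a))
          (fun i _ => ind_nonneg _) hiS
    _ ≤ ∑ _i ∈ S, D := by
        rw [Finset.sum_comm]
        refine Finset.sum_le_sum fun i _ => ?_
        rw [sum_ind_eq_card, Finset.filter_filter]
        convert h.colour_codegree_le x i
    _ = _ := by simp

lemma sum_card_pairEdges_le (h : G.IsGeneralType μ m Δ D Λ lam k C₁ c₂ c₃ C₄) (x : V) :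
    ∑ y, ∑ _a ∈ G.pairEdges x y, (1 : ℝ) ≤ Δ := by
  classical
  rw [h.sum_pairEdges_right]
  refine le_trans ?_ (h.degree_le x)
  rw [Finset.sum_const, nsmul_eq_mul, mul_one]
  norm_cast
  refine Finset.card_le_card fun a ha => ?_
  obtain ⟨h1, h2⟩ := Finset.mem_filter.1 ha
  exact Finset.mem_filter.2 ⟨G.Y_subset_all h1, h2⟩

lemma sum_same_colours_le (h : G.IsGeneralType μ m Δ D Λ lam k C₁ c₂ c₃ C₄) (x : V) {e : ι}
    (he : e ∈ G.Y) :
    ∑ y, ∑ a ∈ G.pairEdges x y, ind (G.colours a = G.colours e) ≤ Λ * lam := by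
  classical
  rw [h.sum_pairEdges_right, sum_ind_eq_card, Finset.filter_filter]
  refine le_trans ?_ (h.same_colours_le e he)
  norm_cast
  refine Finset.card_le_card fun a ha => ?_
  obtain ⟨h1, h2, h3⟩ := Finset.mem_filter.1 ha
  exact Finset.mem_filter.2 ⟨h1, h3.symm⟩

/-- After exchanging the sums, a pair is counted as often as its codegree. The codegree condition
concerns distinct vertices only, so `X` has to vanish on the diagonal. -/
lemma sum_pairs_all_le (h : G.IsGeneralType μ m Δ D Λ lam k C₁ c₂ c₃ C₄) (X : V → V → ℝ)
    (hX : ∀ u v, 0 ≤ X u v) (hX0 : ∀ u, X u u = 0) :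
    ∑ e ∈ G.all, ∑ u ∈ G.verts e, ∑ v ∈ G.verts e, X u v ≤ D * ∑ u, ∑ v, X u v := by
  classical
  have h1 : ∀ e, ∑ u ∈ G.verts e, ∑ v ∈ G.verts e, X u v
      = ∑ u, ∑ v, ind (u ∈ G.verts e ∧ v ∈ G.verts e) * X u v := by
    intro e
    rw [← Finset.sum_filter_add_sum_filter_not Finset.univ (fun u => u ∈ G.verts e)]
    rw [Finset.sum_eq_zero (s := Finset.univ.filter fun u => ¬ u ∈ G.verts e), add_zero]
    · rw [Finset.filter_univ_mem]
      refine Finset.sum_congr rfl fun u hu => ?_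
      rw [← Finset.sum_filter_add_sum_filter_not Finset.univ (fun u => u ∈ G.verts e)]
      rw [Finset.sum_eq_zero (s := Finset.univ.filter fun u => ¬ u ∈ G.verts e), add_zero]
      · rw [Finset.filter_univ_mem]
        refine Finset.sum_congr rfl fun v hv => ?_
        rw [ind_of ⟨hu, hv⟩, one_mul]
      · intro v hv
        rw [ind_of_not, zero_mul]
        exact fun hh => (Finset.mem_filter.1 hv).2 hh.2
    · intro u hu
      refine Finset.sum_eq_zero fun v _ => ?_
      rw [ind_of_not, zero_mul]
      exact fun hh => (Finset.mem_filter.1 hu).2 hh.1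
  simp_rw [h1]
  rw [Finset.sum_comm, Finset.mul_sum]
  refine Finset.sum_le_sum fun u _ => ?_
  rw [Finset.sum_comm, Finset.mul_sum]
  refine Finset.sum_le_sum fun v _ => ?_
  rw [← Finset.sum_mul]
  by_cases huv : u = v
  · rw [huv, hX0]; simp
  · refine mul_le_mul_of_nonneg_right ?_ (hX u v)
    rw [sum_ind_eq_card]
    convert h.codegree_le u v huv

/-- Closed walks of length four, counted by successively bounding the choices of their edges. -/
lemma cycleSum_le (h : G.IsGeneralType μ m Δ D Λ lam k C₁ c₂ c₃ C₄)
    (p : ι → ι → ℝ) (q : ι → ι → ι → ℝ) (r : ι → ι → ι → ι → ℝ) (B₁ B₂ B₃ : ℝ)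
    (hp : ∀ a b, 0 ≤ p a b) (hq : ∀ a b c, 0 ≤ q a b c)
    (hB₂ : 0 ≤ B₂) (hB₃ : 0 ≤ B₃)
    (h₁ : ∀ x, ∀ a ∈ G.Y, ∑ y, ∑ b ∈ G.pairEdges x y, p a b ≤ B₁)
    (h₂ : ∀ x, ∀ a ∈ G.Y, ∀ b ∈ G.Y, ∑ y, ∑ c ∈ G.pairEdges x y, q a b c ≤ B₂)
    (h₃ : ∀ x y, ∀ a ∈ G.Y, ∀ b ∈ G.Y, ∀ c ∈ G.Y, ∑ d ∈ G.pairEdges x y, r a b c d ≤ B₃) :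
    G.cycleSum (fun a b c d => p a b * q a b c * r a b c d)
      ≤ 2 * G.Y.card * (B₁ * B₂ * B₃) := by
  have e1 : ∀ x₁ x₂ x₃ : V, ∑ x₄, ∑ a ∈ G.pairEdges x₁ x₂, ∑ b ∈ G.pairEdges x₂ x₃,
      ∑ c ∈ G.pairEdges x₃ x₄, ∑ d ∈ G.pairEdges x₄ x₁, p a b * q a b c * r a b c d
      ≤ ∑ a ∈ G.pairEdges x₁ x₂, ∑ b ∈ G.pairEdges x₂ x₃, p a b * (B₂ * B₃) := by
    intro x₁ x₂ x₃
    rw [Finset.sum_comm]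
    refine Finset.sum_le_sum fun a ha => ?_
    rw [Finset.sum_comm]
    refine Finset.sum_le_sum fun b hb => ?_
    have ha := mem_Y_of_mem_pairEdges ha
    have hb := mem_Y_of_mem_pairEdges hb
    calc _ ≤ ∑ x₄, ∑ c ∈ G.pairEdges x₃ x₄, p a b * q a b c * B₃ := by
          refine Finset.sum_le_sum fun x₄ _ => Finset.sum_le_sum fun c hc => ?_
          rw [← Finset.mul_sum]
          exact mul_le_mul_of_nonneg_left (h₃ _ _ a ha b hb c (mem_Y_of_mem_pairEdges hc))
            (mul_nonneg (hp _ _) (hq _ _ _))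
      _ = p a b * ((∑ x₄, ∑ c ∈ G.pairEdges x₃ x₄, q a b c) * B₃) := by
          simp_rw [mul_assoc, ← Finset.mul_sum, ← Finset.sum_mul]
      _ ≤ _ := by
          refine mul_le_mul_of_nonneg_left ?_ (hp _ _)
          exact mul_le_mul_of_nonneg_right (h₂ _ a ha b hb) hB₃
  have e2 : ∀ x₁ x₂ : V, ∑ x₃, ∑ a ∈ G.pairEdges x₁ x₂, ∑ b ∈ G.pairEdges x₂ x₃,
      p a b * (B₂ * B₃) ≤ ∑ a ∈ G.pairEdges x₁ x₂, B₁ * B₂ * B₃ := by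
    intro x₁ x₂
    rw [Finset.sum_comm]
    refine Finset.sum_le_sum fun a ha => ?_
    simp_rw [← Finset.sum_mul]
    rw [mul_assoc B₁]
    exact mul_le_mul_of_nonneg_right (h₁ _ a (mem_Y_of_mem_pairEdges ha)) (mul_nonneg hB₂ hB₃)
  unfold cycleSum
  -- The edges are summed out from the last to the first: `d` has both ends prescribed, `c` and `b`
  -- one end each. What remains is the choice of an oriented edge `a`, with `2 * |Y|` possibilities.
  calc _ ≤ ∑ x₁, ∑ x₂, ∑ _a ∈ G.pairEdges x₁ x₂, B₁ * B₂ * B₃ := by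
        refine Finset.sum_le_sum fun x₁ _ => Finset.sum_le_sum fun x₂ _ => ?_
        exact (Finset.sum_le_sum fun x₃ _ => e1 x₁ x₂ x₃).trans (e2 x₁ x₂)
    _ = _ := by
        rw [h.sum_pairEdges]
        simp
        ring

end IsGeneralType

end Counting

end PotentialHyperedges

/-! ### Closed 4-walks whose colour sets cover each other -/

/-- In a family of four sets of equal size, each contained in the union of the others, either two
disjoint pairs of sets coincide or some set meets two of the others. -/
lemma four_sets_cases {S : Type*} [DecidableEq S] (A B C D : Finset S)
    (hAB : A.card = B.card) (hAC : A.card = C.card) (hAD : A.card = D.card)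
    (hA : A ⊆ B ∪ C ∪ D) (hB : B ⊆ A ∪ C ∪ D) (hC : C ⊆ A ∪ B ∪ D) (hD : D ⊆ A ∪ B ∪ C) :
    (A = B ∧ C = D) ∨ (B = C ∧ D = A) ∨ (A = C ∧ B = D) ∨
    (¬ Disjoint A B ∧ ¬ Disjoint A C) ∨ (¬ Disjoint A B ∧ ¬ Disjoint A D) ∨
    (¬ Disjoint A C ∧ ¬ Disjoint A D) ∨ (¬ Disjoint B A ∧ ¬ Disjoint B C) ∨
    (¬ Disjoint B A ∧ ¬ Disjoint B D) ∨ (¬ Disjoint B C ∧ ¬ Disjoint B D) ∨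
    (¬ Disjoint C A ∧ ¬ Disjoint C B) ∨ (¬ Disjoint C A ∧ ¬ Disjoint C D) ∨
    (¬ Disjoint C B ∧ ¬ Disjoint C D) ∨ (¬ Disjoint D A ∧ ¬ Disjoint D B) ∨
    (¬ Disjoint D A ∧ ¬ Disjoint D C) ∨ (¬ Disjoint D B ∧ ¬ Disjoint D C) := by
  -- A set disjoint from two of the others lies in the third, and equals it by cardinality. Hence,
  -- if no set meets two others, the four sets fall into equal pairs.
  have key : ∀ X Y Z W : Finset S, X.card = Y.card → X ⊆ Y ∪ Z ∪ W → Disjoint X Z →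
      Disjoint X W → X = Y := by
    intro X Y Z W hc hs h1 h2
    refine Finset.eq_of_subset_of_card_le (fun x hx => ?_) hc.ge
    have := hs hx
    simp only [Finset.mem_union] at this
    rcases this with (h | h) | h
    · exact h
    · exact absurd h (Finset.disjoint_left.1 h1 hx)
    · exact absurd h (Finset.disjoint_left.1 h2 hx)
  have kAB := key A B C D hAB hA
  have kAC := key A C B D hAC (by rw [Finset.union_comm C B]; exact hA)
  have kAD := key A D B C hAD
    (by rw [Finset.union_assoc, Finset.union_comm D]; exact hA)
  have kBA := key B A C D hAB.symm hB
  have kBC := key B C A D (by omega) (by rw [Finset.union_comm C A]; exact hB)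
  have kBD := key B D A C (by omega) (by rw [Finset.union_assoc, Finset.union_comm D]; exact hB)
  have kCA := key C A B D (by omega) hC
  have kCB := key C B A D (by omega) (by rw [Finset.union_comm B A]; exact hC)
  have kCD := key C D A B (by omega) (by rw [Finset.union_assoc, Finset.union_comm D]; exact hC)
  have kDA := key D A B C (by omega) hD
  have kDB := key D B A C (by omega) (by rw [Finset.union_comm B A]; exact hD)
  have kDC := key D C A B (by omega) (by rw [Finset.union_assoc, Finset.union_comm C]; exact hD)
  rw [disjoint_comm (a := B) (b := A), disjoint_comm (a := C) (b := A),
    disjoint_comm (a := D) (b := A), disjoint_comm (a := C) (b := B),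
    disjoint_comm (a := D) (b := B), disjoint_comm (a := D) (b := C)] at *
  by_cases h1 : Disjoint A B <;> by_cases h2 : Disjoint A C <;> by_cases h3 : Disjoint A D <;>
  by_cases h4 : Disjoint B C <;> by_cases h5 : Disjoint B D <;> by_cases h6 : Disjoint C D <;>
  simp only [h1, h2, h3, h4, h5, h6, true_implies, not_true, not_false_iff, and_true,
    and_false, or_false, or_true] at * <;>
  grind

namespace PotentialHyperedges

variable {V ι 𝓢 Ω : Type*} {α : 𝓢 → Type*}

open Classical in
/-- Each of the four colour sets is contained in the union of the other three. -/
def FourCovered (G : PotentialHyperedges V ι 𝓢 Ω α) (a b c d : ι) : Prop :=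
  G.colours a ⊆ G.colours b ∪ G.colours c ∪ G.colours d ∧
  G.colours b ⊆ G.colours a ∪ G.colours c ∪ G.colours d ∧
  G.colours c ⊆ G.colours a ∪ G.colours b ∪ G.colours d ∧
  G.colours d ⊆ G.colours a ∪ G.colours b ∪ G.colours c

/-- The indicator that `a`, `b` and `c`, `d` have equal colour sets. -/
noncomputable def pairedAdjacent (G : PotentialHyperedges V ι 𝓢 Ω α) (a b c d : ι) : ℝ :=
  ind (G.colours b = G.colours a) * 1 * ind (G.colours d = G.colours c)

/-- The indicator that `a`, `c` and `b`, `d` have equal colour sets. -/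
noncomputable def pairedOpposite (G : PotentialHyperedges V ι 𝓢 Ω α) (a b c d : ι) : ℝ :=
  1 * ind (G.colours c = G.colours a) * ind (G.colours d = G.colours b)

open Classical in
/-- The indicator that the colour sets of `a`, `b`, `c` are successively linked and cover the
colour set of `d`. -/
noncomputable def linked (G : PotentialHyperedges V ι 𝓢 Ω α) (a b c d : ι) : ℝ :=
  ind (¬ Disjoint (G.colours b) (G.colours a)) *
  ind (¬ Disjoint (G.colours c) (G.colours a ∪ G.colours b)) *
  ind (G.colours d ⊆ G.colours a ∪ G.colours b ∪ G.colours c)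

lemma pairedAdjacent_nonneg (G : PotentialHyperedges V ι 𝓢 Ω α) (a b c d : ι) :
    0 ≤ G.pairedAdjacent a b c d :=
  mul_nonneg (mul_nonneg (ind_nonneg _) zero_le_one) (ind_nonneg _)

lemma pairedOpposite_nonneg (G : PotentialHyperedges V ι 𝓢 Ω α) (a b c d : ι) :
    0 ≤ G.pairedOpposite a b c d :=
  mul_nonneg (mul_nonneg zero_le_one (ind_nonneg _)) (ind_nonneg _)

lemma linked_nonneg (G : PotentialHyperedges V ι 𝓢 Ω α) (a b c d : ι) :
    0 ≤ G.linked a b c d :=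
  mul_nonneg (mul_nonneg (ind_nonneg _) (ind_nonneg _)) (ind_nonneg _)

open Classical in
lemma linked_eq_one (G : PotentialHyperedges V ι 𝓢 Ω α) {a b c d : ι}
    (h1 : ¬ Disjoint (G.colours a) (G.colours b))
    (h2 : ¬ Disjoint (G.colours a) (G.colours c) ∨ ¬ Disjoint (G.colours b) (G.colours c))
    (h3 : G.colours d ⊆ G.colours a ∪ G.colours b ∪ G.colours c) : G.linked a b c d = 1 := by
  unfold linked
  rw [ind_of, ind_of, ind_of h3]
  · norm_num
  · rw [Finset.disjoint_union_right, disjoint_comm, disjoint_comm (a := G.colours c)]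
    tauto
  · rwa [disjoint_comm]

/-- Majorant for the indicator of `FourCovered`. -/
noncomputable def coverMajorant (G : PotentialHyperedges V ι 𝓢 Ω α) (a b c d : ι) : ℝ :=
  (G.pairedAdjacent a b c d + G.pairedAdjacent b c d a + G.pairedOpposite a b c d) +
  ((G.linked a b c d + G.linked b c d a) + (G.linked c d a b + G.linked d a b c)) +
  ((G.linked c b a d + G.linked d c b a) + (G.linked a d c b + G.linked b a d c))

/-- The walk count for `linked` needs three consecutive edges of the walk to form the cluster, with
each new edge meeting an earlier one and the covered edge last. Any three edges of a 4-walk are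
consecutive, but the set meeting the other two may sit in the middle or at either end of this arc;
the rotations and reflections in the majorant allow the arc to be read from a suitable end. -/
lemma ind_fourCovered_le (G : PotentialHyperedges V ι 𝓢 Ω α) {a b c d : ι}
    (hab : (G.colours a).card = (G.colours b).card) (hac : (G.colours a).card = (G.colours c).card)
    (had : (G.colours a).card = (G.colours d).card) :
    ind (G.FourCovered a b c d) ≤ G.coverMajorant a b c d := by
  classical
  have hA := G.pairedAdjacent_nonneg
  have hO := G.pairedOpposite_nonneg
  have hL := G.linked_nonneg
  have hA1 := hA a b c d
  have hA2 := hA b c d a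
  have hO1 := hO a b c d
  have l1 := hL a b c d
  have l2 := hL b c d a
  have l3 := hL c d a b
  have l4 := hL d a b c
  have l5 := hL c b a d
  have l6 := hL d c b a
  have l7 := hL a d c b
  have l8 := hL b a d c
  unfold coverMajorant
  refine ind_le (by linarith) ?_
  rintro ⟨h1, h2, h3, h4⟩
  have hcov : ∀ X Y Z W : Finset 𝓢, W ⊆ X ∪ Y ∪ Z →
      W ⊆ X ∪ Z ∪ Y ∧ W ⊆ Y ∪ X ∪ Z ∧ W ⊆ Y ∪ Z ∪ X ∧ W ⊆ Z ∪ X ∪ Y ∧ W ⊆ Z ∪ Y ∪ X := by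
    intro X Y Z W h
    refine ⟨?_, ?_, ?_, ?_, ?_⟩ <;> refine h.trans (fun x hx => ?_) <;>
      simp only [Finset.mem_union] at hx ⊢ <;> tauto
  have g1 := hcov _ _ _ _ h1
  have g2 := hcov _ _ _ _ h2
  have g3 := hcov _ _ _ _ h3
  have g4 := hcov _ _ _ _ h4
  have hcases := four_sets_cases _ _ _ _ hab hac had h1 h2 h3 h4
  have sym : ∀ {X Y : Finset 𝓢}, ¬ Disjoint X Y → ¬ Disjoint Y X := fun h h' => h h'.symm
  rcases hcases with ⟨e1, e2⟩ | ⟨e1, e2⟩ | ⟨e1, e2⟩ | ⟨e1, e2⟩ | ⟨e1, e2⟩ | ⟨e1, e2⟩ | ⟨e1, e2⟩ |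
    ⟨e1, e2⟩ | ⟨e1, e2⟩ | ⟨e1, e2⟩ | ⟨e1, e2⟩ | ⟨e1, e2⟩ | ⟨e1, e2⟩ | ⟨e1, e2⟩ | ⟨e1, e2⟩
  · have : G.pairedAdjacent a b c d = 1 := by
      unfold pairedAdjacent; rw [ind_of e1.symm, ind_of e2.symm]; norm_num
    linarith
  · have : G.pairedAdjacent b c d a = 1 := by
      unfold pairedAdjacent; rw [ind_of e1.symm, ind_of e2.symm]; norm_num
    linarith
  · have : G.pairedOpposite a b c d = 1 := by
      unfold pairedOpposite; rw [ind_of e1.symm, ind_of e2.symm]; norm_num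
    linarith
  · have := G.linked_eq_one (e1) (.inl e2) h4
    linarith
  · have := G.linked_eq_one (sym e1) (.inr e2) g3.2.1
    linarith
  · have := G.linked_eq_one (e2) (.inl e1) g2.1
    linarith
  · have := G.linked_eq_one (sym e1) (.inr e2) h4
    linarith
  · have := G.linked_eq_one (e1) (.inl e2) g3.2.1
    linarith
  · have := G.linked_eq_one (e1) (.inl e2) h1
    linarith
  · have := G.linked_eq_one (e2) (.inl e1) g4.2.2.2.2
    linarith
  · have := G.linked_eq_one (e2) (.inl e1) g2.2.2.1
    linarith
  · have := G.linked_eq_one (sym e1) (.inr e2) h1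
    linarith
  · have := G.linked_eq_one (e1) (.inl e2) g3.2.2.2.1
    linarith
  · have := G.linked_eq_one (sym e1) (.inr e2) g2.1
    linarith
  · have := G.linked_eq_one (e2) (.inl e1) g1.2.2.2.2
    linarith

section

variable [MeasurableSpace Ω] [∀ i, MeasurableSpace (α i)]
  {G : PotentialHyperedges V ι 𝓢 Ω α} {μ : Measure Ω} {m Δ D Λ lam : ℝ} {k : ℕ}
  {C₁ c₂ c₃ C₄ : ℝ}

namespace IsGeneralType

lemma card_colours_Y_le (h : G.IsGeneralType μ m Δ D Λ lam k C₁ c₂ c₃ C₄) {a : ι}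
    (ha : a ∈ G.Y) : (G.colours a).card ≤ k :=
  h.card_colours_le a (G.Y_subset_all ha)

variable [Fintype V]

/-- Given `a`, there are `Λ * lam` choices for `b` with the same colours, `Δ` for `c`, and `lam` for
`d`, whose ends and colours are both prescribed. -/
lemma cycleSum_pairedAdjacent_le (h : G.IsGeneralType μ m Δ D Λ lam k C₁ c₂ c₃ C₄)
    (hΔ : 0 ≤ Δ) (hlam : 0 ≤ lam) :
    G.cycleSum G.pairedAdjacent ≤ 2 * G.Y.card * (Λ * lam * Δ * lam) :=
  h.cycleSum_le (fun a b => ind (G.colours b = G.colours a)) (fun _ _ _ => 1)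
    (fun _ _ c d => ind (G.colours d = G.colours c)) _ _ _ (fun _ _ => ind_nonneg _)
    (fun _ _ _ => zero_le_one) hΔ hlam (fun x _ ha => h.sum_same_colours_le x ha)
    (fun x _ _ _ _ => h.sum_card_pairEdges_le x)
    (fun x y _ _ _ _ _ _ => h.sum_colours_eq_le hlam x y _)

lemma cycleSum_pairedOpposite_le (h : G.IsGeneralType μ m Δ D Λ lam k C₁ c₂ c₃ C₄)
    (hΛ : 0 ≤ Λ) (hlam : 0 ≤ lam) :
    G.cycleSum G.pairedOpposite ≤ 2 * G.Y.card * (Δ * (Λ * lam) * lam) :=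
  h.cycleSum_le (fun _ _ => 1) (fun a _ c => ind (G.colours c = G.colours a))
    (fun _ b _ d => ind (G.colours d = G.colours b)) _ _ _ (fun _ _ => zero_le_one)
    (fun _ _ _ => ind_nonneg _) (mul_nonneg hΛ hlam) hlam
    (fun x _ _ => h.sum_card_pairEdges_le x)
    (fun x _ ha _ _ => h.sum_same_colours_le x ha)
    (fun x y _ _ _ _ _ _ => h.sum_colours_eq_le hlam x y _)

/-- The edge `b` shares one of at most `k` colours with `a`, and `c` one of at most `2 * k` colours
with `a` and `b`, which costs a factor `D` each time. The colours of `d` form a subset of a set of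
size at most `3 * k`. -/
lemma cycleSum_linked_le (h : G.IsGeneralType μ m Δ D Λ lam k C₁ c₂ c₃ C₄)
    (hD : 0 ≤ D) (hlam : 0 ≤ lam) :
    G.cycleSum G.linked
      ≤ 2 * G.Y.card * ((k * D) * ((2 * k) * D) * (2 ^ (3 * k) * lam)) := by
  classical
  refine h.cycleSum_le (fun a b => ind (¬ Disjoint (G.colours b) (G.colours a)))
    (fun a b c => ind (¬ Disjoint (G.colours c) (G.colours a ∪ G.colours b)))
    (fun a b c d => ind (G.colours d ⊆ G.colours a ∪ G.colours b ∪ G.colours c))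
    _ _ _ (fun _ _ => ind_nonneg _) (fun _ _ _ => ind_nonneg _) (by positivity) (by positivity)
    ?_ ?_ ?_
  · intro x a ha
    refine (h.sum_not_disjoint_le x _).trans ?_
    have : ((G.colours a).card : ℝ) ≤ k := by exact_mod_cast h.card_colours_Y_le ha
    gcongr
  · intro x a ha b hb
    refine (h.sum_not_disjoint_le x _).trans ?_
    have : ((G.colours a ∪ G.colours b).card : ℝ) ≤ 2 * k := by
      have h1 := Finset.card_union_le (G.colours a) (G.colours b)
      have h2 := h.card_colours_Y_le ha
      have h3 := h.card_colours_Y_le hb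
      exact_mod_cast (by omega)
    gcongr
  · intro x y a ha b hb c hc
    refine (h.sum_colours_subset_le hlam x y _).trans ?_
    have : (G.colours a ∪ G.colours b ∪ G.colours c).card ≤ 3 * k := by
      have h1 := Finset.card_union_le (G.colours a) (G.colours b)
      have h1' := Finset.card_union_le (G.colours a ∪ G.colours b) (G.colours c)
      have h2 := h.card_colours_Y_le ha
      have h3 := h.card_colours_Y_le hb
      have h4 := h.card_colours_Y_le hc
      omega
    gcongr
    norm_num

/-- Walk sums are invariant under rotation and reflection, so the majorant costs three paired sums
and eight linked ones. With the factor `2` for the orientation of the first edge this gives `6 = 2 *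
3` and `32 = 2 * 8 * 2`. -/
lemma cycleSum_fourCovered_le (h : G.IsGeneralType μ m Δ D Λ lam k C₁ c₂ c₃ C₄)
    (hΔ : 0 ≤ Δ) (hD : 0 ≤ D) (hΛ : 0 ≤ Λ) (hlam : 0 ≤ lam) :
    G.cycleSum (fun a b c d => ind (G.FourCovered a b c d))
      ≤ G.Y.card * (6 * (Λ * lam * Δ * lam) + 32 * k ^ 2 * 2 ^ (3 * k) * (D ^ 2 * lam)) := by
  have h1 : G.cycleSum (fun a b c d => ind (G.FourCovered a b c d)) ≤ G.cycleSum G.coverMajorant :=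
    G.cycleSum_mono fun a ha b hb c hc d hd => G.ind_fourCovered_le
      (h.card_colours_Y a ha b hb) (h.card_colours_Y a ha c hc) (h.card_colours_Y a ha d hd)
  have hA := h.cycleSum_pairedAdjacent_le hΔ hlam
  have hO := h.cycleSum_pairedOpposite_le hΛ hlam
  have hL := h.cycleSum_linked_le hD hlam
  have h2 : G.cycleSum G.coverMajorant = 2 * G.cycleSum G.pairedAdjacent
      + G.cycleSum G.pairedOpposite + 8 * G.cycleSum G.linked := by
    unfold coverMajorant
    simp only [cycleSum_add]
    have r1 := fun F : ι → ι → ι → ι → ℝ => G.cycleSum_rotate F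
    have r2 : ∀ F : ι → ι → ι → ι → ℝ, G.cycleSum (fun a b c d => F c d a b) = G.cycleSum F :=
      fun F => by
        rw [← r1 F, ← r1 (fun a b c d => F b c d a)]
    have r3 : ∀ F : ι → ι → ι → ι → ℝ, G.cycleSum (fun a b c d => F d a b c) = G.cycleSum F :=
      fun F => by
        rw [← r1 F, ← r2 (fun a b c d => F b c d a)]
    have s1 := fun F : ι → ι → ι → ι → ℝ => G.cycleSum_reflect F
    have s2 : ∀ F : ι → ι → ι → ι → ℝ, G.cycleSum (fun a b c d => F d c b a) = G.cycleSum F :=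
      fun F => by rw [← s1 F, ← r1 (fun a b c d => F c b a d)]
    have s3 : ∀ F : ι → ι → ι → ι → ℝ, G.cycleSum (fun a b c d => F a d c b) = G.cycleSum F :=
      fun F => by rw [← s1 F, ← r2 (fun a b c d => F c b a d)]
    have s4 : ∀ F : ι → ι → ι → ι → ℝ, G.cycleSum (fun a b c d => F b a d c) = G.cycleSum F :=
      fun F => by rw [← s1 F, ← r3 (fun a b c d => F c b a d)]
    rw [r1 G.pairedAdjacent, r1 G.linked, r2 G.linked, r3 G.linked, s1 G.linked, s2 G.linked,
      s3 G.linked, s4 G.linked]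
    ring
  rw [h2] at h1
  nlinarith [h1, hA, hO, hL]

end IsGeneralType

end

end PotentialHyperedges

/-! ### Independence and centred indicators -/

section Independence

variable {Ω : Type*} [MeasurableSpace Ω] {μ : Measure Ω}

lemma ind_mul_ind (p q : Prop) : ind p * ind q = ind (p ∧ q) := by
  by_cases hp : p <;> by_cases hq : q <;> simp [ind, hp, hq]

lemma measurable_ind_mem {A : Set Ω} (hA : MeasurableSet A) :
    Measurable fun ω => ind (ω ∈ A) := by
  classical
  have : (fun ω => ind (ω ∈ A)) = A.indicator fun _ => (1 : ℝ) := by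
    ext ω; simp [ind, Set.indicator_apply]
  rw [this]
  exact measurable_const.indicator hA

lemma integral_ind_mem {A : Set Ω} (hA : MeasurableSet A) :
    ∫ ω, ind (ω ∈ A) ∂μ = μ.real A := by
  classical
  have : (fun ω => ind (ω ∈ A)) = A.indicator 1 := by
    ext ω; simp [ind, Set.indicator_apply]
  rw [this, integral_indicator_one hA]

lemma integrable_of_abs_le [IsFiniteMeasure μ] {f : Ω → ℝ} (hf : Measurable f) (C : ℝ)
    (hC : ∀ ω, |f ω| ≤ C) : Integrable f μ :=
  Integrable.of_bound hf.aestronglyMeasurable C (Filter.Eventually.of_forall hC)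

lemma integrable_ind_mem [IsFiniteMeasure μ] {A : Set Ω} (hA : MeasurableSet A) :
    Integrable (fun ω => ind (ω ∈ A)) μ :=
  integrable_of_abs_le (measurable_ind_mem hA) 1 fun ω => by
    rw [abs_of_nonneg (ind_nonneg _)]; exact ind_le_one _

lemma abs_integral_le_one [IsProbabilityMeasure μ] {f : Ω → ℝ} (hf : ∀ ω, |f ω| ≤ 1) :
    |∫ ω, f ω ∂μ| ≤ 1 := by
  have h := norm_integral_le_of_norm_le_const (μ := μ) (f := f) (C := 1) (Filter.Eventually.of_forall hf)
  simpa using h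

lemma prod_ind {A : Type*} [Fintype A] (p : A → Prop) : ∏ i, ind (p i) = ind (∀ i, p i) := by
  classical
  by_cases h : ∀ i, p i
  · rw [ind_of h]; exact Finset.prod_eq_one fun i _ => ind_of (h i)
  · rw [ind_of_not h]
    push Not at h
    obtain ⟨i, hi⟩ := h
    exact Finset.prod_eq_zero (Finset.mem_univ i) (ind_of_not hi)

/-- If an event is independent of a family of events, its centred indicator is orthogonal to every
product of affine functions of the indicators of that family. -/
lemma EventIndepOf.integral_mul_prod_eq_zero [IsFiniteMeasure μ] {A : Set Ω} {n : ℕ}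
    {B : Fin n → Set Ω} (h : EventIndepOf μ A B) (hA : MeasurableSet A)
    (hB : ∀ i, MeasurableSet (B i)) (α γ : Fin n → ℝ) :
    ∫ ω, (ind (ω ∈ A) - μ.real A) * ∏ i, (α i * ind (ω ∈ B i) + γ i) ∂μ = 0 := by
  classical
  set E : Fin n → Bool → Set Ω := fun i b => if b then B i else (B i)ᶜ with hE
  set c : Fin n → Bool → ℝ := fun i b => if b then α i + γ i else γ i with hc
  have hEm : ∀ i b, MeasurableSet (E i b) := by
    intro i b
    cases b
    · simpa [hE] using (hB i).compl
    · simpa [hE] using hB i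
  -- An affine function of an indicator is a combination of the indicators of `B i` and its
  -- complement. The product therefore expands over the atoms appearing in the definition of
  -- independence.
  have h1 : ∀ ω, (ind (ω ∈ A) - μ.real A) * ∏ i, (α i * ind (ω ∈ B i) + γ i)
      = ∑ s : Fin n → Bool, (∏ i, c i (s i)) *
        (ind (ω ∈ A ∩ ⋂ i, E i (s i)) - μ.real A * ind (ω ∈ ⋂ i, E i (s i))) := by
    intro ω
    have h2 : ∀ i, α i * ind (ω ∈ B i) + γ i = ∑ b, c i b * ind (ω ∈ E i b) := by
      intro i
      by_cases hω : ω ∈ B i <;> simp [hE, hc, ind, hω]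
    simp_rw [h2]
    rw [Fintype.prod_sum, Finset.mul_sum]
    refine Finset.sum_congr rfl fun s _ => ?_
    rw [Finset.prod_mul_distrib, prod_ind]
    simp_rw [Set.mem_inter_iff, ← ind_mul_ind, Set.mem_iInter]
    ring
  have hEI : ∀ s : Fin n → Bool, MeasurableSet (⋂ i, E i (s i)) :=
    fun s => MeasurableSet.iInter fun i => hEm i _
  simp_rw [h1]
  rw [integral_finsetSum]
  · refine Finset.sum_eq_zero fun s _ => ?_
    rw [integral_const_mul, integral_sub (integrable_ind_mem (hA.inter (hEI s)))
      ((integrable_ind_mem (hEI s)).const_mul _), integral_const_mul,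
      integral_ind_mem (hA.inter (hEI s)), integral_ind_mem (hEI s),
      h (fun i => E i (s i)) fun i => by cases hs : s i <;> simp [hE]]
    ring
  · intro s _
    exact ((integrable_ind_mem (hA.inter (hEI s))).sub
      ((integrable_ind_mem (hEI s)).const_mul _)).const_mul _

end Independence

/-! ### The deviation matrix and its mixed moments -/

namespace PotentialHyperedges

variable {V ι 𝓢 Ω : Type*} {α : 𝓢 → Type*}

/-- The indicator of `e ∈ R`. -/
noncomputable def rInd (G : PotentialHyperedges V ι 𝓢 Ω α) (e : ι) (ω : Ω) : ℝ :=
  ind (ω ∈ G.inR e)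

lemma rInd_nonneg (G : PotentialHyperedges V ι 𝓢 Ω α) (e : ι) (ω : Ω) : 0 ≤ G.rInd e ω :=
  ind_nonneg _

lemma rInd_le_one (G : PotentialHyperedges V ι 𝓢 Ω α) (e : ι) (ω : Ω) : G.rInd e ω ≤ 1 :=
  ind_le_one _

lemma abs_rInd_le_one (G : PotentialHyperedges V ι 𝓢 Ω α) (e : ι) (ω : Ω) : |G.rInd e ω| ≤ 1 := by
  rw [abs_of_nonneg (G.rInd_nonneg e ω)]; exact G.rInd_le_one e ω

variable [MeasurableSpace Ω]

/-- The centred indicator of `f ∈ T`. -/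
noncomputable def tau (G : PotentialHyperedges V ι 𝓢 Ω α) (μ : Measure Ω) (f : ι) (ω : Ω) : ℝ :=
  ind (ω ∈ G.inT f) - μ.real (G.inT f)

/-- The deviation of `B(u, v)` from its mean. -/
noncomputable def discr (G : PotentialHyperedges V ι 𝓢 Ω α) (μ : Measure Ω) (u v : V) (ω : Ω) : ℝ :=
  ∑ f ∈ G.pairEdges u v, G.tau μ f ω

open Classical in
/-- The off-diagonal part of the square of the matrix `discr`. -/
noncomputable def discrSq [Fintype V] (G : PotentialHyperedges V ι 𝓢 Ω α) (μ : Measure Ω)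
    (u v : V) (ω : Ω) : ℝ :=
  if u = v then 0 else ∑ w, G.discr μ u w ω * G.discr μ w v ω

lemma abs_tau_le_one (G : PotentialHyperedges V ι 𝓢 Ω α) (μ : Measure Ω) [IsProbabilityMeasure μ]
    (f : ι) (ω : Ω) : |G.tau μ f ω| ≤ 1 := by
  have h1 := ind_nonneg (ω ∈ G.inT f)
  have h2 := ind_le_one (ω ∈ G.inT f)
  have h3 : 0 ≤ μ.real (G.inT f) := measureReal_nonneg
  have h4 : μ.real (G.inT f) ≤ 1 := measureReal_le_one
  unfold tau
  rw [abs_le]; constructor <;> linarith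

lemma abs_discr_le_sum {G : PotentialHyperedges V ι 𝓢 Ω α} {μ : Measure Ω}
    [IsProbabilityMeasure μ] (u v : V) (ω : Ω) :
    |G.discr μ u v ω| ≤ ∑ _f ∈ G.pairEdges u v, (1 : ℝ) := by
  unfold discr
  exact (Finset.abs_sum_le_sum_abs _ _).trans
    (Finset.sum_le_sum fun f _ => G.abs_tau_le_one μ f ω)

lemma abs_discr_le {G : PotentialHyperedges V ι 𝓢 Ω α} {μ : Measure Ω}
    [IsProbabilityMeasure μ] (u v : V) (ω : Ω) : |G.discr μ u v ω| ≤ G.Y.card := by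
  refine (abs_discr_le_sum u v ω).trans ?_
  rw [Finset.sum_const, nsmul_eq_mul, mul_one]
  exact_mod_cast Finset.card_le_card fun f hf => mem_Y_of_mem_pairEdges hf

lemma discr_comm (G : PotentialHyperedges V ι 𝓢 Ω α) (μ : Measure Ω) (u v : V) (ω : Ω) :
    G.discr μ u v ω = G.discr μ v u ω := by
  unfold discr; rw [G.pairEdges_comm]

variable [∀ i, MeasurableSpace (α i)]
  {G : PotentialHyperedges V ι 𝓢 Ω α} {μ : Measure Ω} {m Δ D Λ lam : ℝ} {k : ℕ}
  {C₁ c₂ c₃ C₄ : ℝ}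

namespace IsGeneralType

lemma colourAlgebra_le (h : G.IsGeneralType μ m Δ D Λ lam k C₁ c₂ c₃ C₄) (S : Finset 𝓢) :
    G.colourAlgebra S ≤ (inferInstance : MeasurableSpace Ω) :=
  iSup₂_le fun i _ => (h.measurable_Z i).comap_le

lemma measurableSet_inR (h : G.IsGeneralType μ m Δ D Λ lam k C₁ c₂ c₃ C₄) {e : ι}
    (he : e ∈ G.all) : MeasurableSet (G.inR e) :=
  h.colourAlgebra_le _ _ (h.R_function e he)

lemma measurableSet_inT (h : G.IsGeneralType μ m Δ D Λ lam k C₁ c₂ c₃ C₄) {e : ι}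
    (he : e ∈ G.Y) : MeasurableSet (G.inT e) :=
  h.colourAlgebra_le _ _ (h.T_function e he)

lemma measurable_rInd (h : G.IsGeneralType μ m Δ D Λ lam k C₁ c₂ c₃ C₄) {e : ι}
    (he : e ∈ G.all) : Measurable (G.rInd e) :=
  measurable_ind_mem (h.measurableSet_inR he)

lemma measurable_tau (h : G.IsGeneralType μ m Δ D Λ lam k C₁ c₂ c₃ C₄) {e : ι}
    (he : e ∈ G.Y) : Measurable (G.tau μ e) :=
  (measurable_ind_mem (h.measurableSet_inT he)).sub_const _

lemma measurable_discr (h : G.IsGeneralType μ m Δ D Λ lam k C₁ c₂ c₃ C₄) (u v : V) :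
    Measurable (G.discr μ u v) :=
  Finset.measurable_fun_sum _ fun _ hf => h.measurable_tau (mem_Y_of_mem_pairEdges hf)

lemma discr_self (h : G.IsGeneralType μ m Δ D Λ lam k C₁ c₂ c₃ C₄) (u : V) (ω : Ω) :
    G.discr μ u u ω = 0 := by
  unfold discr; rw [h.pairEdges_self]; simp

end IsGeneralType

end PotentialHyperedges

lemma abs_mul_le_one {a b : ℝ} (ha : |a| ≤ 1) (hb : |b| ≤ 1) : |a * b| ≤ 1 := by
  rw [abs_mul]
  exact mul_le_one₀ ha (abs_nonneg _) hb

namespace PotentialHyperedges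

variable {V ι 𝓢 Ω : Type*} {α : 𝓢 → Type*} [MeasurableSpace Ω] [∀ i, MeasurableSpace (α i)]
  {G : PotentialHyperedges V ι 𝓢 Ω α} {μ : Measure Ω} {m Δ D Λ lam : ℝ} {k : ℕ}
  {C₁ c₂ c₃ C₄ : ℝ}

namespace IsGeneralType

variable [IsProbabilityMeasure μ]

/-- Distinct colour sets of equal size are not nested, so the two centred indicators are orthogonal.
-/
lemma integral_tau_mul_tau_le (h : G.IsGeneralType μ m Δ D Λ lam k C₁ c₂ c₃ C₄) {a b : ι}
    (ha : a ∈ G.Y) (hb : b ∈ G.Y) :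
    ∫ ω, G.tau μ a ω * G.tau μ b ω ∂μ ≤ ind (G.colours b = G.colours a) := by
  classical
  by_cases hc : G.colours b = G.colours a
  · rw [ind_of hc]
    exact (le_abs_self _).trans
      (abs_integral_le_one fun ω => abs_mul_le_one (G.abs_tau_le_one μ a ω) (G.abs_tau_le_one μ b ω))
  · rw [ind_of_not hc]
    have h1 : ¬ G.colours b ⊆ G.colours a := fun hs =>
      hc (Finset.eq_of_subset_of_card_le hs (h.card_colours_Y a ha b hb).le)
    have h2 := (h.indep_T 1 ![a] b (by simpa using ha) hb
      (by simpa using h1)).integral_mul_prod_eq_zero (h.measurableSet_inT hb)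
      (fun i => by simpa using h.measurableSet_inT ha) (fun _ => 1)
      (fun _ => - μ.real (G.inT a))
    refine le_of_eq ?_
    rw [← h2]
    refine integral_congr_ae (Filter.Eventually.of_forall fun ω => ?_)
    simp only [tau, Finset.univ_unique, Finset.prod_singleton, Matrix.cons_val_fin_one]
    ring

open Classical in
lemma integral_rInd_mul_eq_zero (h : G.IsGeneralType μ m Δ D Λ lam k C₁ c₂ c₃ C₄) {e f g : ι}
    (he : e ∈ G.all) (hf : f ∈ G.Y) (hg : g ∈ G.Y)
    (hc : ¬ G.colours g ⊆ G.colours e ∪ G.colours f) :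
    ∫ ω, G.rInd e ω * (G.tau μ f ω * G.tau μ g ω) ∂μ = 0 := by
  -- The constants `0` and `- μ.real (G.inT f)` leave the indicator of `e ∈ R` uncentred and centre
  -- that of `f ∈ T`.
  have h2 := (h.indep_T_R_T e he f hf g hg (by convert hc)).integral_mul_prod_eq_zero
    (h.measurableSet_inT hg)
    (fun i => by
      fin_cases i
      · exact h.measurableSet_inR he
      · exact h.measurableSet_inT hf) (fun _ => 1) ![0, - μ.real (G.inT f)]
  rw [← h2]
  refine integral_congr_ae (Filter.Eventually.of_forall fun ω => ?_)
  simp only [tau, rInd, Fin.prod_univ_two, Matrix.cons_val_zero, Matrix.cons_val_one]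
  ring

-- The integral vanishes unless each of the colour sets of `f` and `g` is covered by the other one
-- and that of `e`. If moreover `f` shares no colour with `e`, its colour set lies in that of `g`,
-- and equal size forces equality.
open Classical in
lemma abs_integral_rInd_mul_le (h : G.IsGeneralType μ m Δ D Λ lam k C₁ c₂ c₃ C₄) {e f g : ι}
    (he : e ∈ G.all) (hf : f ∈ G.Y) (hg : g ∈ G.Y) :
    |∫ ω, G.rInd e ω * (G.tau μ f ω * G.tau μ g ω) ∂μ|
      ≤ ind (G.colours g = G.colours f) +
        ind (¬ Disjoint (G.colours f) (G.colours e)) *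
          ind (G.colours g ⊆ G.colours e ∪ G.colours f) := by
  have hnn : 0 ≤ ind (G.colours g = G.colours f) +
        ind (¬ Disjoint (G.colours f) (G.colours e)) *
          ind (G.colours g ⊆ G.colours e ∪ G.colours f) :=
    add_nonneg (ind_nonneg _) (mul_nonneg (ind_nonneg _) (ind_nonneg _))
  by_cases h1 : G.colours g ⊆ G.colours e ∪ G.colours f
  · by_cases h2 : G.colours f ⊆ G.colours e ∪ G.colours g
    · refine (abs_integral_le_one fun ω => abs_mul_le_one (G.abs_rInd_le_one e ω)
        (abs_mul_le_one (G.abs_tau_le_one μ f ω) (G.abs_tau_le_one μ g ω))).trans ?_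
      by_cases hd : Disjoint (G.colours f) (G.colours e)
      · have hs : G.colours f ⊆ G.colours g := fun x hx =>
          (Finset.mem_union.1 (h2 hx)).resolve_left (Finset.disjoint_left.1 hd hx)
        have heq := Finset.eq_of_subset_of_card_le hs (h.card_colours_Y g hg f hf).le
        rw [ind_of heq.symm]
        have := mul_nonneg (ind_nonneg (¬ Disjoint (G.colours f) (G.colours e)))
          (ind_nonneg (G.colours g ⊆ G.colours e ∪ G.colours f))
        linarith
      · rw [ind_of hd, ind_of h1]
        have := ind_nonneg (G.colours g = G.colours f)
        linarith
    · have := h.integral_rInd_mul_eq_zero he hg hf h2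
      simp_rw [mul_comm (G.tau μ f _)]
      rw [this, abs_zero]; exact hnn
  · rw [h.integral_rInd_mul_eq_zero he hf hg h1, abs_zero]; exact hnn

lemma integral_rInd_mul_tau (h : G.IsGeneralType μ m Δ D Λ lam k C₁ c₂ c₃ C₄) {e f : ι}
    (he : e ∈ G.all) (hf : f ∈ G.Y) :
    ∫ ω, G.rInd e ω * G.tau μ f ω ∂μ
      = μ.real (G.inR e ∩ G.inT f) - μ.real (G.inR e) * μ.real (G.inT f) := by
  have hR := h.measurableSet_inR he
  have hT := h.measurableSet_inT hf
  have h1 : ∀ ω, G.rInd e ω * G.tau μ f ω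
      = ind (ω ∈ G.inR e ∩ G.inT f) - ind (ω ∈ G.inR e) * μ.real (G.inT f) := by
    intro ω
    rw [Set.mem_inter_iff, ← ind_mul_ind]
    unfold rInd tau
    ring
  simp_rw [h1]
  rw [integral_sub (integrable_ind_mem (hR.inter hT)) ((integrable_ind_mem hR).mul_const _),
    integral_mul_const, integral_ind_mem (hR.inter hT), integral_ind_mem hR]

lemma integral_tau_four_eq_zero (h : G.IsGeneralType μ m Δ D Λ lam k C₁ c₂ c₃ C₄) [DecidableEq 𝓢]
    {a b c d : ι} (ha : a ∈ G.Y) (hb : b ∈ G.Y) (hc : c ∈ G.Y) (hd : d ∈ G.Y)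
    (hs : ¬ G.colours a ⊆ G.colours b ∪ G.colours c ∪ G.colours d) :
    ∫ ω, G.tau μ a ω * G.tau μ b ω * (G.tau μ c ω * G.tau μ d ω) ∂μ = 0 := by
  classical
  have hu : Finset.univ.biUnion (fun i => G.colours (![b, c, d] i))
      = G.colours b ∪ G.colours c ∪ G.colours d := by
    ext x
    simp [Fin.exists_fin_succ]
  have h2 := (h.indep_T 3 ![b, c, d] a (by intro i; fin_cases i <;> assumption) ha
    (fun hsub => hs (by
      rw [← hu]
      intro x hx
      have := hsub hx
      simp only [Finset.mem_biUnion] at this ⊢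
      exact this))).integral_mul_prod_eq_zero (h.measurableSet_inT ha)
    (fun i => by
      fin_cases i
      · exact h.measurableSet_inT hb
      · exact h.measurableSet_inT hc
      · exact h.measurableSet_inT hd) (fun _ => 1)
    (fun i => - μ.real (G.inT (![b, c, d] i)))
  rw [← h2]
  refine integral_congr_ae (Filter.Eventually.of_forall fun ω => ?_)
  simp only [tau, Fin.prod_univ_three, Matrix.cons_val_zero, Matrix.cons_val_one, Matrix.cons_val]
  ring

/-- An edge whose colours are not covered by the other three is independent of them, and its centred
indicator makes the integral vanish. -/
lemma integral_tau_four_le (h : G.IsGeneralType μ m Δ D Λ lam k C₁ c₂ c₃ C₄)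
    {a b c d : ι} (ha : a ∈ G.Y) (hb : b ∈ G.Y) (hc : c ∈ G.Y) (hd : d ∈ G.Y) :
    ∫ ω, G.tau μ a ω * G.tau μ b ω * (G.tau μ c ω * G.tau μ d ω) ∂μ
      ≤ ind (G.FourCovered a b c d) := by
  classical
  by_cases hF : G.FourCovered a b c d
  · rw [ind_of hF]
    exact (le_abs_self _).trans (abs_integral_le_one fun ω => abs_mul_le_one
      (abs_mul_le_one (G.abs_tau_le_one μ a ω) (G.abs_tau_le_one μ b ω))
      (abs_mul_le_one (G.abs_tau_le_one μ c ω) (G.abs_tau_le_one μ d ω)))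
  · rw [ind_of_not hF]
    unfold FourCovered at hF
    refine le_of_eq ?_
    by_cases h1 : G.colours a ⊆ G.colours b ∪ G.colours c ∪ G.colours d
    · by_cases h2 : G.colours b ⊆ G.colours a ∪ G.colours c ∪ G.colours d
      · by_cases h3 : G.colours c ⊆ G.colours a ∪ G.colours b ∪ G.colours d
        · have h4 : ¬ G.colours d ⊆ G.colours a ∪ G.colours b ∪ G.colours c :=
            fun h4 => hF ⟨h1, h2, h3, h4⟩
          rw [← h.integral_tau_four_eq_zero hd ha hb hc h4]
          exact integral_congr_ae (Filter.Eventually.of_forall fun ω => by simp only []; ring)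
        · rw [← h.integral_tau_four_eq_zero hc ha hb hd h3]
          exact integral_congr_ae (Filter.Eventually.of_forall fun ω => by simp only []; ring)
      · rw [← h.integral_tau_four_eq_zero hb ha hc hd h2]
        exact integral_congr_ae (Filter.Eventually.of_forall fun ω => by simp only []; ring)
    · exact h.integral_tau_four_eq_zero ha hb hc hd h1

end IsGeneralType

end PotentialHyperedges

/-! ### Expectations of the gains and errors -/

namespace PotentialHyperedges

variable {V ι 𝓢 Ω : Type*} {α : 𝓢 → Type*} [MeasurableSpace Ω] [∀ i, MeasurableSpace (α i)]
  {G : PotentialHyperedges V ι 𝓢 Ω α} {μ : Measure Ω} {m Δ D Λ lam : ℝ} {k : ℕ}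
  {C₁ c₂ c₃ C₄ : ℝ}

namespace IsGeneralType

variable [IsProbabilityMeasure μ]

variable [Fintype V]

/-- This and the next two bounds hold for every outcome. They serve integrability, the exceptional
event and bounded `m`. -/
lemma sum_abs_discr_le (h : G.IsGeneralType μ m Δ D Λ lam k C₁ c₂ c₃ C₄) (u : V) (ω : Ω) :
    ∑ w, |G.discr μ u w ω| ≤ G.Y.card := by
  classical
  refine (Finset.sum_le_sum fun w _ => abs_discr_le_sum u w ω).trans ?_
  rw [h.sum_pairEdges_right, Finset.sum_const, nsmul_eq_mul, mul_one]
  exact_mod_cast Finset.card_le_card (Finset.filter_subset _ _)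

lemma sum_discr_sq_le (h : G.IsGeneralType μ m Δ D Λ lam k C₁ c₂ c₃ C₄) (u : V) (ω : Ω) :
    ∑ w, G.discr μ u w ω ^ 2 ≤ (G.Y.card : ℝ) ^ 2 := by
  calc _ ≤ ∑ w, |G.discr μ u w ω| * G.Y.card := by
        refine Finset.sum_le_sum fun w _ => ?_
        rw [← sq_abs, sq]
        exact mul_le_mul_of_nonneg_left (abs_discr_le u w ω) (abs_nonneg _)
    _ ≤ _ := by
        rw [← Finset.sum_mul, sq]
        exact mul_le_mul_of_nonneg_right (h.sum_abs_discr_le u ω) (Nat.cast_nonneg _)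

lemma abs_discrSq_le (h : G.IsGeneralType μ m Δ D Λ lam k C₁ c₂ c₃ C₄) (u v : V) (ω : Ω) :
    |G.discrSq μ u v ω| ≤ (G.Y.card : ℝ) ^ 2 := by
  unfold discrSq
  split_ifs
  · rw [abs_zero]; positivity
  · calc _ ≤ ∑ w, |G.discr μ u w ω * G.discr μ w v ω| := Finset.abs_sum_le_sum_abs _ _
      _ ≤ ∑ w, |G.discr μ u w ω| * G.Y.card := by
        refine Finset.sum_le_sum fun w _ => ?_
        rw [abs_mul]
        exact mul_le_mul_of_nonneg_left (abs_discr_le w v ω) (abs_nonneg _)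
      _ ≤ _ := by
        rw [← Finset.sum_mul, sq]
        exact mul_le_mul_of_nonneg_right (h.sum_abs_discr_le u ω) (Nat.cast_nonneg _)

omit [IsProbabilityMeasure μ] in
lemma measurable_discrSq (h : G.IsGeneralType μ m Δ D Λ lam k C₁ c₂ c₃ C₄) (u v : V) :
    Measurable (G.discrSq μ u v) := by
  unfold discrSq
  split_ifs
  · exact measurable_const
  · exact Finset.measurable_fun_sum _ fun w _ => (h.measurable_discr u w).mul (h.measurable_discr w v)

omit [Fintype V] in
lemma integrable_discr_sq (h : G.IsGeneralType μ m Δ D Λ lam k C₁ c₂ c₃ C₄) (u v : V) :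
    Integrable (fun ω => G.discr μ u v ω ^ 2) μ :=
  integrable_of_abs_le ((h.measurable_discr u v).pow_const 2) ((G.Y.card : ℝ) ^ 2) fun ω => by
    rw [abs_pow]; exact pow_le_pow_left₀ (abs_nonneg _) (abs_discr_le u v ω) 2

lemma integrable_discrSq_sq (h : G.IsGeneralType μ m Δ D Λ lam k C₁ c₂ c₃ C₄) (u v : V) :
    Integrable (fun ω => G.discrSq μ u v ω ^ 2) μ :=
  integrable_of_abs_le ((h.measurable_discrSq u v).pow_const 2) (((G.Y.card : ℝ) ^ 2) ^ 2)
    fun ω => by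
      rw [abs_pow]; exact pow_le_pow_left₀ (abs_nonneg _) (h.abs_discrSq_le u v ω) 2

omit [Fintype V] in
lemma integrable_rInd_mul_discr (h : G.IsGeneralType μ m Δ D Λ lam k C₁ c₂ c₃ C₄) {e : ι}
    (he : e ∈ G.all) (u v : V) : Integrable (fun ω => G.rInd e ω * G.discr μ u v ω) μ :=
  integrable_of_abs_le ((h.measurable_rInd he).mul (h.measurable_discr u v)) G.Y.card fun ω => by
    rw [abs_mul, ← one_mul (G.Y.card : ℝ)]
    exact mul_le_mul (G.abs_rInd_le_one e ω) (abs_discr_le u v ω) (abs_nonneg _) zero_le_one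

lemma integrable_rInd_mul_discrSq (h : G.IsGeneralType μ m Δ D Λ lam k C₁ c₂ c₃ C₄) {e : ι}
    (he : e ∈ G.all) (u v : V) : Integrable (fun ω => G.rInd e ω * G.discrSq μ u v ω) μ :=
  integrable_of_abs_le ((h.measurable_rInd he).mul (h.measurable_discrSq u v)) ((G.Y.card : ℝ) ^ 2)
    fun ω => by
    rw [abs_mul, ← one_mul ((G.Y.card : ℝ) ^ 2)]
    exact mul_le_mul (G.abs_rInd_le_one e ω) (h.abs_discrSq_le u v ω) (abs_nonneg _) zero_le_one

/-! ### The linear term -/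

omit [Fintype V] in
lemma integral_rInd_mul_discr_nonneg (h : G.IsGeneralType μ m Δ D Λ lam k C₁ c₂ c₃ C₄) {e : ι}
    (he : e ∈ G.all) (u v : V) : 0 ≤ ∫ ω, G.rInd e ω * G.discr μ u v ω ∂μ := by
  unfold discr
  simp_rw [Finset.mul_sum]
  rw [integral_finsetSum]
  · refine Finset.sum_nonneg fun f hf => ?_
    have hf := mem_Y_of_mem_pairEdges hf
    rw [h.integral_rInd_mul_tau he hf]
    linarith [h.correlation e he f hf]
  · intro f hf
    exact integrable_of_abs_le ((h.measurable_rInd he).mul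
      (h.measurable_tau (mem_Y_of_mem_pairEdges hf))) 1
      fun ω => abs_mul_le_one (G.abs_rInd_le_one e ω) (G.abs_tau_le_one μ f ω)

-- At least `lam / 2` edges parallel to `e` share its colour set and gain `c₃` each; the remaining
-- correlations are nonnegative.
omit [Fintype V] in
open Classical in
lemma le_integral_rInd_mul_discr (h : G.IsGeneralType μ m Δ D Λ lam k C₁ c₂ c₃ C₄) (hc₃ : 0 ≤ c₃)
    {e : ι} (he : e ∈ G.Y) (u v : V) (huv : G.verts e = {u, v}) :
    c₃ * (lam / 2) ≤ ∫ ω, G.rInd e ω * G.discr μ u v ω ∂μ := by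
  have he' := G.Y_subset_all he
  unfold discr
  simp_rw [Finset.mul_sum]
  rw [integral_finsetSum]
  · calc c₃ * (lam / 2) ≤ c₃ * ∑ f ∈ G.pairEdges u v, ind (G.colours e = G.colours f) := by
          refine mul_le_mul_of_nonneg_left ?_ hc₃
          rw [sum_ind_eq_card]
          refine (h.multiplicity e he).1.trans ?_
          norm_cast
          refine Finset.card_le_card fun f hf => ?_
          obtain ⟨h1, h2, h3⟩ := Finset.mem_filter.1 hf
          exact Finset.mem_filter.2 ⟨Finset.mem_filter.2 ⟨h1, h2 ▸ huv⟩, h3⟩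
      _ ≤ _ := by
          rw [Finset.mul_sum]
          refine Finset.sum_le_sum fun f hf => ?_
          have hf := mem_Y_of_mem_pairEdges hf
          rw [h.integral_rInd_mul_tau he' hf]
          by_cases hc : G.colours e = G.colours f
          · rw [ind_of hc, mul_one]; exact h.correlation_gain e he f hf hc
          · rw [ind_of_not hc, mul_zero]
            linarith [h.correlation e he' f hf]
  · intro f hf
    exact integrable_of_abs_le ((h.measurable_rInd he').mul
      (h.measurable_tau (mem_Y_of_mem_pairEdges hf))) 1
      fun ω => abs_mul_le_one (G.abs_rInd_le_one e ω) (G.abs_tau_le_one μ f ω)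

omit [Fintype V] in
lemma le_integral_linear (h : G.IsGeneralType μ m Δ D Λ lam k C₁ c₂ c₃ C₄) (hc₃ : 0 ≤ c₃) :
    c₃ * lam * G.Y.card / 4 ≤ ∫ ω, ∑ e ∈ G.all, ∑ u ∈ G.verts e, ∑ v ∈ G.verts e,
      (1 / 2) ^ (G.verts e).card * (G.rInd e ω * G.discr μ u v ω) ∂μ := by
  classical
  rw [integral_finsetSum _ fun e he => integrable_finsetSum _ fun u _ => integrable_finsetSum _
    fun v _ => (h.integrable_rInd_mul_discr he u v).const_mul _]
  have hsum : ∀ e ∈ G.all, ∫ ω, ∑ u ∈ G.verts e, ∑ v ∈ G.verts e,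
      (1 / 2) ^ (G.verts e).card * (G.rInd e ω * G.discr μ u v ω) ∂μ
      = ∑ u ∈ G.verts e, ∑ v ∈ G.verts e,
      (1 / 2) ^ (G.verts e).card * ∫ ω, G.rInd e ω * G.discr μ u v ω ∂μ := by
    intro e he
    rw [integral_finsetSum _ fun u _ => integrable_finsetSum _
      fun v _ => (h.integrable_rInd_mul_discr he u v).const_mul _]
    refine Finset.sum_congr rfl fun u _ => ?_
    rw [integral_finsetSum _ fun v _ => (h.integrable_rInd_mul_discr he u v).const_mul _]
    exact Finset.sum_congr rfl fun v _ => integral_const_mul _ _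
  rw [Finset.sum_congr rfl hsum]
  have hnn : ∀ e ∈ G.all, ∀ u v, 0 ≤ ((1 : ℝ) / 2) ^ (G.verts e).card *
      ∫ ω, G.rInd e ω * G.discr μ u v ω ∂μ := fun e he u v =>
    mul_nonneg (by positivity) (h.integral_rInd_mul_discr_nonneg he u v)
  -- An edge of `Y` has two ordered pairs, each of weight `1 / 4` and contributing at least `c₃ *
  -- lam / 2`.
  calc c₃ * lam * G.Y.card / 4 = ∑ _e ∈ G.Y, c₃ * lam / 4 := by
        rw [Finset.sum_const, nsmul_eq_mul]; ring
    _ ≤ ∑ e ∈ G.Y, ∑ u ∈ G.verts e, ∑ v ∈ G.verts e,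
      (1 / 2) ^ (G.verts e).card * ∫ ω, G.rInd e ω * G.discr μ u v ω ∂μ := by
        refine Finset.sum_le_sum fun e he => ?_
        have he' := G.Y_subset_all he
        obtain ⟨p, q, hpq, hv⟩ := Finset.card_eq_two.1 (h.card_verts_Y e he)
        have h1 := h.le_integral_rInd_mul_discr hc₃ he p q hv
        have h2 := h.le_integral_rInd_mul_discr hc₃ he q p (hv.trans (Finset.pair_comm _ _))
        have h3 := hnn e he' p p
        have h4 := hnn e he' q q
        rw [h.card_verts_Y e he] at h3 h4 ⊢
        rw [hv, Finset.sum_pair hpq, Finset.sum_pair hpq, Finset.sum_pair hpq]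
        linarith
    _ ≤ _ := Finset.sum_le_sum_of_subset_of_nonneg G.Y_subset_all fun e he _ =>
        Finset.sum_nonneg fun u _ => Finset.sum_nonneg fun v _ => hnn e he u v

/-! ### The quadratic term -/

open Classical in
lemma abs_integral_rInd_mul_discrSq_le (h : G.IsGeneralType μ m Δ D Λ lam k C₁ c₂ c₃ C₄)
    {e : ι} (he : e ∈ G.all) (u v : V) :
    |∫ ω, G.rInd e ω * G.discrSq μ u v ω ∂μ| ≤
      (if u = v then 0 else ∑ w, ∑ f ∈ G.pairEdges u w, ∑ g ∈ G.pairEdges w v,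
        ind (G.colours g = G.colours f)) +
      ∑ w, ∑ f ∈ G.pairEdges u w, ∑ g ∈ G.pairEdges w v,
        ind (¬ Disjoint (G.colours f) (G.colours e)) *
          ind (G.colours g ⊆ G.colours e ∪ G.colours f) := by
  unfold discrSq
  split_ifs with huv
  · simp only [mul_zero, integral_zero, abs_zero, zero_add]
    exact Finset.sum_nonneg fun w _ => Finset.sum_nonneg fun f _ => Finset.sum_nonneg fun g _ =>
      mul_nonneg (ind_nonneg _) (ind_nonneg _)
  · have h1 : ∀ ω, G.rInd e ω * ∑ w, G.discr μ u w ω * G.discr μ w v ω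
        = ∑ w, ∑ f ∈ G.pairEdges u w, ∑ g ∈ G.pairEdges w v,
          G.rInd e ω * (G.tau μ f ω * G.tau μ g ω) := by
      intro ω
      unfold discr
      simp_rw [Finset.sum_mul_sum, Finset.mul_sum]
    have hint : ∀ w, ∀ f ∈ G.pairEdges u w, ∀ g ∈ G.pairEdges w v,
        Integrable (fun ω => G.rInd e ω * (G.tau μ f ω * G.tau μ g ω)) μ := by
      intro w f hf g hg
      exact integrable_of_abs_le ((h.measurable_rInd he).mul
        ((h.measurable_tau (mem_Y_of_mem_pairEdges hf)).mul
          (h.measurable_tau (mem_Y_of_mem_pairEdges hg)))) 1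
        fun ω => abs_mul_le_one (G.abs_rInd_le_one e ω)
          (abs_mul_le_one (G.abs_tau_le_one μ f ω) (G.abs_tau_le_one μ g ω))
    simp_rw [h1]
    rw [integral_finsetSum _ fun w _ => integrable_finsetSum _ fun f hf => integrable_finsetSum _
      fun g hg => hint w f hf g hg, ← Finset.sum_add_distrib]
    refine (Finset.abs_sum_le_sum_abs _ _).trans (Finset.sum_le_sum fun w _ => ?_)
    rw [integral_finsetSum _ fun f hf => integrable_finsetSum _
      fun g hg => hint w f hf g hg, ← Finset.sum_add_distrib]
    refine (Finset.abs_sum_le_sum_abs _ _).trans (Finset.sum_le_sum fun f hf => ?_)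
    rw [integral_finsetSum _ fun g hg => hint w f hf g hg, ← Finset.sum_add_distrib]
    refine (Finset.abs_sum_le_sum_abs _ _).trans (Finset.sum_le_sum fun g hg => ?_)
    exact h.abs_integral_rInd_mul_le he (mem_Y_of_mem_pairEdges hf) (mem_Y_of_mem_pairEdges hg)

omit [IsProbabilityMeasure μ] in
lemma sum_equal_colour_paths_le (h : G.IsGeneralType μ m Δ D Λ lam k C₁ c₂ c₃ C₄) :
    ∑ u, ∑ v, ∑ w, ∑ f ∈ G.pairEdges u w, ∑ g ∈ G.pairEdges w v, ind (G.colours g = G.colours f)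
      ≤ 2 * G.Y.card * (Λ * lam) := by
  calc _ ≤ ∑ u, ∑ w, ∑ _f ∈ G.pairEdges u w, Λ * lam := by
        refine Finset.sum_le_sum fun u _ => ?_
        rw [Finset.sum_comm]
        refine Finset.sum_le_sum fun w _ => ?_
        rw [Finset.sum_comm]
        exact Finset.sum_le_sum fun f hf => h.sum_same_colours_le w (mem_Y_of_mem_pairEdges hf)
    _ = _ := by
        rw [h.sum_pairEdges]; simp; ring

omit [IsProbabilityMeasure μ] in
open Classical in
lemma sum_linked_paths_le (h : G.IsGeneralType μ m Δ D Λ lam k C₁ c₂ c₃ C₄) (hD : 0 ≤ D)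
    (hlam : 0 ≤ lam) {e : ι} (he : e ∈ G.all) (u v : V) :
    ∑ w, ∑ f ∈ G.pairEdges u w, ∑ g ∈ G.pairEdges w v,
        ind (¬ Disjoint (G.colours f) (G.colours e)) *
          ind (G.colours g ⊆ G.colours e ∪ G.colours f) ≤ k * D * (2 ^ (2 * k) * lam) := by
  have hek := h.card_colours_le e he
  calc _ ≤ ∑ w, ∑ f ∈ G.pairEdges u w, ind (¬ Disjoint (G.colours f) (G.colours e)) *
          (2 ^ (2 * k) * lam) := by
        refine Finset.sum_le_sum fun w _ => Finset.sum_le_sum fun f hf => ?_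
        rw [← Finset.mul_sum]
        refine mul_le_mul_of_nonneg_left ((h.sum_colours_subset_le hlam w v _).trans ?_)
          (ind_nonneg _)
        have h1 := Finset.card_union_le (G.colours e) (G.colours f)
        have h2 := h.card_colours_Y_le (mem_Y_of_mem_pairEdges hf)
        have h3 : (G.colours e ∪ G.colours f).card ≤ 2 * k := by omega
        gcongr
        norm_num
    _ ≤ _ := by
        simp_rw [← Finset.sum_mul]
        refine mul_le_mul_of_nonneg_right ((h.sum_not_disjoint_le u _).trans ?_) (by positivity)
        have : ((G.colours e).card : ℝ) ≤ k := by exact_mod_cast hek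
        gcongr

/-- The two kinds of surviving paths are summed differently. Paths with two equal colour sets do not
involve the colours of `e`, so they are counted globally and charged by codegree. Paths linked to
the colours of `e` are counted for each of its at most `k ^ 2` pairs. -/
lemma abs_integral_quadratic_le (h : G.IsGeneralType μ m Δ D Λ lam k C₁ c₂ c₃ C₄)
    (hD : 0 ≤ D) (hlam : 0 ≤ lam) :
    |∫ ω, ∑ e ∈ G.all, ∑ u ∈ G.verts e, ∑ v ∈ G.verts e,
      (1 / 2) ^ (G.verts e).card * (G.rInd e ω * G.discrSq μ u v ω) ∂μ|
      ≤ D * (2 * G.Y.card * (Λ * lam)) + G.all.card * (k ^ 2 * (k * D * (2 ^ (2 * k) * lam))) := by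
  classical
  rw [integral_finsetSum _ fun e he => integrable_finsetSum _ fun u _ => integrable_finsetSum _
    fun v _ => (h.integrable_rInd_mul_discrSq he u v).const_mul _]
  set A : V → V → ℝ := fun u v => if u = v then 0 else ∑ w, ∑ f ∈ G.pairEdges u w,
    ∑ g ∈ G.pairEdges w v, ind (G.colours g = G.colours f) with hA
  have hnn : ∀ u v : V, 0 ≤ ∑ w, ∑ f ∈ G.pairEdges u w,
    ∑ g ∈ G.pairEdges w v, ind (G.colours g = G.colours f) := fun u v =>
    Finset.sum_nonneg fun w _ => Finset.sum_nonneg fun f _ => Finset.sum_nonneg fun g _ =>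
      ind_nonneg _
  have hA0 : ∀ u v, 0 ≤ A u v := by
    intro u v; simp only [hA]; split_ifs
    · exact le_rfl
    · exact hnn u v
  have h1 : ∀ e ∈ G.all, |∫ ω, ∑ u ∈ G.verts e, ∑ v ∈ G.verts e,
      (1 / 2) ^ (G.verts e).card * (G.rInd e ω * G.discrSq μ u v ω) ∂μ|
      ≤ (∑ u ∈ G.verts e, ∑ v ∈ G.verts e, A u v) + k ^ 2 * (k * D * (2 ^ (2 * k) * lam)) := by
    intro e he
    have hB : 0 ≤ k * D * (2 ^ (2 * k) * lam) := by positivity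
    have hek : ((G.verts e).card : ℝ) ≤ k := by exact_mod_cast h.card_verts_le e he
    rw [integral_finsetSum _ fun u _ => integrable_finsetSum _
      fun v _ => (h.integrable_rInd_mul_discrSq he u v).const_mul _]
    calc _ ≤ ∑ u ∈ G.verts e, ∑ v ∈ G.verts e, (A u v + k * D * (2 ^ (2 * k) * lam)) := by
          refine (Finset.abs_sum_le_sum_abs _ _).trans (Finset.sum_le_sum fun u _ => ?_)
          rw [integral_finsetSum _ fun v _ => (h.integrable_rInd_mul_discrSq he u v).const_mul _]
          refine (Finset.abs_sum_le_sum_abs _ _).trans (Finset.sum_le_sum fun v _ => ?_)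
          rw [integral_const_mul, abs_mul, abs_of_nonneg (by positivity)]
          calc _ ≤ 1 * |∫ ω, G.rInd e ω * G.discrSq μ u v ω ∂μ| := by
                refine mul_le_mul_of_nonneg_right ?_ (abs_nonneg _)
                exact pow_le_one₀ (by norm_num) (by norm_num)
            _ ≤ _ := by
                rw [one_mul]
                refine (h.abs_integral_rInd_mul_discrSq_le he u v).trans ?_
                have := h.sum_linked_paths_le hD hlam he u v
                simp only [hA]
                linarith
      _ = (∑ u ∈ G.verts e, ∑ v ∈ G.verts e, A u v)
          + (G.verts e).card ^ 2 * (k * D * (2 ^ (2 * k) * lam)) := by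
          simp only [Finset.sum_add_distrib, Finset.sum_const, nsmul_eq_mul]
          ring
      _ ≤ _ := by gcongr
  refine (Finset.abs_sum_le_sum_abs _ _).trans ((Finset.sum_le_sum h1).trans ?_)
  rw [Finset.sum_add_distrib, Finset.sum_const, nsmul_eq_mul]
  refine add_le_add ((h.sum_pairs_all_le A hA0 fun u => by simp [hA]).trans ?_) le_rfl
  refine mul_le_mul_of_nonneg_left (le_trans ?_ h.sum_equal_colour_paths_le) hD
  refine Finset.sum_le_sum fun u _ => Finset.sum_le_sum fun v _ => ?_
  simp only [hA]
  split_ifs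
  · exact hnn u v
  · exact le_rfl

/-! ### The error terms -/

omit [Fintype V] in
lemma integral_discr_sq_le (h : G.IsGeneralType μ m Δ D Λ lam k C₁ c₂ c₃ C₄) (hlam : 0 ≤ lam)
    (u v : V) : ∫ ω, G.discr μ u v ω ^ 2 ∂μ ≤ ∑ _f ∈ G.pairEdges u v, lam := by
  unfold discr
  simp_rw [sq, Finset.sum_mul_sum]
  have hint : ∀ f ∈ G.pairEdges u v, ∀ g ∈ G.pairEdges u v,
      Integrable (fun ω => G.tau μ f ω * G.tau μ g ω) μ := fun f hf g hg =>
    integrable_of_abs_le ((h.measurable_tau (mem_Y_of_mem_pairEdges hf)).mul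
      (h.measurable_tau (mem_Y_of_mem_pairEdges hg))) 1
      fun ω => abs_mul_le_one (G.abs_tau_le_one μ f ω) (G.abs_tau_le_one μ g ω)
  rw [integral_finsetSum _ fun f hf => integrable_finsetSum _ fun g hg => hint f hf g hg]
  refine Finset.sum_le_sum fun f hf => ?_
  rw [integral_finsetSum _ fun g hg => hint f hf g hg]
  refine le_trans (Finset.sum_le_sum fun g hg => ?_) (h.sum_colours_eq_le hlam u v (G.colours f))
  exact h.integral_tau_mul_tau_le (mem_Y_of_mem_pairEdges hf) (mem_Y_of_mem_pairEdges hg)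

lemma integral_sum_discr_sq_le (h : G.IsGeneralType μ m Δ D Λ lam k C₁ c₂ c₃ C₄) (hD : 0 ≤ D)
    (hlam : 0 ≤ lam) :
    ∫ ω, ∑ e ∈ G.all, ∑ u ∈ G.verts e, ∑ v ∈ G.verts e, G.discr μ u v ω ^ 2 ∂μ
      ≤ D * (2 * G.Y.card * lam) := by
  have hX : ∫ ω, ∑ e ∈ G.all, ∑ u ∈ G.verts e, ∑ v ∈ G.verts e, G.discr μ u v ω ^ 2 ∂μ
      = ∑ e ∈ G.all, ∑ u ∈ G.verts e, ∑ v ∈ G.verts e, ∫ ω, G.discr μ u v ω ^ 2 ∂μ := by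
    rw [integral_finsetSum _ fun e he => integrable_finsetSum _ fun u _ => integrable_finsetSum _
      fun v _ => h.integrable_discr_sq u v]
    refine Finset.sum_congr rfl fun e _ => ?_
    rw [integral_finsetSum _ fun u _ => integrable_finsetSum _
      fun v _ => h.integrable_discr_sq u v]
    refine Finset.sum_congr rfl fun u _ => ?_
    rw [integral_finsetSum _ fun v _ => h.integrable_discr_sq u v]
  rw [hX]
  refine (h.sum_pairs_all_le _ (fun u v => integral_nonneg fun ω => sq_nonneg _)
    fun u => by simp [h.discr_self]).trans ?_
  refine mul_le_mul_of_nonneg_left ?_ hD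
  calc _ ≤ ∑ u, ∑ v, ∑ _f ∈ G.pairEdges u v, lam :=
        Finset.sum_le_sum fun u _ => Finset.sum_le_sum fun v _ => h.integral_discr_sq_le hlam u v
    _ = _ := by rw [h.sum_pairEdges]; simp; ring

lemma integral_discrSq_sq_le (h : G.IsGeneralType μ m Δ D Λ lam k C₁ c₂ c₃ C₄) (u v : V) :
    ∫ ω, G.discrSq μ u v ω ^ 2 ∂μ ≤ ∑ w, ∑ w', ∑ a ∈ G.pairEdges u w, ∑ b ∈ G.pairEdges w v,
      ∑ c ∈ G.pairEdges v w', ∑ d ∈ G.pairEdges w' u, ind (G.FourCovered a b c d) := by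
  unfold discrSq
  split_ifs with huv
  · simp only [ne_eq, OfNat.ofNat_ne_zero, not_false_eq_true, zero_pow, integral_zero]
    exact Finset.sum_nonneg fun _ _ => Finset.sum_nonneg fun _ _ => Finset.sum_nonneg fun _ _ =>
      Finset.sum_nonneg fun _ _ => Finset.sum_nonneg fun _ _ => Finset.sum_nonneg fun _ _ =>
      ind_nonneg _
  · have h1 : ∀ ω, (∑ w, G.discr μ u w ω * G.discr μ w v ω) ^ 2
        = ∑ w, ∑ w', ∑ a ∈ G.pairEdges u w, ∑ b ∈ G.pairEdges w v,
      ∑ c ∈ G.pairEdges v w', ∑ d ∈ G.pairEdges w' u,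
        G.tau μ a ω * G.tau μ b ω * (G.tau μ c ω * G.tau μ d ω) := by
      intro ω
      -- Reversing the second path from `u` to `v` makes the product of the two a closed walk `u, w,
      -- v, w'`.
      have h2 : (∑ w, G.discr μ u w ω * G.discr μ w v ω)
          = ∑ w, G.discr μ v w ω * G.discr μ w u ω :=
        Finset.sum_congr rfl fun w _ => by
          rw [G.discr_comm μ u w, G.discr_comm μ w v, mul_comm]
      rw [sq]
      nth_rewrite 2 [h2]
      rw [Finset.sum_mul_sum]
      unfold discr
      refine Finset.sum_congr rfl fun w _ => Finset.sum_congr rfl fun w' _ => ?_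
      rw [Finset.sum_mul_sum, Finset.sum_mul_sum, Finset.sum_mul]
      refine Finset.sum_congr rfl fun a _ => ?_
      rw [Finset.sum_mul]
      refine Finset.sum_congr rfl fun b _ => ?_
      rw [Finset.mul_sum]
      refine Finset.sum_congr rfl fun c _ => ?_
      rw [Finset.mul_sum]
    have hint : ∀ w w', ∀ a ∈ G.pairEdges u w, ∀ b ∈ G.pairEdges w v, ∀ c ∈ G.pairEdges v w',
        ∀ d ∈ G.pairEdges w' u,
        Integrable (fun ω => G.tau μ a ω * G.tau μ b ω * (G.tau μ c ω * G.tau μ d ω)) μ :=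
      fun w w' a ha b hb c hc d hd =>
      integrable_of_abs_le (((h.measurable_tau (mem_Y_of_mem_pairEdges ha)).mul
        (h.measurable_tau (mem_Y_of_mem_pairEdges hb))).mul
        ((h.measurable_tau (mem_Y_of_mem_pairEdges hc)).mul
        (h.measurable_tau (mem_Y_of_mem_pairEdges hd)))) 1
        fun ω => abs_mul_le_one
          (abs_mul_le_one (G.abs_tau_le_one μ a ω) (G.abs_tau_le_one μ b ω))
          (abs_mul_le_one (G.abs_tau_le_one μ c ω) (G.abs_tau_le_one μ d ω))
    simp_rw [h1]
    rw [integral_finsetSum _ fun w _ => integrable_finsetSum _ fun w' _ => integrable_finsetSum _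
      fun a ha => integrable_finsetSum _ fun b hb => integrable_finsetSum _ fun c hc =>
      integrable_finsetSum _ fun d hd => hint w w' a ha b hb c hc d hd]
    refine Finset.sum_le_sum fun w _ => ?_
    rw [integral_finsetSum _ fun w' _ => integrable_finsetSum _
      fun a ha => integrable_finsetSum _ fun b hb => integrable_finsetSum _ fun c hc =>
      integrable_finsetSum _ fun d hd => hint w w' a ha b hb c hc d hd]
    refine Finset.sum_le_sum fun w' _ => ?_
    rw [integral_finsetSum _
      fun a ha => integrable_finsetSum _ fun b hb => integrable_finsetSum _ fun c hc =>
      integrable_finsetSum _ fun d hd => hint w w' a ha b hb c hc d hd]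
    refine Finset.sum_le_sum fun a ha => ?_
    rw [integral_finsetSum _ fun b hb => integrable_finsetSum _ fun c hc =>
      integrable_finsetSum _ fun d hd => hint w w' a ha b hb c hc d hd]
    refine Finset.sum_le_sum fun b hb => ?_
    rw [integral_finsetSum _ fun c hc =>
      integrable_finsetSum _ fun d hd => hint w w' a ha b hb c hc d hd]
    refine Finset.sum_le_sum fun c hc => ?_
    rw [integral_finsetSum _ fun d hd => hint w w' a ha b hb c hc d hd]
    refine Finset.sum_le_sum fun d hd => ?_
    exact h.integral_tau_four_le (mem_Y_of_mem_pairEdges ha) (mem_Y_of_mem_pairEdges hb)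
      (mem_Y_of_mem_pairEdges hc) (mem_Y_of_mem_pairEdges hd)

lemma integral_sum_discrSq_sq_le (h : G.IsGeneralType μ m Δ D Λ lam k C₁ c₂ c₃ C₄) (hΔ : 0 ≤ Δ)
    (hD : 0 ≤ D) (hΛ : 0 ≤ Λ) (hlam : 0 ≤ lam) :
    ∫ ω, ∑ e ∈ G.all, ∑ u ∈ G.verts e, ∑ v ∈ G.verts e, G.discrSq μ u v ω ^ 2 ∂μ
      ≤ D * (G.Y.card *
        (6 * (Λ * lam * Δ * lam) + 32 * k ^ 2 * 2 ^ (3 * k) * (D ^ 2 * lam))) := by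
  have hX : ∫ ω, ∑ e ∈ G.all, ∑ u ∈ G.verts e, ∑ v ∈ G.verts e, G.discrSq μ u v ω ^ 2 ∂μ
      = ∑ e ∈ G.all, ∑ u ∈ G.verts e, ∑ v ∈ G.verts e, ∫ ω, G.discrSq μ u v ω ^ 2 ∂μ := by
    rw [integral_finsetSum _ fun e he => integrable_finsetSum _ fun u _ => integrable_finsetSum _
      fun v _ => h.integrable_discrSq_sq u v]
    refine Finset.sum_congr rfl fun e _ => ?_
    rw [integral_finsetSum _ fun u _ => integrable_finsetSum _
      fun v _ => h.integrable_discrSq_sq u v]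
    refine Finset.sum_congr rfl fun u _ => ?_
    rw [integral_finsetSum _ fun v _ => h.integrable_discrSq_sq u v]
  rw [hX]
  refine (h.sum_pairs_all_le _ (fun u v => integral_nonneg fun ω => sq_nonneg _)
    fun u => by simp [discrSq]).trans ?_
  refine mul_le_mul_of_nonneg_left ?_ hD
  refine le_trans ?_ (h.cycleSum_fourCovered_le hΔ hD hΛ hlam)
  unfold cycleSum
  refine Finset.sum_le_sum fun u _ => ?_
  refine (Finset.sum_le_sum fun v _ => h.integral_discrSq_sq_le u v).trans (le_of_eq ?_)
  exact Finset.sum_comm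

end IsGeneralType

end PotentialHyperedges

/-! ### The expected surplus in terms of the four moments -/

namespace PotentialHyperedges

variable {V ι 𝓢 Ω : Type*} {α : 𝓢 → Type*} [MeasurableSpace Ω]
  {G : PotentialHyperedges V ι 𝓢 Ω α} {μ : Measure Ω} {m Δ D Λ lam : ℝ} {k : ℕ}
  {C₁ c₂ c₃ C₄ : ℝ}

/-- The weighted sum of `discr` over the pairs inside the hyperedges of `R`. -/
noncomputable def linearGain (G : PotentialHyperedges V ι 𝓢 Ω α) (μ : Measure Ω) (ω : Ω) : ℝ :=
  ∑ e ∈ G.all, ∑ u ∈ G.verts e, ∑ v ∈ G.verts e,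
    (1 / 2) ^ (G.verts e).card * (G.rInd e ω * G.discr μ u v ω)

/-- The sum of the squares of `discr` over the pairs inside potential hyperedges. -/
noncomputable def linearError (G : PotentialHyperedges V ι 𝓢 Ω α) (μ : Measure Ω) (ω : Ω) : ℝ :=
  ∑ e ∈ G.all, ∑ u ∈ G.verts e, ∑ v ∈ G.verts e, G.discr μ u v ω ^ 2

section

variable [Fintype V]

/-- The weighted sum of `discrSq` over the pairs inside the hyperedges of `R`. -/
noncomputable def quadraticGain (G : PotentialHyperedges V ι 𝓢 Ω α) (μ : Measure Ω) (ω : Ω) : ℝ :=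
  ∑ e ∈ G.all, ∑ u ∈ G.verts e, ∑ v ∈ G.verts e,
    (1 / 2) ^ (G.verts e).card * (G.rInd e ω * G.discrSq μ u v ω)

/-- The sum of the squares of `discrSq` over the pairs inside potential hyperedges. -/
noncomputable def quadraticError (G : PotentialHyperedges V ι 𝓢 Ω α) (μ : Measure Ω) (ω : Ω) : ℝ :=
  ∑ e ∈ G.all, ∑ u ∈ G.verts e, ∑ v ∈ G.verts e, G.discrSq μ u v ω ^ 2

end

variable [∀ i, MeasurableSpace (α i)]

namespace IsGeneralType

lemma sum_R_eq (h : G.IsGeneralType μ m Δ D Λ lam k C₁ c₂ c₃ C₄) (F : ι → ℝ) (ω : Ω) :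
    ∑ e ∈ G.R ω, F e = ∑ e ∈ G.all, G.rInd e ω * F e := by
  classical
  rw [← Finset.inter_eq_right.2 (h.R_subset ω), ← Finset.filter_mem_eq_inter, Finset.sum_filter]
  refine Finset.sum_congr rfl fun e _ => ?_
  unfold rInd ind inR
  simp only [Set.mem_ofPred_eq]
  split_ifs <;> simp

variable [Fintype V]

/-- The random set `R` takes finitely many values, each on a measurable event determined by the
events `e ∈ R`. -/
lemma integrable_surp [IsProbabilityMeasure μ]
    (h : G.IsGeneralType μ m Δ D Λ lam k C₁ c₂ c₃ C₄) :
    Integrable (fun ω => surp (G.hypergraph ω)) μ := by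
  classical
  have hm : ∀ A ∈ G.all.powerset, MeasurableSet {ω | G.R ω = A} := by
    intro A hA
    have : {ω | G.R ω = A} = ⋂ e ∈ G.all, if e ∈ A then G.inR e else (G.inR e)ᶜ := by
      ext ω
      simp only [Set.mem_ofPred_eq, Set.mem_iInter]
      constructor
      · rintro rfl e _
        split_ifs with he
        · exact he
        · exact he
      · intro hω
        ext e
        by_cases he : e ∈ G.all
        · have := hω e he
          split_ifs at this with heA
          · exact ⟨fun _ => heA, fun _ => this⟩
          · exact ⟨fun hR => absurd hR this, fun hA => absurd hA heA⟩
        · exact ⟨fun hR => absurd (h.R_subset ω hR) he,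
            fun hh => absurd (Finset.mem_powerset.1 hA hh) he⟩
    rw [this]
    refine Finset.measurableSet_biInter _ fun e he => ?_
    split_ifs
    · exact h.measurableSet_inR he
    · exact (h.measurableSet_inR he).compl
  have hs : (fun ω => surp (G.hypergraph ω))
      = fun ω => ∑ A ∈ G.all.powerset, ind (ω ∈ {ω | G.R ω = A}) * surp (A.val.map G.verts) := by
    ext ω
    rw [Finset.sum_eq_single (G.R ω)]
    · rw [ind_of (by simp), one_mul]; rfl
    · intro A _ hA
      have hne : ω ∉ {ω | G.R ω = A} := fun hh => hA (Eq.symm hh)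
      rw [ind_of_not hne, zero_mul]
    · intro hh
      exact absurd (Finset.mem_powerset.2 (h.R_subset ω)) hh
  rw [hs]
  exact integrable_finsetSum _ fun A hA => (integrable_ind_mem (hm A hA)).mul_const _

lemma gain_le_surp [IsProbabilityMeasure μ] (h : G.IsGeneralType μ m Δ D Λ lam k C₁ c₂ c₃ C₄)
    (ω : Ω) (K β : ℝ) (hK : 0 ≤ K) (hβ : 0 < β)
    (hrow : ∀ v, ∑ w, G.discr μ v w ω ^ 2 ≤ K * β ^ 2) (N θ : ℝ)
    (hN : N = 1 / ((k : ℝ) ^ 2 + 1)) (hθ : θ = 1 / (((k : ℝ) ^ 2 + 1) * (1 + K))) :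
    Real.exp (-N) * θ * (2 * G.linearGain μ ω / β - G.quadraticGain μ ω / β ^ 2)
      - 2 * (k : ℝ) ^ 2 * θ ^ 2 *
        (8 * G.linearError μ ω / β ^ 2 + 2 * G.quadraticError μ ω / β ^ 4)
      ≤ surp (G.hypergraph ω) := by
  classical
  have hmain := gramEntry_le_surp k (fun u v => G.discr μ u v ω) (fun u v => G.discr_comm μ u v ω)
    (fun v => h.discr_self v ω) K β hK hβ hrow (G.hypergraph ω)
    (by
      intro e he
      obtain ⟨i, hi, rfl⟩ := Multiset.mem_map.1 he
      exact h.card_verts_le i (h.R_subset ω hi)) N θ hN hθ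
  refine le_trans ?_ hmain
  unfold hypergraph
  rw [Multiset.map_map]
  change _ ≤ ∑ e ∈ G.R ω, _
  rw [h.sum_R_eq]
  unfold linearGain quadraticGain linearError quadraticError
  simp only [Finset.mul_sum, Finset.sum_div, Function.comp_apply, ← Finset.sum_sub_distrib,
    ← Finset.sum_add_distrib]
  refine Finset.sum_le_sum fun e he => Finset.sum_le_sum fun u _ => Finset.sum_le_sum fun v _ => ?_
  have hP : gramEntry (fun u v => G.discr μ u v ω) β θ u v
      = θ * (-2 * G.discr μ u v ω / β + G.discrSq μ u v ω / β ^ 2) := by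
    unfold gramEntry discrSq
    split_ifs with huv
    · rw [huv, h.discr_self]; simp
    · rfl
  rw [hP]
  set M := G.discr μ u v ω
  set Q := G.discrSq μ u v ω
  have hr0 := G.rInd_nonneg e ω
  have hr1 := G.rInd_le_one e ω
  set r := G.rInd e ω
  have hsq : (-2 * M / β + Q / β ^ 2) ^ 2 ≤ 8 * M ^ 2 / β ^ 2 + 2 * Q ^ 2 / β ^ 4 := by
    have e1 : 8 * M ^ 2 / β ^ 2 + 2 * Q ^ 2 / β ^ 4
        = 2 * (-2 * M / β) ^ 2 + 2 * (Q / β ^ 2) ^ 2 := by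
      field_simp; ring
    rw [e1]
    nlinarith [sq_nonneg (-2 * M / β - Q / β ^ 2)]
  -- Only the gains need the factor `r`, since their size depends on correlations with `R`; in the
  -- error terms it is bounded by `1`.
  have herr : r * (2 * (k : ℝ) ^ 2 * θ ^ 2 * (-2 * M / β + Q / β ^ 2) ^ 2)
      ≤ 2 * (k : ℝ) ^ 2 * θ ^ 2 * (8 * M ^ 2 / β ^ 2 + 2 * Q ^ 2 / β ^ 4) := by
    have h1 : 2 * (k : ℝ) ^ 2 * θ ^ 2 * (-2 * M / β + Q / β ^ 2) ^ 2
        ≤ 2 * (k : ℝ) ^ 2 * θ ^ 2 * (8 * M ^ 2 / β ^ 2 + 2 * Q ^ 2 / β ^ 4) := by gcongr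
    have h2 : 0 ≤ 2 * (k : ℝ) ^ 2 * θ ^ 2 * (-2 * M / β + Q / β ^ 2) ^ 2 := by positivity
    exact (mul_le_of_le_one_left h2 hr1).trans h1
  have hid : r * (-((1 / 2) ^ (G.verts e).card * Real.exp (-N) *
        (θ * (-2 * M / β + Q / β ^ 2))) -
        2 * (k : ℝ) ^ 2 * (θ * (-2 * M / β + Q / β ^ 2)) ^ 2)
      = Real.exp (-N) * θ * (2 * ((1 / 2) ^ (G.verts e).card * (r * M)) / β
          - (1 / 2) ^ (G.verts e).card * (r * Q) / β ^ 2)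
        - r * (2 * (k : ℝ) ^ 2 * θ ^ 2 * (-2 * M / β + Q / β ^ 2) ^ 2) := by
    ring
  linarith [hid, herr]

/-! ### The concentration event -/

omit [Fintype V] in
lemma countT_eq_sum (h : G.IsGeneralType μ m Δ D Λ lam k C₁ c₂ c₃ C₄) (u v : V) (ω : Ω) :
    G.countT u v ω = ∑ f ∈ G.pairEdges u v, ind (ω ∈ G.inT f) := by
  classical
  rw [sum_ind_eq_card]
  unfold countT
  norm_cast
  congr 1
  ext f
  rw [Finset.mem_filter, Finset.mem_filter]
  constructor
  · rintro ⟨h1, h2⟩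
    exact ⟨Finset.mem_filter.2 ⟨h.T_subset ω h1, h2⟩, h1⟩
  · rintro ⟨h1, h2⟩
    exact ⟨h2, (Finset.mem_filter.1 h1).2⟩

omit [Fintype V] in
lemma countT_sub_integral [IsProbabilityMeasure μ]
    (h : G.IsGeneralType μ m Δ D Λ lam k C₁ c₂ c₃ C₄) (u v : V) (ω : Ω) :
    G.countT u v ω - ∫ ω', G.countT u v ω' ∂μ = G.discr μ u v ω := by
  simp_rw [h.countT_eq_sum]
  rw [integral_finsetSum _ fun f hf =>
    integrable_ind_mem (h.measurableSet_inT (mem_Y_of_mem_pairEdges hf)), ← Finset.sum_sub_distrib]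
  refine Finset.sum_congr rfl fun f hf => ?_
  rw [integral_ind_mem (h.measurableSet_inT (mem_Y_of_mem_pairEdges hf))]
  rfl

lemma measurableSet_rows_le [IsProbabilityMeasure μ]
    (h : G.IsGeneralType μ m Δ D Λ lam k C₁ c₂ c₃ C₄) (B : ℝ) :
    MeasurableSet {ω | ∀ v, ∑ w, G.discr μ v w ω ^ 2 ≤ B} := by
  have : {ω | ∀ v, ∑ w, G.discr μ v w ω ^ 2 ≤ B}
      = ⋂ v, {ω | ∑ w, G.discr μ v w ω ^ 2 ≤ B} := by ext; simp
  rw [this]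
  exact MeasurableSet.iInter fun v => measurableSet_le
    (Finset.measurable_fun_sum _ fun w _ => (h.measurable_discr v w).pow_const 2) measurable_const

/-- The squared bound for an entry is proportional to the number of edges on its pair, and these
numbers add up along a row to at most the degree bound `Δ`. -/
lemma rows_le_of_concentration [IsProbabilityMeasure μ]
    (h : G.IsGeneralType μ m Δ D Λ lam k C₁ c₂ c₃ C₄) (hlam : 0 ≤ lam) (hlog : 0 ≤ Real.log m)
    {ω : Ω} (hω : ∀ u v : V, u ≠ v →
    |G.countT u v ω - ∫ ω', G.countT u v ω' ∂μ| ≤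
      C₄ * (Real.log m) ^ ((k : ℝ) / 2) * Real.sqrt lam * Real.sqrt (G.countY u v)) (v : V) :
    ∑ w, G.discr μ v w ω ^ 2 ≤ C₄ ^ 2 * (Real.log m) ^ k * lam * Δ := by
  classical
  calc _ ≤ ∑ w, C₄ ^ 2 * (Real.log m) ^ k * lam * ∑ _f ∈ G.pairEdges v w, (1 : ℝ) := by
        refine Finset.sum_le_sum fun w _ => ?_
        by_cases hvw : v = w
        · rw [hvw, h.discr_self, sq, mul_zero]; positivity
        · have h1 := hω v w hvw
          rw [h.countT_sub_integral] at h1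
          have h2 : (G.discr μ v w ω) ^ 2 ≤ (C₄ * (Real.log m) ^ ((k : ℝ) / 2) * Real.sqrt lam
              * Real.sqrt (G.countY v w)) ^ 2 := by
            rw [← sq_abs]
            exact pow_le_pow_left₀ (abs_nonneg _) h1 2
          refine h2.trans (le_of_eq ?_)
          have h3 : G.countY v w = ∑ _f ∈ G.pairEdges v w, (1 : ℝ) := by
            rw [Finset.sum_const, nsmul_eq_mul, mul_one]; rfl
          rw [← h3, mul_pow, mul_pow, mul_pow, Real.sq_sqrt hlam,
            Real.sq_sqrt (by unfold countY; positivity), ← Real.rpow_natCast (_ ^ _) 2,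
            ← Real.rpow_mul hlog]
          norm_num
    _ ≤ _ := by
        rw [← Finset.mul_sum]
        exact mul_le_mul_of_nonneg_left (h.sum_card_pairEdges_le v) (by positivity)

lemma measureReal_rows_compl_le [IsProbabilityMeasure μ]
    (h : G.IsGeneralType μ m Δ D Λ lam k C₁ c₂ c₃ C₄) (hlam : 0 ≤ lam) (hlog : 0 ≤ Real.log m)
    (B : ℝ) (hB : C₄ ^ 2 * (Real.log m) ^ k * lam * Δ ≤ B) :
    μ.real {ω | ∀ v, ∑ w, G.discr μ v w ω ^ 2 ≤ B}ᶜ ≤ m ^ (-10 : ℤ) := by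
  rw [probReal_compl_eq_one_sub (h.measurableSet_rows_le B)]
  have h1 := h.concentration
  have h2 : μ.real {ω | ∀ u v : V, u ≠ v →
    |G.countT u v ω - ∫ ω', G.countT u v ω' ∂μ| ≤
      C₄ * (Real.log m) ^ ((k : ℝ) / 2) * Real.sqrt lam * Real.sqrt (G.countY u v)}
      ≤ μ.real {ω | ∀ v, ∑ w, G.discr μ v w ω ^ 2 ≤ B} :=
    -- Only monotonicity is used, so measurability of the concentration event is not required.
    measureReal_mono fun ω hω v => (h.rows_le_of_concentration hlam hlog hω v).trans hB
  linarith

/-! ### Integrating the pointwise bound -/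

omit [Fintype V] in
lemma integrable_linearGain [IsProbabilityMeasure μ]
    (h : G.IsGeneralType μ m Δ D Λ lam k C₁ c₂ c₃ C₄) : Integrable (G.linearGain μ) μ :=
  integrable_finsetSum _ fun _ he => integrable_finsetSum _ fun u _ => integrable_finsetSum _
    fun v _ => (h.integrable_rInd_mul_discr he u v).const_mul _

lemma integrable_quadraticGain [IsProbabilityMeasure μ]
    (h : G.IsGeneralType μ m Δ D Λ lam k C₁ c₂ c₃ C₄) : Integrable (G.quadraticGain μ) μ :=
  integrable_finsetSum _ fun _ he => integrable_finsetSum _ fun u _ => integrable_finsetSum _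
    fun v _ => (h.integrable_rInd_mul_discrSq he u v).const_mul _

omit [Fintype V] in
lemma integrable_linearError [IsProbabilityMeasure μ]
    (h : G.IsGeneralType μ m Δ D Λ lam k C₁ c₂ c₃ C₄) : Integrable (G.linearError μ) μ :=
  integrable_finsetSum _ fun _ _ => integrable_finsetSum _ fun u _ => integrable_finsetSum _
    fun v _ => h.integrable_discr_sq u v

lemma integrable_quadraticError [IsProbabilityMeasure μ]
    (h : G.IsGeneralType μ m Δ D Λ lam k C₁ c₂ c₃ C₄) : Integrable (G.quadraticError μ) μ :=
  integrable_finsetSum _ fun _ _ => integrable_finsetSum _ fun u _ => integrable_finsetSum _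
    fun v _ => h.integrable_discrSq_sq u v

omit [Fintype V] in
lemma sum_weighted_rInd_le (h : G.IsGeneralType μ m Δ D Λ lam k C₁ c₂ c₃ C₄) (X : V → V → ℝ)
    (B : ℝ) (hX : ∀ u v, |X u v| ≤ B) (hB : 0 ≤ B) (ω : Ω) :
    |∑ e ∈ G.all, ∑ u ∈ G.verts e, ∑ v ∈ G.verts e,
      (1 / 2) ^ (G.verts e).card * (G.rInd e ω * X u v)| ≤ G.all.card * (k ^ 2 * B) := by
  have h1 : ∀ e ∈ G.all, |∑ u ∈ G.verts e, ∑ v ∈ G.verts e,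
      (1 / 2) ^ (G.verts e).card * (G.rInd e ω * X u v)| ≤ k ^ 2 * B := by
    intro e he
    have hek : ((G.verts e).card : ℝ) ≤ k := by exact_mod_cast h.card_verts_le e he
    calc _ ≤ ∑ _u ∈ G.verts e, ∑ _v ∈ G.verts e, B := by
          refine (Finset.abs_sum_le_sum_abs _ _).trans (Finset.sum_le_sum fun u _ => ?_)
          refine (Finset.abs_sum_le_sum_abs _ _).trans (Finset.sum_le_sum fun v _ => ?_)
          rw [abs_mul, abs_mul, abs_of_nonneg (by positivity)]
          calc _ ≤ 1 * (1 * B) := by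
                have := G.abs_rInd_le_one e ω
                have := hX u v
                have : ((1 : ℝ) / 2) ^ (G.verts e).card ≤ 1 :=
                  pow_le_one₀ (by norm_num) (by norm_num)
                gcongr
            _ = B := by ring
      _ = (G.verts e).card ^ 2 * B := by
          simp only [Finset.sum_const, nsmul_eq_mul]; ring
      _ ≤ _ := by gcongr
  refine (Finset.abs_sum_le_sum_abs _ _).trans ((Finset.sum_le_sum h1).trans ?_)
  rw [Finset.sum_const, nsmul_eq_mul]

lemma le_integral_surp [IsProbabilityMeasure μ] (h : G.IsGeneralType μ m Δ D Λ lam k C₁ c₂ c₃ C₄)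
    (K β : ℝ) (hK : 0 ≤ K) (hβ : 0 < β) (N θ : ℝ)
    (hN : N = 1 / ((k : ℝ) ^ 2 + 1)) (hθ : θ = 1 / (((k : ℝ) ^ 2 + 1) * (1 + K))) :
    Real.exp (-N) * θ * (2 * (∫ ω, G.linearGain μ ω ∂μ) / β
        - (∫ ω, G.quadraticGain μ ω ∂μ) / β ^ 2)
      - 2 * (k : ℝ) ^ 2 * θ ^ 2 *
        (8 * (∫ ω, G.linearError μ ω ∂μ) / β ^ 2 + 2 * (∫ ω, G.quadraticError μ ω ∂μ) / β ^ 4)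
      - μ.real {ω | ∀ v, ∑ w, G.discr μ v w ω ^ 2 ≤ K * β ^ 2}ᶜ *
        (Real.exp (-N) * θ * (2 * (G.all.card * (k ^ 2 * G.Y.card)) / β
          + (G.all.card * (k ^ 2 * (G.Y.card : ℝ) ^ 2)) / β ^ 2))
      ≤ ∫ ω, surp (G.hypergraph ω) ∂μ := by
  have hθ0 : 0 ≤ θ := by rw [hθ]; positivity
  set good : Set Ω := {ω | ∀ v, ∑ w, G.discr μ v w ω ^ 2 ≤ K * β ^ 2} with hgood
  have hgm : MeasurableSet good := h.measurableSet_rows_le _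
  -- `L` dominates the gain for every outcome. Subtracting it on the exceptional event makes the
  -- lower bound nonpositive there, hence at most the surplus.
  set L : ℝ := Real.exp (-N) * θ * (2 * (G.all.card * (k ^ 2 * G.Y.card)) / β
          + (G.all.card * (k ^ 2 * (G.Y.card : ℝ) ^ 2)) / β ^ 2) with hL
  have hL0 : 0 ≤ L := by positivity
  have i1 := ((h.integrable_linearGain.const_mul 2).div_const β)
  have i2 := (h.integrable_quadraticGain.div_const (β ^ 2))
  have i3 := (i1.sub i2).const_mul (Real.exp (-N) * θ)
  have i4 := ((h.integrable_linearError.const_mul 8).div_const (β ^ 2))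
  have i5 := ((h.integrable_quadraticError.const_mul 2).div_const (β ^ 4))
  have i6 := (i4.add i5).const_mul (2 * (k : ℝ) ^ 2 * θ ^ 2)
  have i7 := (integrable_ind_mem (μ := μ) hgm.compl).mul_const L
  have hle := integral_mono ((i3.sub i6).sub i7) h.integrable_surp (fun ω => by
    change Real.exp (-N) * θ * (2 * G.linearGain μ ω / β - G.quadraticGain μ ω / β ^ 2)
      - 2 * (k : ℝ) ^ 2 * θ ^ 2 *
        (8 * G.linearError μ ω / β ^ 2 + 2 * G.quadraticError μ ω / β ^ 4)
      - ind (ω ∈ goodᶜ) * L ≤ surp (G.hypergraph ω)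
    by_cases hω : ω ∈ good
    · rw [ind_of_not (fun hh => hh hω), zero_mul, sub_zero]
      exact h.gain_le_surp ω K β hK hβ hω N θ hN hθ
    · rw [ind_of (show ω ∈ goodᶜ from hω), one_mul]
      have h1 := (abs_le.1 (h.sum_weighted_rInd_le (fun u v => G.discr μ u v ω) G.Y.card
        (fun u v => abs_discr_le u v ω) (Nat.cast_nonneg _) ω)).2
      have h2 := (abs_le.1 (h.sum_weighted_rInd_le (fun u v => G.discrSq μ u v ω)
        ((G.Y.card : ℝ) ^ 2) (fun u v => h.abs_discrSq_le u v ω) (by positivity) ω)).1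
      have h3 : 0 ≤ G.linearError μ ω := Finset.sum_nonneg fun _ _ => Finset.sum_nonneg fun _ _ =>
        Finset.sum_nonneg fun _ _ => sq_nonneg _
      have h4 : 0 ≤ G.quadraticError μ ω := Finset.sum_nonneg fun _ _ =>
        Finset.sum_nonneg fun _ _ => Finset.sum_nonneg fun _ _ => sq_nonneg _
      have h5 : Real.exp (-N) * θ * (2 * G.linearGain μ ω / β - G.quadraticGain μ ω / β ^ 2) ≤ L := by
        rw [hL, sub_eq_add_neg, ← neg_div]
        have h6 : -G.quadraticGain μ ω ≤ G.all.card * (k ^ 2 * (G.Y.card : ℝ) ^ 2) := by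
          unfold quadraticGain; linarith
        have h7 : G.linearGain μ ω ≤ G.all.card * (k ^ 2 * (G.Y.card : ℝ)) := h1
        gcongr
      have h8 : 0 ≤ 2 * (k : ℝ) ^ 2 * θ ^ 2 *
        (8 * G.linearError μ ω / β ^ 2 + 2 * G.quadraticError μ ω / β ^ 4) := by positivity
      have h9 := surp_nonneg (G.hypergraph ω)
      linarith)
  refine le_trans (le_of_eq ?_) hle
  simp only [Pi.sub_apply, Pi.add_apply]
  have e1 := integral_sub (i3.sub i6) i7
  have e2 := integral_sub i3 i6
  have e3 := integral_sub i1 i2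
  have e4 := integral_add i4 i5
  simp only [Pi.sub_apply, Pi.add_apply] at e1 e2 e3 e4
  rw [e1, e2, integral_const_mul, integral_const_mul, integral_mul_const, e3, e4,
    integral_div, integral_div, integral_div, integral_div, integral_const_mul, integral_const_mul,
    integral_const_mul, integral_ind_mem hgm.compl]

end IsGeneralType

end PotentialHyperedges

/-! ### Numerical estimates -/

lemma sq_le_of_rpow_mul_sqrt_le {x y β : ℝ} (k : ℕ) (hx : 0 ≤ x) (hy : 0 ≤ y)
    (hβ : x ^ (((k : ℝ) + 1) / 2) * Real.sqrt y ≤ β) : x ^ (k + 1) * y ≤ β ^ 2 := by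
  have h1 : (x ^ (((k : ℝ) + 1) / 2) * Real.sqrt y) ^ 2 = x ^ (k + 1) * y := by
    rw [mul_pow, Real.sq_sqrt hy, ← Real.rpow_natCast (_ ^ _) 2, ← Real.rpow_mul hx,
      ← Real.rpow_natCast x (k + 1)]
    congr 2
    push_cast
    ring
  rw [← h1]
  exact pow_le_pow_left₀ (by positivity) hβ 2

/-- The exceptional contribution is negligible against the main term once `m` is large. -/
lemma exceptional_linear_le {m c a : ℝ} (hm : 1 < m) (hc : 0 < c)
    (hma : a / c ≤ m) : m ^ (-10 : ℤ) * (a * m ^ 2) ≤ c * (m / Real.log m) := by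
  have hm0 : 0 < m := by linarith
  have hlog : 0 < Real.log m := Real.log_pos hm
  have hlm : Real.log m ≤ m := (Real.log_le_sub_one_of_pos hm0).trans (by linarith)
  rw [div_le_iff₀ hc] at hma
  have h1 : c ≤ c * (m / Real.log m) := by
    have : 1 ≤ m / Real.log m := (one_le_div hlog).2 hlm
    nlinarith
  refine le_trans ?_ h1
  rw [zpow_neg, inv_mul_le_iff₀ (by positivity)]
  have h2 : (m : ℝ) ^ (10 : ℤ) = m ^ 3 * m ^ 7 := by
    rw [← pow_add]; norm_cast
  have h3 : (1 : ℝ) ≤ m ^ 7 := one_le_pow₀ hm.le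
  calc a * m ^ 2 ≤ (m * c) * m ^ 2 := by gcongr
    _ = m ^ 3 * 1 * c := by ring
    _ ≤ m ^ 3 * m ^ 7 * c := by gcongr
    _ = _ := by rw [h2]

lemma exceptional_quadratic_le {m : ℝ} (hm : 1 ≤ m) : m ^ (-10 : ℤ) * m ^ 3 ≤ m := by
  have hm0 : 0 < m := by linarith
  rw [zpow_neg, inv_mul_le_iff₀ (by positivity)]
  have h2 : (m : ℝ) ^ (10 : ℤ) * m = m ^ 3 * m ^ 8 := by
    rw [← pow_add]
    norm_cast
  rw [h2]
  have h3 : (1 : ℝ) ≤ m ^ 8 := one_le_pow₀ hm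
  have : 0 < m ^ 3 := by positivity
  nlinarith

/-- The numerical part of the lower bound for the expected surplus: `g₁`, `g₂`, `e₁`, `e₂` are the
expectations of the gains and errors, `n` and `y` are the numbers of potential hyperedges in
`X ∪ Y` and `Y`, and `δ` is the probability of the exceptional event. -/
lemma surplus_lower_bound_arithmetic {C₁ c₂ c₃ m Δ D Λ lam β κ a c θ δ g₁ g₂ e₁ e₂ n y I : ℝ}
    {k : ℕ} (hC₁ : 0 < C₁) (hc₃ : 0 < c₃) (hm : 1 ≤ m) (hD : 1 ≤ D)
    (hΛ : 1 ≤ Λ) (hlam : 1 ≤ lam) (hβ : 0 < β) (hκ0 : 0 ≤ κ) (hκ : Δ * lam ≤ κ * β ^ 2)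
    (hθ0 : 0 ≤ θ) (hθ1 : θ ≤ 1) (ha0 : 0 ≤ a) (ha1 : a ≤ 1) (hδ0 : 0 ≤ δ)
    (hc : c = a * c₂ * c₃ / 4)
    (hy0 : 0 ≤ y) (hall : n ≤ C₁ * m) (hY : y ≤ C₁ * m)
    (hYl : c₂ * (m / Real.log m) ≤ y)
    (g1 : c₃ * lam * y / 4 ≤ g₁)
    (g2 : g₂ ≤ D * (2 * y * (Λ * lam)) + n * (k ^ 2 * (k * D * (2 ^ (2 * k) * lam))))
    (e1 : e₁ ≤ D * (2 * y * lam))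
    (e2 : e₂ ≤ D * (y *
      (6 * (Λ * lam * Δ * lam) + 32 * k ^ 2 * 2 ^ (3 * k) * (D ^ 2 * lam))))
    (h1 : δ * (2 * k ^ 2 * C₁ ^ 2 * m ^ 2) ≤ c₂ * c₃ / 4 * (m / Real.log m))
    (h2 : δ * m ^ 3 ≤ m)
    (hmain : a * (2 * g₁ / β - g₂ / β ^ 2)
      - 2 * (k : ℝ) ^ 2 * θ ^ 2 * (8 * e₁ / β ^ 2 + 2 * e₂ / β ^ 4)
      - δ * (a * (2 * (n * (k ^ 2 * y)) / β + n * (k ^ 2 * y ^ 2) / β ^ 2)) ≤ I) :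
    c * (m * lam / (β * Real.log m))
      - (C₁ * (2 + k ^ 3 * 2 ^ (2 * k)) + 32 * k ^ 2 * C₁ + 24 * k ^ 2 * C₁ * κ
          + 128 * k ^ 4 * 2 ^ (3 * k) * C₁ + k ^ 2 * C₁ ^ 3)
        * (m * Λ * lam * D / β ^ 2 + m * D ^ 3 * lam / β ^ 4) ≤ I := by
  have hm0 : 0 < m := by linarith
  have hD0 : 0 < D := by linarith
  have hΛ0 : 0 < Λ := by linarith
  have hlam0 : 0 < lam := by linarith
  obtain ⟨X₁, hX₁⟩ : ∃ X₁, X₁ = m * Λ * lam * D / β ^ 2 := ⟨_, rfl⟩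
  obtain ⟨X₂, hX₂⟩ : ∃ X₂, X₂ = m * D ^ 3 * lam / β ^ 4 := ⟨_, rfl⟩
  have hX₁0 : 0 ≤ X₁ := by rw [hX₁]; positivity
  have hX₂0 : 0 ≤ X₂ := by rw [hX₂]; positivity
  obtain ⟨ℓ, hℓ⟩ : ∃ ℓ, ℓ = m / Real.log m := ⟨_, rfl⟩
  have hℓ0 : 0 ≤ ℓ := by rw [hℓ]; exact div_nonneg (by linarith) (Real.log_nonneg hm)
  rw [← hℓ] at h1 hYl
  rw [← hX₁, ← hX₂]
  -- main term
  have t1 : 2 * (c * (m * lam / (β * Real.log m))) ≤ a * (2 * g₁ / β) := by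
    have h3 : c₃ * lam * (c₂ * ℓ) / 4 ≤ g₁ := le_trans (by gcongr) g1
    calc _ = a * (2 * (c₃ * lam * (c₂ * ℓ) / 4) / β) := by
          rw [hc, hℓ]; ring
      _ ≤ _ := by gcongr
  -- quadratic term
  have t2 : a * (g₂ / β ^ 2) ≤ C₁ * (2 + k ^ 3 * 2 ^ (2 * k)) * X₁ := by
    have h3 : g₂ ≤ D * (2 * (C₁ * m) * (Λ * lam))
        + C₁ * m * (k ^ 2 * (k * D * (2 ^ (2 * k) * (Λ * lam)))) := by
      refine g2.trans ?_
      have : lam ≤ Λ * lam := le_mul_of_one_le_left (by linarith) hΛ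
      gcongr
    have h4 : 0 ≤ D * (2 * (C₁ * m) * (Λ * lam))
        + C₁ * m * (k ^ 2 * (k * D * (2 ^ (2 * k) * (Λ * lam)))) := by positivity
    calc _ ≤ a * ((D * (2 * (C₁ * m) * (Λ * lam))
        + C₁ * m * (k ^ 2 * (k * D * (2 ^ (2 * k) * (Λ * lam))))) / β ^ 2) := by gcongr
      _ ≤ 1 * ((D * (2 * (C₁ * m) * (Λ * lam))
        + C₁ * m * (k ^ 2 * (k * D * (2 ^ (2 * k) * (Λ * lam))))) / β ^ 2) := by gcongr
      _ = _ := by rw [hX₁]; ring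
  have hθ2 : θ ^ 2 ≤ 1 := pow_le_one₀ hθ0 hθ1
  -- error terms
  have t3 : 8 * e₁ / β ^ 2 ≤ 16 * C₁ * X₁ := by
    have h3 : e₁ ≤ D * (2 * (C₁ * m) * (Λ * lam)) := by
      refine e1.trans ?_
      have : lam ≤ Λ * lam := le_mul_of_one_le_left (by linarith) hΛ
      gcongr
    calc _ ≤ 8 * (D * (2 * (C₁ * m) * (Λ * lam))) / β ^ 2 := by gcongr
      _ = _ := by rw [hX₁]; ring
  have t4 : 2 * e₂ / β ^ 4 ≤ 12 * C₁ * κ * X₁ + 64 * k ^ 2 * 2 ^ (3 * k) * C₁ * X₂ := by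
    have h3 : e₂ ≤ D * (C₁ * m * (6 * (Λ * lam * (κ * β ^ 2))
        + 32 * k ^ 2 * 2 ^ (3 * k) * (D ^ 2 * lam))) := by
      refine e2.trans ?_
      -- Trading `Δ * lam` for `κ * β ^ 2` turns the paired 4-walks into an error of the first type,
      -- with `β ^ 2` in the denominator.
      have : Λ * lam * Δ * lam ≤ Λ * lam * (κ * β ^ 2) := by
        rw [mul_assoc (Λ * lam)]; gcongr
      calc _ ≤ D * (y * (6 * (Λ * lam * (κ * β ^ 2))
            + 32 * k ^ 2 * 2 ^ (3 * k) * (D ^ 2 * lam))) := by gcongr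
        _ ≤ _ := by gcongr
    calc _ ≤ 2 * (D * (C₁ * m * (6 * (Λ * lam * (κ * β ^ 2))
        + 32 * k ^ 2 * 2 ^ (3 * k) * (D ^ 2 * lam)))) / β ^ 4 := by gcongr
      _ = _ := by rw [hX₁, hX₂]; field_simp; ring
  have t5 : 2 * (k : ℝ) ^ 2 * θ ^ 2 * (8 * e₁ / β ^ 2 + 2 * e₂ / β ^ 4)
      ≤ 2 * (k : ℝ) ^ 2 * 1 * (16 * C₁ * X₁ + (12 * C₁ * κ * X₁
        + 64 * k ^ 2 * 2 ^ (3 * k) * C₁ * X₂)) := by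
    have h3 : 0 ≤ 16 * C₁ * X₁ + (12 * C₁ * κ * X₁ + 64 * k ^ 2 * 2 ^ (3 * k) * C₁ * X₂) := by
      positivity
    calc _ ≤ 2 * (k : ℝ) ^ 2 * θ ^ 2 * (16 * C₁ * X₁ + (12 * C₁ * κ * X₁
        + 64 * k ^ 2 * 2 ^ (3 * k) * C₁ * X₂)) := by gcongr
      _ ≤ _ := by gcongr
  -- exceptional event
  have t6 : δ * (a * (2 * (n * (k ^ 2 * y)) / β + n * (k ^ 2 * y ^ 2) / β ^ 2))
      ≤ c * (m * lam / (β * Real.log m)) + k ^ 2 * C₁ ^ 3 * X₁ := by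
    have h3 : 2 * (n * (k ^ 2 * y)) ≤ 2 * k ^ 2 * C₁ ^ 2 * m ^ 2 := by
      calc _ ≤ 2 * (C₁ * m * (k ^ 2 * (C₁ * m))) := by gcongr
        _ = _ := by ring
    have h4 : n * (k ^ 2 * y ^ 2) ≤ k ^ 2 * C₁ ^ 3 * m ^ 3 := by
      calc _ ≤ C₁ * m * (k ^ 2 * (C₁ * m) ^ 2) := by gcongr
        _ = _ := by ring
    -- The linear gain provides twice the claimed main term; the second copy pays for this part of
    -- the exceptional loss.
    have h5 : a * (c₂ * c₃ / 4 * ℓ) / β ≤ c * (m * lam / (β * Real.log m)) := by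
      have h6 : a * (c₂ * c₃ / 4 * ℓ) / β * lam = c * (m * lam / (β * Real.log m)) := by
        rw [hc, hℓ]; ring
      rw [← h6]
      refine le_mul_of_one_le_right ?_ hlam
      have : 0 ≤ c₂ * c₃ / 4 * ℓ := le_trans (by positivity) h1
      positivity
    have h7 : m ≤ m * Λ * lam * D := by
      have : 1 ≤ Λ * lam * D := one_le_mul_of_one_le_of_one_le
        (one_le_mul_of_one_le_of_one_le hΛ hlam) hD
      calc m = m * 1 := (mul_one m).symm
        _ ≤ m * (Λ * lam * D) := by gcongr
        _ = _ := by ring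
    calc _ ≤ δ * (a * (2 * k ^ 2 * C₁ ^ 2 * m ^ 2 / β + k ^ 2 * C₁ ^ 3 * m ^ 3 / β ^ 2)) := by
          gcongr
      _ = a * (δ * (2 * k ^ 2 * C₁ ^ 2 * m ^ 2)) / β
          + a * (k ^ 2 * C₁ ^ 3 * (δ * m ^ 3 / β ^ 2)) := by ring
      _ ≤ a * (c₂ * c₃ / 4 * ℓ) / β + 1 * (k ^ 2 * C₁ ^ 3 * (m * Λ * lam * D / β ^ 2)) := by
          have h8 : δ * m ^ 3 ≤ m * Λ * lam * D := h2.trans h7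
          gcongr
      _ ≤ _ := by rw [one_mul, ← hX₁]; gcongr
  have hk0 : (0 : ℝ) ≤ k := Nat.cast_nonneg k
  -- One constant multiplies `X₁ + X₂`, although each of its summands is needed for only one of the
  -- two. These are the superfluous products.
  have p1 : 0 ≤ C₁ * (2 + k ^ 3 * 2 ^ (2 * k)) * X₂ := by positivity
  have p2 : 0 ≤ 32 * k ^ 2 * C₁ * X₂ := by positivity
  have p3 : 0 ≤ 24 * k ^ 2 * C₁ * κ * X₂ := by positivity
  have p4 : 0 ≤ 128 * k ^ 4 * 2 ^ (3 * k) * C₁ * X₁ := by positivity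
  have p5 : 0 ≤ k ^ 2 * C₁ ^ 3 * X₂ := by positivity
  have t7 : a * (2 * g₁ / β - g₂ / β ^ 2) = a * (2 * g₁ / β) - a * (g₂ / β ^ 2) := mul_sub _ _ _
  linarith [t1, t2, t5, t6, p1, p2, p3, p4, p5, t7]

/-! ### Choice of constants and conclusion -/

namespace PotentialHyperedges.IsGeneralType

variable {V ι 𝓢 Ω : Type*} {α : 𝓢 → Type*} [Fintype V] [MeasurableSpace Ω]
  [∀ i, MeasurableSpace (α i)]
  {G : PotentialHyperedges V ι 𝓢 Ω α} {μ : Measure Ω} {m Δ D Λ lam : ℝ} {k : ℕ}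
  {C₁ c₂ c₃ C₄ : ℝ}

/-- The lower bound for the expected surplus, with the probability of the exceptional event kept
as a parameter. -/
lemma le_integral_surp_of_exceptional [IsProbabilityMeasure μ]
    (h : G.IsGeneralType μ m Δ D Λ lam k C₁ c₂ c₃ C₄) (hC₁ : 0 < C₁) (hc₃ : 0 < c₃)
    (hm : 1 ≤ m) (hΔ : 1 ≤ Δ) (hD : 1 ≤ D) (hΛ : 1 ≤ Λ) (hlam : 1 ≤ lam)
    (K β κ a c : ℝ) (hK : 0 ≤ K) (hβ : 0 < β) (hκ0 : 0 ≤ κ) (hκ : Δ * lam ≤ κ * β ^ 2)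
    (ha : a = Real.exp (-(1 / ((k : ℝ) ^ 2 + 1))) * (1 / (((k : ℝ) ^ 2 + 1) * (1 + K))))
    (hc : c = a * c₂ * c₃ / 4)
    (h1 : μ.real {ω | ∀ v, ∑ w, G.discr μ v w ω ^ 2 ≤ K * β ^ 2}ᶜ * (2 * k ^ 2 * C₁ ^ 2 * m ^ 2)
      ≤ c₂ * c₃ / 4 * (m / Real.log m))
    (h2 : μ.real {ω | ∀ v, ∑ w, G.discr μ v w ω ^ 2 ≤ K * β ^ 2}ᶜ * m ^ 3 ≤ m) :
    c * (m * lam / (β * Real.log m))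
      - (C₁ * (2 + k ^ 3 * 2 ^ (2 * k)) + 32 * k ^ 2 * C₁ + 24 * k ^ 2 * C₁ * κ
          + 128 * k ^ 4 * 2 ^ (3 * k) * C₁ + k ^ 2 * C₁ ^ 3)
        * (m * Λ * lam * D / β ^ 2 + m * D ^ 3 * lam / β ^ 4)
      ≤ ∫ ω, surp (G.hypergraph ω) ∂μ := by
  set θ : ℝ := 1 / (((k : ℝ) ^ 2 + 1) * (1 + K)) with hθ
  set δ : ℝ := μ.real {ω | ∀ v, ∑ w, G.discr μ v w ω ^ 2 ≤ K * β ^ 2}ᶜ with hδ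
  have hδ0 : 0 ≤ δ := measureReal_nonneg
  have hmain := h.le_integral_surp K β hK hβ _ θ rfl hθ
  rw [← ha, ← hδ] at hmain
  have g1 := h.le_integral_linear hc₃.le
  have g2 := (abs_le.1 (h.abs_integral_quadratic_le (by linarith) (by linarith))).2
  have e1 := h.integral_sum_discr_sq_le (by linarith) (by linarith)
  have e2 := h.integral_sum_discrSq_sq_le (by linarith) (by linarith) (by linarith) (by linarith)
  change _ ≤ ∫ ω, G.linearGain μ ω ∂μ at g1
  change ∫ ω, G.quadraticGain μ ω ∂μ ≤ _ at g2
  change ∫ ω, G.linearError μ ω ∂μ ≤ _ at e1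
  change ∫ ω, G.quadraticError μ ω ∂μ ≤ _ at e2
  have hθ0 : 0 ≤ θ := by positivity
  have hθ1 : θ ≤ 1 := by
    rw [hθ, div_le_one (by positivity)]
    exact one_le_mul_of_one_le_of_one_le (by linarith [sq_nonneg (k : ℝ)]) (by linarith)
  have ha0 : 0 ≤ a := by rw [ha]; positivity
  have ha1 : a ≤ 1 := by
    rw [ha]
    refine mul_le_one₀ (Real.exp_le_one_iff.2 ?_) hθ0 hθ1
    exact neg_nonpos.2 (by positivity)
  have hall := h.card_all_le
  have hYall : (G.Y.card : ℝ) ≤ G.all.card := by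
    exact_mod_cast Finset.card_le_card G.Y_subset_all
  have hY : (G.Y.card : ℝ) ≤ C₁ * m := hYall.trans hall
  have hYl := h.le_card_Y
  exact surplus_lower_bound_arithmetic hC₁ hc₃ hm hD hΛ hlam hβ hκ0 hκ hθ0 hθ1 ha0 ha1
    hδ0 hc (Nat.cast_nonneg _) hall hY hYl g1 g2 e1 e2 h1 h2 hmain

end PotentialHyperedges.IsGeneralType

theorem mainTheorem7 (k : ℕ) (C₁ c₂ c₃ C₄ : ℝ)
    (hC₁ : 0 < C₁) (hc₂ : 0 < c₂) (hc₃ : 0 < c₃) (hC₄ : 0 < C₄) :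
    ∃ c C : ℝ, 0 < c ∧ 0 < C ∧
      ∀ (V ι 𝓢 Ω : Type*) (α : 𝓢 → Type*) [Fintype V] [MeasurableSpace Ω]
        [∀ i, MeasurableSpace (α i)] (μ : Measure Ω) [IsProbabilityMeasure μ]
        (G : PotentialHyperedges V ι 𝓢 Ω α) (m Δ D Λ lam : ℝ),
        1 ≤ m → 1 ≤ Δ → 1 ≤ D → 1 ≤ Λ → 1 ≤ lam →
        G.IsGeneralType μ m Δ D Λ lam k C₁ c₂ c₃ C₄ →
        Integrable (fun ω => surp (G.hypergraph ω)) μ ∧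
        ∀ β : ℝ, (Real.log m) ^ (((k : ℝ) + 1) / 2) * Real.sqrt (Δ * lam) ≤ β →
          c * (m * lam / (β * Real.log m))
              - C * (m * Λ * lam * D / β ^ 2 + m * D ^ 3 * lam / β ^ 4)
            ≤ ∫ ω, surp (G.hypergraph ω) ∂μ := by
  -- For `m > 1` the bounds `c₂ * m / log m ≤ |Y| ≤ C₁ * m` force `log m ≥ ℓ₀`. Consequently `Δ *
  -- lam ≤ κ * β ^ 2` for the next constant `κ`.
  set ℓ₀ : ℝ := c₂ / C₁ with hℓ₀
  have hℓ₀0 : 0 < ℓ₀ := by positivity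
  set κ : ℝ := 1 / ℓ₀ ^ (k + 1) with hκ
  have hκ0 : 0 < κ := by positivity
  -- The threshold beyond which `exceptional_linear_le` applies.
  set m₀ : ℝ := 2 * k ^ 2 * C₁ ^ 2 / (c₂ * c₃ / 4) with hm₀
  have hm₀0 : 0 ≤ m₀ := by positivity
  -- The first summand accommodates the concentration bound for the rows, with one factor `log m` of
  -- `β ^ 2` to spare. The second accommodates the trivial bound `|Y| ^ 2` when `m < m₀`.
  set K : ℝ := C₄ ^ 2 / ℓ₀ + (C₁ * m₀) ^ 2 * κ with hK
  have hK0 : 0 ≤ K := by positivity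
  set a : ℝ := Real.exp (-(1 / ((k : ℝ) ^ 2 + 1))) * (1 / (((k : ℝ) ^ 2 + 1) * (1 + K))) with ha
  refine ⟨a * c₂ * c₃ / 4, C₁ * (2 + k ^ 3 * 2 ^ (2 * k)) + 32 * k ^ 2 * C₁ + 24 * k ^ 2 * C₁ * κ
          + 128 * k ^ 4 * 2 ^ (3 * k) * C₁ + k ^ 2 * C₁ ^ 3, by positivity, by positivity, ?_⟩
  intro V ι 𝓢 Ω α _ _ _ μ _ G m Δ D Λ lam hm hΔ hD hΛ hlam h
  refine ⟨h.integrable_surp, fun β hβ => ?_⟩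
  have hlog0 : 0 ≤ Real.log m := Real.log_nonneg hm
  have hΔlam : 1 ≤ Δ * lam := one_le_mul_of_one_le_of_one_le hΔ hlam
  rcases hlog0.eq_or_lt with hlog | hlog
  -- If `log m = 0`, the main term is a quotient by zero, hence `0`, and the claim reduces to
  -- nonnegativity of the surplus.
  · have hpos : 0 ≤ ∫ ω, surp (G.hypergraph ω) ∂μ := integral_nonneg fun ω => surp_nonneg _
    rw [← hlog, mul_zero, div_zero, mul_zero, zero_sub]
    refine le_trans ?_ hpos
    have : 0 ≤ m * Λ * lam * D / β ^ 2 + m * D ^ 3 * lam / β ^ 4 := by positivity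
    rw [neg_nonpos]
    positivity
  have hm1 : 1 < m := by
    by_contra hh
    have : m = 1 := le_antisymm (not_lt.1 hh) hm
    rw [this, Real.log_one] at hlog
    exact lt_irrefl _ hlog
  have hm0 : 0 < m := by linarith
  have hYle : (G.Y.card : ℝ) ≤ C₁ * m := by
    refine le_trans ?_ h.card_all_le
    exact_mod_cast Finset.card_le_card G.Y_subset_all
  have hℓ : ℓ₀ ≤ Real.log m := by
    have h1 := h.le_card_Y.trans hYle
    rw [hℓ₀, div_le_iff₀ hC₁]
    rw [mul_div_assoc', div_le_iff₀ hlog] at h1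
    refine le_of_mul_le_mul_right (a := m) ?_ hm0
    linarith
  have hβ2 := sq_le_of_rpow_mul_sqrt_le k hlog0 (by linarith) hβ
  have hβ0 : 0 < β := by
    refine lt_of_lt_of_le ?_ hβ
    exact mul_pos (Real.rpow_pos_of_pos hlog _) (Real.sqrt_pos.2 (by linarith))
  have hκβ : Δ * lam ≤ κ * β ^ 2 := by
    rw [hκ, one_div, ← div_eq_inv_mul, le_div_iff₀ (by positivity)]
    calc Δ * lam * ℓ₀ ^ (k + 1) ≤ Δ * lam * Real.log m ^ (k + 1) := by gcongr
      _ ≤ β ^ 2 := by rw [mul_comm]; exact hβ2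
  have hrowB : C₄ ^ 2 * (Real.log m) ^ k * lam * Δ ≤ K * β ^ 2 := by
    have h1 : C₄ ^ 2 * (Real.log m) ^ k * lam * Δ ≤ C₄ ^ 2 / ℓ₀ * β ^ 2 := by
      rw [div_mul_eq_mul_div, le_div_iff₀ hℓ₀0]
      calc C₄ ^ 2 * (Real.log m) ^ k * lam * Δ * ℓ₀
          ≤ C₄ ^ 2 * (Real.log m) ^ k * lam * Δ * Real.log m := by gcongr
        _ = C₄ ^ 2 * (Real.log m ^ (k + 1) * (Δ * lam)) := by ring
        _ ≤ _ := by gcongr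
    refine h1.trans ?_
    rw [hK]
    have : 0 ≤ (C₁ * m₀) ^ 2 * κ := by positivity
    gcongr
    linarith
  have hexc := h.measureReal_rows_compl_le (by linarith) hlog0 _ hrowB
  refine h.le_integral_surp_of_exceptional hC₁ hc₃ hm hΔ hD hΛ hlam K β κ a _ hK0 hβ0 hκ0.le hκβ
    ha rfl ?_ ?_
  · rcases le_or_gt m₀ m with hmm | hmm
    · refine le_trans ?_ (exceptional_linear_le hm1 (by positivity) hmm)
      gcongr
    -- For bounded `m`, the factor `m ^ (-10)` need not beat the constants. Here the trivial row
    -- bound and `1 ≤ Δ * lam ≤ κ * β ^ 2` leave no exceptional outcomes.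
    · have hempty : {ω | ∀ v, ∑ w, G.discr μ v w ω ^ 2 ≤ K * β ^ 2}ᶜ = ∅ := by
        rw [Set.compl_empty_iff, Set.eq_univ_iff_forall]
        intro ω v
        refine (h.sum_discr_sq_le v ω).trans ?_
        calc (G.Y.card : ℝ) ^ 2 ≤ (C₁ * m₀) ^ 2 := by
              have : C₁ * m ≤ C₁ * m₀ := by gcongr
              exact pow_le_pow_left₀ (Nat.cast_nonneg _) (hYle.trans this) 2
          _ = (C₁ * m₀) ^ 2 * 1 := (mul_one _).symm
          _ ≤ (C₁ * m₀) ^ 2 * (κ * β ^ 2) := by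
              gcongr
              linarith
          _ ≤ K * β ^ 2 := by
              rw [hK, ← mul_assoc]
              have : 0 ≤ C₄ ^ 2 / ℓ₀ := by positivity
              gcongr
              linarith
      rw [hempty, measureReal_empty, zero_mul]
      positivity
  · refine le_trans ?_ (exceptional_quadratic_le hm)
    gcongr
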